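/- Let $(M,g)$ be a smooth Riemannian manifold of even dimension $d=2n$, possibly with boundary, let $A$ be a smooth $1$-form on $M$ and $B=\mathrm dA$. Let $\mathbf B(q):T_qM\to T_qM$ be the operator defined by $B_q(Q_1,Q_2)=g_q(\mathbf B(q)Q_1,Q_2)$, let $|\cdot|_{g_q^*}$ be the norm on $T_q^*M$ dual to $g_q$, and let $H(q,p)=|p-A(q)|^2_{g^*_q}$ on $T^*M$. Equip $T^*M$ with $\omega=\mathrm d\alpha$, where $\alpha=p\,\mathrm dq$ is the Liouville form. Write $w=(y,\eta)$ and $z=(x,\xi)$ for points of $\mathbf R^{n}\times\mathbf R^n=\mathbf R^{d}$, with the Euclidean norm, $|z_j|^2=x_j^2+\xi_j^2$, $\mathrm d\eta\wedge\mathrm dy=\sum_j\mathrm d\eta_j\wedge\mathrm dy_j$, $\mathrm d\xi\wedge\mathrm dx=\sum_j\mathrm d\xi_j\wedge\mathrm dx_j$, and $B_z(\varepsilon)=\{z\in\mathbf R^d:|z|\le\varepsilon\}$. Let $q_0\in M\setminus\partial M$ be such that $\mathbf B(q_0)$ is invertible and all its (complex) eigenvalues are simple. (This applies in particular when $q_0$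 is the unique non-degenerate minimum of the magnetic intensity $b(q)=\tfrac12\mathrm{Tr}\,[\mathbf B(q)^*\mathbf B(q)]^{1/2}$; no such global assumption is needed here.) Then there are an open neighbourhood $\Omega_0$ of $q_0$, with compact closure contained in $M\setminus\partial M$, smooth functions $\beta_1,\dots,\beta_n:\Omega_0\to(0,\infty)$ such that for every $q\in\Omega_0$ the eigenvalues of $\mathbf B(q)$ are simple and equal to $\pm i\beta_1(q),\dots,\pm i\beta_n(q)$, and $\varepsilon_0>0$, such that for every open neighbourhood $\Omega\subset\Omega_0$ of $q_0$ and every $\varepsilon\in(0,\varepsilon_0]$ there exist symplectomorphisms $$\varphi:(\Omega,B)\to(V,\mathrm d\eta\wedge\mathrm dy),\qquad \Phi:\bigl(V\times B_z(\varepsilon),\ \mathrm d\eta\wedge\mathrm dy+\mathrm d\xi\wedge\mathrm dx\bigr)\to(U,\omega),$$ with $V\subset\mathbf R^d$ open and $U=\Phi(V\times B_z(\varepsilon))\subset T^*M$, where $\Phi$ is the restriction of a symplectomorphism from an open neighbourhood of $V\times B_z(\varepsilon)$ onto an open subset of $T^*M$, such that $\Phi(\varphi(q),0)=(q,A(q))$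 for all $q\in\Omega$ and, with $\hat\beta_j=\beta_j\circ\varphi^{-1}$, $$H\circ\Phi(w,z)=\sum_{j=1}^{n}\hat\beta_j(w)|z_j|^2+\mathcal O(|z|^3)$$ locally uniformly in $w$: every $w_0\in V$ has a neighbourhood on which, for some constant $C$, the remainder is at most $C|z|^3$ for all $z\in B_z(\varepsilon)$. -/

import Mathlib

open Set Filter Topology Bundle
open scoped Manifold ContDiff

noncomputable section

namespace MagneticWell

section General

variable {E : Type*} [NormedAddCommGroup E] [NormedSpace ℝ E]
  {H : Type*} [TopologicalSpace H] (I : ModelWithCorners ℝ E H)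
  {M : Type*} [TopologicalSpace M] [ChartedSpace H M]
  {F : Type*} [NormedAddCommGroup F] [NormedSpace ℝ F]
  {G : Type*} [TopologicalSpace G] (J : ModelWithCorners ℝ F G)
  {N : Type*} [TopologicalSpace N] [ChartedSpace G N]

/-- The representation of a `1`-form `α` in the preferred chart at `c`, i.e. the pullback of `α`
by the inverse of that chart, a `1`-form on the model space. -/
def oneFormInChart (α : ∀ q : M, TangentSpace I q →L[ℝ] ℝ) (c : M) (x : E) : E →L[ℝ] ℝ :=
  (α ((extChartAt I c).symm x)).comp
    (mfderivWithin 𝓘(ℝ, E) I (extChartAt I c).symm (range I) x)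

/-- The exterior derivative of a `1`-form on a manifold,
`dα(X, Y) = (D_X a)(Y) - (D_Y a)(X)` where `a` represents `α` in the preferred chart at the point;
for a smooth form the result does not depend on the chart. -/
def extDerivOneForm (α : ∀ q : M, TangentSpace I q →L[ℝ] ℝ) (q : M) :
    TangentSpace I q →L[ℝ] TangentSpace I q →L[ℝ] ℝ :=
  let D : TangentSpace I q →L[ℝ] E := mfderiv I 𝓘(ℝ, E) (extChartAt I q) q
  let L : E →L[ℝ] E →L[ℝ] ℝ :=
    fderivWithin ℝ (oneFormInChart I α q) (range I) (extChartAt I q q)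
  (ContinuousLinearMap.precomp ℝ D).comp ((L - L.flip).comp D)

theorem extDerivOneForm_apply (α : ∀ q : M, TangentSpace I q →L[ℝ] ℝ) (q : M)
    (X Y : TangentSpace I q) :
    extDerivOneForm I α q X Y =
      fderivWithin ℝ (oneFormInChart I α q) (range I) (extChartAt I q q)
          (mfderiv I 𝓘(ℝ, E) (extChartAt I q) q X) (mfderiv I 𝓘(ℝ, E) (extChartAt I q) q Y)
        - fderivWithin ℝ (oneFormInChart I α q) (range I) (extChartAt I q q)
          (mfderiv I 𝓘(ℝ, E) (extChartAt I q) q Y) (mfderiv I 𝓘(ℝ, E) (extChartAt I q) q X) :=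
  rfl

/-- `f` pulls the `2`-form `τ` back to the `2`-form `σ` at every point of `S`. -/
def PullsBackOn (f : M → N) (S : Set M)
    (τ : ∀ y : N, TangentSpace J y → TangentSpace J y → ℝ)
    (σ : ∀ x : M, TangentSpace I x → TangentSpace I x → ℝ) : Prop :=
  ∀ x ∈ S, ∀ X Y : TangentSpace I x,
    τ (f x) (mfderiv I J f x X) (mfderiv I J f x Y) = σ x X Y

/-- `f`, an open partial homeomorphism, is a symplectomorphism of its (open) source, with the form
`σ`, onto its (open) target, with the form `τ`. -/
structure IsSymplectomorphism (f : OpenPartialHomeomorph M N)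
    (σ : ∀ x : M, TangentSpace I x → TangentSpace I x → ℝ)
    (τ : ∀ y : N, TangentSpace J y → TangentSpace J y → ℝ) : Prop where
  contMDiffOn : ContMDiffOn I J ∞ f f.source
  contMDiffOn_symm : ContMDiffOn J I ∞ f.symm f.target
  pullsBackOn : PullsBackOn I J f f.source τ σ

end General

section Cotangent

variable {E : Type*} [NormedAddCommGroup E] [NormedSpace ℝ E]
  {H : Type*} [TopologicalSpace H] (I : ModelWithCorners ℝ E H)
  (M : Type*) [TopologicalSpace M] [ChartedSpace H M]

/-- The cotangent bundle `T*M`. -/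
abbrev CotangentBundle [IsManifold I ∞ M] : Type _ :=
  TotalSpace (E →L[ℝ] ℝ) (fun q : M => TangentSpace I q →L[ℝ] Trivial M ℝ q)

variable [IsManifold I ∞ M]

/-- The Liouville form `p dq` on `T*M`: `V ↦ p (π_* V)` at the point `(q, p)`. -/
def liouvilleForm (ζ : CotangentBundle I M) :
    TangentSpace (I.prod 𝓘(ℝ, E →L[ℝ] ℝ)) ζ →L[ℝ] ℝ :=
  (ζ.2 : TangentSpace I ζ.1 →L[ℝ] ℝ).comp
    (mfderiv (I.prod 𝓘(ℝ, E →L[ℝ] ℝ)) I (fun ζ : CotangentBundle I M => ζ.1) ζ)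

/-- The canonical symplectic form `dp ∧ dq = d(p dq)` on `T*M`. -/
def canonicalForm (ζ : CotangentBundle I M)
    (X Y : TangentSpace (I.prod 𝓘(ℝ, E →L[ℝ] ℝ)) ζ) : ℝ :=
  extDerivOneForm (I.prod 𝓘(ℝ, E →L[ℝ] ℝ)) (liouvilleForm I M) ζ X Y

end Cotangent

section Magnetic

variable {E : Type*} [NormedAddCommGroup E] [NormedSpace ℝ E] [FiniteDimensional ℝ E]
  {H : Type*} [TopologicalSpace H] {I : ModelWithCorners ℝ E H}
  {M : Type*} [TopologicalSpace M] [ChartedSpace H M] [IsManifold I ∞ M]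

instance (q : M) : FiniteDimensional ℝ (TangentSpace I q) :=
  inferInstanceAs (FiniteDimensional ℝ E)

/-- Smooth Riemannian metrics on `M`. -/
abbrev RiemannianMetric (I : ModelWithCorners ℝ E H) (M : Type*) [TopologicalSpace M]
    [ChartedSpace H M] [IsManifold I ∞ M] : Type _ :=
  ContMDiffRiemannianMetric I ∞ E (fun q : M => TangentSpace I q)

/-- Smooth `1`-forms on `M`, i.e. smooth sections of `T*M`. -/
abbrev OneForm (I : ModelWithCorners ℝ E H) (M : Type*) [TopologicalSpace M]
    [ChartedSpace H M] [IsManifold I ∞ M] : Type _ :=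
  ContMDiffSection I (E →L[ℝ] ℝ) ∞ (fun q : M => TangentSpace I q →L[ℝ] Trivial M ℝ q)

variable (g : RiemannianMetric I M) (A : OneForm I M)

/-- The isomorphism `T*_q M → T_q M` given by the metric, inverse of `Q ↦ g_q(Q, ·)`. -/
def sharp (q : M) : (TangentSpace I q →L[ℝ] ℝ) →L[ℝ] TangentSpace I q :=
  (g.inner q).inverse

theorem isInvertible_inner (q : M) : (g.inner q).IsInvertible := by
  have hinj : Function.Injective (g.inner q).toLinearMap := by
    rw [← LinearMap.ker_eq_bot, LinearMap.ker_eq_bot']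
    intro v hv
    by_contra h
    have := g.pos q v h
    have h0 : g.inner q v = 0 := hv
    rw [h0] at this
    simp at this
  have hfin : Module.finrank ℝ (TangentSpace I q) =
      Module.finrank ℝ (TangentSpace I q →L[ℝ] ℝ) := by
    change Module.finrank ℝ E = Module.finrank ℝ (E →L[ℝ] ℝ)
    rw [← (LinearMap.toContinuousLinearMap (𝕜 := ℝ) (E := E) (F' := ℝ)).finrank_eq]
    exact Subspace.dual_finrank_eq.symm
  let e : E ≃ₗ[ℝ] (E →L[ℝ] ℝ) := LinearMap.linearEquivOfInjective
    (V := E) (V₂ := E →L[ℝ] ℝ) (g.inner q).toLinearMap hinj hfin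
  exact ⟨e.toContinuousLinearEquiv, by ext v w; rfl⟩

theorem inner_sharp (q : M) (p : TangentSpace I q →L[ℝ] ℝ) : g.inner q (sharp g q p) = p :=
  ((isInvertible_inner g q).inverse_apply_eq.mp rfl).symm

/-- The square of the norm on `T*_q M` dual to `g_q`, i.e. `g_q(p♯, p♯)`. -/
def dualNormSq (q : M) (p : TangentSpace I q →L[ℝ] ℝ) : ℝ :=
  g.inner q (sharp g q p) (sharp g q p)

/-- The magnetic `2`-form `B = dA`. -/
def magneticForm (q : M) : TangentSpace I q →L[ℝ] TangentSpace I q →L[ℝ] ℝ :=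
  extDerivOneForm I (fun q => A q) q

/-- The magnetic operator `𝐁(q) : T_q M → T_q M`. -/
def magneticOperator (q : M) : TangentSpace I q →L[ℝ] TangentSpace I q :=
  (sharp g q).comp (magneticForm A q)

/-- The defining relation of the magnetic operator: `B_q(X, Y) = g_q(𝐁(q) X, Y)`. -/
theorem magneticForm_eq_inner (q : M) (X Y : TangentSpace I q) :
    magneticForm A q X Y = g.inner q (magneticOperator g A q X) Y := by
  rw [magneticOperator, ContinuousLinearMap.comp_apply, inner_sharp]

/-- The complex eigenvalues of `𝐁(q)`, counted with multiplicity. -/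
def magneticEigenvalues (q : M) : Multiset ℂ :=
  ((magneticOperator g A q : TangentSpace I q →ₗ[ℝ] TangentSpace I q).charpoly.map
    (algebraMap ℝ ℂ)).roots

/-- The classical Hamiltonian `H(q, p) = |p - A(q)|²` on `T*M`. -/
def hamiltonian (ζ : CotangentBundle I M) : ℝ :=
  dualNormSq g ζ.1 (ζ.2 - A ζ.1)

end Magnetic

/-- `ℝ²ⁿ` with its Euclidean norm. A point `z = (x, ξ)` has `x_j = z (inl j)`, `ξ_j = z (inr j)`. -/
abbrev PhaseSpace (n : ℕ) : Type := EuclideanSpace ℝ (Fin n ⊕ Fin n)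

/-- The symplectic form `dξ ∧ dx = ∑_j dξ_j ∧ dx_j` on `ℝ²ⁿ`. -/
def stdForm (n : ℕ) (X Y : PhaseSpace n) : ℝ :=
  ∑ j : Fin n, (X (Sum.inr j) * Y (Sum.inl j) - Y (Sum.inr j) * X (Sum.inl j))

/-- The symplectic form `dη ∧ dy + dξ ∧ dx` on `ℝ²ⁿ × ℝ²ⁿ`. -/
def prodForm (n : ℕ) (X Y : PhaseSpace n × PhaseSpace n) : ℝ :=
  stdForm n X.1 Y.1 + stdForm n X.2 Y.2

/-- `|z_j|² = x_j² + ξ_j²`. -/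
def normSqAt {n : ℕ} (z : PhaseSpace n) (j : Fin n) : ℝ :=
  z (Sum.inl j) ^ 2 + z (Sum.inr j) ^ 2

end MagneticWell

end

open Set Filter Topology Bundle
open scoped Manifold ContDiff

noncomputable section

namespace MagneticWell

section Instances

variable {E F G K : Type*} [NormedAddCommGroup E] [NormedSpace ℝ E] [NormedAddCommGroup F]
  [NormedSpace ℝ F] [NormedAddCommGroup G] [NormedSpace ℝ G] [NormedAddCommGroup K]
  [NormedSpace ℝ K]

instance normedAddCommGroupBilinear : NormedAddCommGroup (E →L[ℝ] F →L[ℝ] G) :=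
  ContinuousLinearMap.toNormedAddCommGroup

instance normedSpaceBilinear : NormedSpace ℝ (E →L[ℝ] F →L[ℝ] G) :=
  ContinuousLinearMap.toNormedSpace

instance normedAddCommGroupTrilinear : NormedAddCommGroup (E →L[ℝ] F →L[ℝ] G →L[ℝ] K) :=
  ContinuousLinearMap.toNormedAddCommGroup

instance normedSpaceTrilinear : NormedSpace ℝ (E →L[ℝ] F →L[ℝ] G →L[ℝ] K) :=
  ContinuousLinearMap.toNormedSpace

end Instances

section InverseFunction

variable {E F : Type*} [NormedAddCommGroup E] [NormedSpace ℝ E] [CompleteSpace E]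
  [NormedAddCommGroup F] [NormedSpace ℝ F]

/-- The inverse function theorem for smooth maps, with smoothness on open sets. -/
theorem exists_smooth_inverse {f : E → F} {U : Set E} (hU : IsOpen U) (hf : ContDiffOn ℝ ∞ f U)
    {x : E} (hx : x ∈ U) {f' : E ≃L[ℝ] F} (hf' : HasFDerivAt f (f' : E →L[ℝ] F) x) :
    ∃ e : OpenPartialHomeomorph E F, x ∈ e.source ∧ e.source ⊆ U ∧ (∀ y, e y = f y) ∧
      ContDiffOn ℝ ∞ e e.source ∧ ContDiffOn ℝ ∞ e.symm e.target := by
  have hfx : ContDiffAt ℝ ∞ f x := hf.contDiffAt (hU.mem_nhds hx)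
  let e₀ := hfx.toOpenPartialHomeomorph f hf' (by simp)
  have he₀ : (e₀ : E → F) = f := rfl
  have hx₀ : x ∈ e₀.source := hfx.mem_toOpenPartialHomeomorph_source hf' (by simp)
  have hcont : ContinuousAt (fderiv ℝ f) x :=
    (hf.continuousOn_fderiv_of_isOpen hU (by simp)).continuousAt (hU.mem_nhds hx)
  have hinv : {y | ∃ A : E ≃L[ℝ] F, (A : E →L[ℝ] F) = fderiv ℝ f y} ∈ 𝓝 x := by
    have := ContinuousLinearEquiv.nhds f'
    rw [← hf'.fderiv] at this
    exact hcont this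
  obtain ⟨W, hWs, hWo, hxW⟩ := mem_nhds_iff.1 (inter_mem hinv (hU.mem_nhds hx))
  refine ⟨e₀.restrOpen W hWo, ?_, ?_, fun y => rfl, ?_, ?_⟩
  · exact ⟨hx₀, hxW⟩
  · rintro y ⟨-, hy⟩
    exact (hWs hy).2
  · intro y hy
    exact (hf.contDiffAt (hU.mem_nhds (hWs hy.2).2)).contDiffWithinAt
  · intro y hy
    have hmem := (e₀.restrOpen W hWo).map_target hy
    obtain ⟨A, hA⟩ := (hWs hmem.2).1
    have hs := hf.contDiffAt (hU.mem_nhds (hWs hmem.2).2)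
    refine (OpenPartialHomeomorph.contDiffAt_symm (f₀' := A) _ hy ?_ hs).contDiffWithinAt
    rw [hA]
    exact (hs.differentiableAt (by simp)).hasFDerivAt

end InverseFunction

section Superposition

universe u

variable {K : Type*} [TopologicalSpace K] [CompactSpace K]
  {F G : Type u} [NormedAddCommGroup F] [NormedSpace ℝ F] [NormedAddCommGroup G] [NormedSpace ℝ G]

instance normedAddCommGroupCurvesOfMaps : NormedAddCommGroup C(K, F →L[ℝ] G) :=
  ContinuousMap.instNormedAddCommGroup

instance normedSpaceCurvesOfMaps : NormedSpace ℝ C(K, F →L[ℝ] G) :=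
  ContinuousMap.normedSpace

/-- Pointwise application of a continuous family of linear maps to a continuous family of
vectors. -/
def pointwiseApply (K : Type*) [TopologicalSpace K] [CompactSpace K]
    (F G : Type u) [NormedAddCommGroup F] [NormedSpace ℝ F] [NormedAddCommGroup G]
    [NormedSpace ℝ G] : C(K, F →L[ℝ] G) →L[ℝ] C(K, F) →L[ℝ] C(K, G) :=
  LinearMap.mkContinuous₂
    (LinearMap.mk₂ ℝ (fun (A : C(K, F →L[ℝ] G)) (u : C(K, F)) =>
        (⟨fun t => A t (u t), by fun_prop⟩ : C(K, G)))
      (fun A A' u => by ext; simp) (fun c A u => by ext; simp)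
      (fun A u u' => by ext; simp) (fun c A u => by ext; simp)) 1
    (fun A u => by
      rw [ContinuousMap.norm_le _ (by positivity)]
      intro t
      rw [one_mul]
      exact ((A t).le_opNorm _).trans
        (mul_le_mul (A.norm_coe_le_norm t) (u.norm_coe_le_norm t) (norm_nonneg _) (norm_nonneg _)))

@[simp]
theorem pointwiseApply_apply (A : C(K, F →L[ℝ] G)) (u : C(K, F)) (t : K) :
    pointwiseApply K F G A u t = A t (u t) := rfl

/-- The superposition operator `γ ↦ f ∘ γ` has derivative `δ ↦ (Df ∘ γ) δ`. -/
theorem hasFDerivAt_superposition {f : C(F, G)} {f' : C(F, F →L[ℝ] G)}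
    (hf : ∀ x, HasFDerivAt f (f' x) x) (γ : C(K, F)) :
    HasFDerivAt (fun γ : C(K, F) => f.comp γ) (pointwiseApply K F G (f'.comp γ)) γ := by
  rw [hasFDerivAt_iff_isLittleO_nhds_zero, Asymptotics.isLittleO_iff]
  intro c hc
  have hcont : Continuous (fun γ : C(K, F) => f'.comp γ) := ContinuousMap.continuous_postcomp f'
  obtain ⟨δ, hδ, hδ'⟩ := Metric.continuousAt_iff.1 (hcont.continuousAt (x := γ)) c hc
  filter_upwards [Metric.ball_mem_nhds (0 : C(K, F)) hδ] with h hh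
  rw [ContinuousMap.norm_le _ (by positivity)]
  intro t
  have hht : ‖h t‖ < δ := (h.norm_coe_le_norm t).trans_lt (by simpa using hh)
  have key := (convex_ball (γ t) δ).norm_image_sub_le_of_norm_hasFDerivWithin_le'
    (f := f) (f' := f') (φ := f' (γ t)) (C := c) (x := γ t) (y := γ t + h t)
    (fun y _ => (hf y).hasFDerivWithinAt) ?_ (by simpa using hδ) (by simpa using hht)
  · have h1 : ‖f (γ t + h t) - f (γ t) - f' (γ t) (h t)‖ ≤ c * ‖h t‖ := by simpa using key
    exact h1.trans (by gcongr; exact h.norm_coe_le_norm t)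
  · intro y hy
    have h2 : dist (γ + ContinuousMap.const K (y - γ t)) γ < δ := by
      rw [dist_eq_norm, add_sub_cancel_left, ContinuousMap.norm_lt_iff _ hδ]
      intro s
      simpa [dist_eq_norm] using hy
    have h3 := (ContinuousMap.dist_apply_le_dist t).trans_lt (hδ' h2)
    simpa [dist_eq_norm] using h3.le

theorem contDiff_superposition_nat (n : ℕ) : ∀ {G : Type u} [NormedAddCommGroup G] [NormedSpace ℝ G]
    {f : C(F, G)} (_ : ContDiff ℝ ∞ f), ContDiff ℝ n (fun γ : C(K, F) => f.comp γ) := by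
  induction n with
  | zero =>
    intro G _ _ f hf
    exact contDiff_zero.2 (ContinuousMap.continuous_postcomp f)
  | succ n ih =>
    intro G _ _ f hf
    have hd : ContDiff ℝ ∞ (fderiv ℝ f) := hf.fderiv_right (by simp)
    let f' : C(F, F →L[ℝ] G) := ⟨fderiv ℝ f, hd.continuous⟩
    refine contDiff_succ_iff_hasFDerivAt.2 ⟨fun γ => pointwiseApply K F G (f'.comp γ), ?_, ?_⟩
    · exact (pointwiseApply K F G).contDiff.comp (ih (f := f') hd)
    · exact fun γ => hasFDerivAt_superposition
        (fun x => (hf.differentiable (by simp) x).hasFDerivAt) γ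

theorem contDiff_superposition {f : C(F, G)} (hf : ContDiff ℝ ∞ f) :
    ContDiff ℝ ∞ (fun γ : C(K, F) => f.comp γ) :=
  contDiff_infty.2 fun n => contDiff_superposition_nat n hf

end Superposition

section Flow

universe u

variable {F : Type u} [NormedAddCommGroup F]

/-- The extension of a curve on the unit interval to the real line, constant on both sides. -/
def extendCurve (γ : C(unitInterval, F)) (t : ℝ) : F :=
  γ (projIcc 0 1 zero_le_one t)

theorem continuous_extendCurve (γ : C(unitInterval, F)) : Continuous (extendCurve γ) :=
  γ.continuous.comp continuous_projIcc

theorem extendCurve_coe (γ : C(unitInterval, F)) (t : unitInterval) : extendCurve γ t = γ t := by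
  simp [extendCurve]

variable [NormedSpace ℝ F]

/-- Integration from `0`, as an operator on curves. -/
def primitiveCLM (F : Type u) [NormedAddCommGroup F] [NormedSpace ℝ F] [CompleteSpace F] :
    C(unitInterval, F) →L[ℝ] C(unitInterval, F) :=
  LinearMap.mkContinuous
    { toFun := fun γ => ⟨fun t => ∫ s in (0 : ℝ)..t, extendCurve γ s,
        (intervalIntegral.continuous_primitive
          (fun a b => (continuous_extendCurve γ).intervalIntegrable a b) 0).comp
          continuous_subtype_val⟩
      map_add' := fun γ γ' => by
        ext t
        exact intervalIntegral.integral_add ((continuous_extendCurve γ).intervalIntegrable _ _)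
          ((continuous_extendCurve γ').intervalIntegrable _ _)
      map_smul' := fun c γ => by
        ext t
        exact intervalIntegral.integral_smul c _ } 1
    (fun γ => by
      rw [ContinuousMap.norm_le _ (by positivity)]
      intro t
      have := intervalIntegral.norm_integral_le_of_norm_le_const (a := 0) (b := (t : ℝ))
        (f := extendCurve γ) (C := ‖γ‖) (fun s _ => γ.norm_coe_le_norm _)
      refine this.trans ?_
      rw [sub_zero, abs_of_nonneg t.2.1, one_mul]
      exact mul_le_of_le_one_right (norm_nonneg _) t.2.2)

theorem primitiveCLM_apply [CompleteSpace F] (γ : C(unitInterval, F)) (t : unitInterval) :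
    primitiveCLM F γ t = ∫ s in (0 : ℝ)..t, extendCurve γ s := rfl

/-- The graph `t ↦ (t, γ t)` of a curve. -/
def graphCurve (γ : C(unitInterval, F)) : C(unitInterval, ℝ × F) :=
  ⟨fun t => (t, γ t), by fun_prop⟩

theorem hasFDerivAt_graphCurve (γ : C(unitInterval, F)) :
    HasFDerivAt (graphCurve (F := F))
      ((ContinuousLinearMap.inr ℝ ℝ F).compLeftContinuous ℝ unitInterval) γ := by
  have : graphCurve (F := F) = fun γ => (⟨fun t => ((t : ℝ), (0 : F)), by fun_prop⟩ :
      C(unitInterval, ℝ × F)) + (ContinuousLinearMap.inr ℝ ℝ F).compLeftContinuous ℝ unitInterval γ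
      := by
    ext γ t <;> simp [graphCurve]
  rw [this]
  exact (ContinuousLinearMap.hasFDerivAt _).const_add _

theorem contDiff_graphCurve : ContDiff ℝ ∞ (graphCurve (F := F)) := by
  have : graphCurve (F := F) = fun γ => (⟨fun t => ((t : ℝ), (0 : F)), by fun_prop⟩ :
      C(unitInterval, ℝ × F)) + (ContinuousLinearMap.inr ℝ ℝ F).compLeftContinuous ℝ unitInterval γ
      := by
    ext γ t <;> simp [graphCurve]
  rw [this]
  exact contDiff_const.add (ContinuousLinearMap.contDiff _)

variable [CompleteSpace F]

theorem hasDerivWithinAt_of_eq_add_primitive {γ δ : C(unitInterval, F)} {x : F}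
    (h : γ = ContinuousMap.const _ x + primitiveCLM F δ) {t : ℝ} (ht : t ∈ Icc (0 : ℝ) 1) :
    HasDerivWithinAt (extendCurve γ) (extendCurve δ t) (Icc 0 1) t := by
  have h1 : HasDerivAt (fun t => x + ∫ s in (0 : ℝ)..t, extendCurve δ s) (extendCurve δ t) t :=
    ((continuous_extendCurve δ).integral_hasStrictDerivAt 0 t).hasDerivAt.const_add x
  refine h1.hasDerivWithinAt.congr_of_mem (fun s hs => ?_) ht
  have := extendCurve_coe γ ⟨s, hs⟩
  simp only at this
  rw [this, h]
  simp [primitiveCLM_apply]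

/-- Smooth dependence on the initial condition for the equation `γ' = f (t, γ)`, near an
equilibrium `p₀` at which `f (t, ·)` vanishes to second order. The third property is the
variational equation, the last one says that nearby equilibria are fixed. -/
theorem exists_smooth_flow {f : ℝ × F → F} (hf : ContDiff ℝ ∞ f) {p₀ : F}
    (h0 : ∀ t ∈ Icc (0 : ℝ) 1, f (t, p₀) = 0)
    (h1 : ∀ t ∈ Icc (0 : ℝ) 1, ∀ v, fderiv ℝ f (t, p₀) (0, v) = 0) :
    ∃ (N : Set F) (Γ : F → C(unitInterval, F)), IsOpen N ∧ p₀ ∈ N ∧ ContDiffOn ℝ ∞ Γ N ∧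
      Γ p₀ = ContinuousMap.const _ p₀ ∧
      (∀ x ∈ N, Γ x 0 = x ∧ ∀ t ∈ Icc (0 : ℝ) 1,
        HasDerivWithinAt (extendCurve (Γ x)) (f (t, extendCurve (Γ x) t)) (Icc 0 1) t) ∧
      (∀ x ∈ N, ∀ v, fderiv ℝ Γ x v 0 = v ∧ ∀ t ∈ Icc (0 : ℝ) 1,
        HasDerivWithinAt (extendCurve (fderiv ℝ Γ x v))
          (fderiv ℝ f (t, extendCurve (Γ x) t) (0, extendCurve (fderiv ℝ Γ x v) t)) (Icc 0 1) t) ∧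
      (∀ x ∈ N, (∀ t ∈ Icc (0 : ℝ) 1, f (t, x) = 0) → Γ x = ContinuousMap.const _ x) := by
  let fc : C(ℝ × F, F) := ⟨f, hf.continuous⟩
  have hdf : ContDiff ℝ ∞ (fderiv ℝ f) := hf.fderiv_right (by simp)
  let fc' : C(ℝ × F, (ℝ × F) →L[ℝ] F) := ⟨fderiv ℝ f, hdf.continuous⟩
  let S : C(unitInterval, F) → C(unitInterval, F) := fun γ => γ - primitiveCLM F (fc.comp (graphCurve γ))
  let S' : C(unitInterval, F) → C(unitInterval, F) →L[ℝ] C(unitInterval, F) := fun γ =>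
    ContinuousLinearMap.id ℝ _ - (primitiveCLM F).comp
      ((pointwiseApply unitInterval (ℝ × F) F (fc'.comp (graphCurve γ))).comp
        ((ContinuousLinearMap.inr ℝ ℝ F).compLeftContinuous ℝ unitInterval))
  have hS : ∀ γ, HasFDerivAt S (S' γ) γ := fun γ =>
    (hasFDerivAt_id γ).sub ((primitiveCLM F).hasFDerivAt.comp γ
      ((hasFDerivAt_superposition (f := fc) (f' := fc')
        (fun x => (hf.differentiable (by simp) x).hasFDerivAt) (graphCurve γ)).comp γ
        (hasFDerivAt_graphCurve γ)))
  have hSs : ContDiff ℝ ∞ S := contDiff_id.sub ((primitiveCLM F).contDiff.comp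
    ((contDiff_superposition (f := fc) hf).comp contDiff_graphCurve))
  have hfix : ∀ x, (∀ t ∈ Icc (0 : ℝ) 1, f (t, x) = 0) →
      S (ContinuousMap.const _ x) = ContinuousMap.const _ x := by
    intro x hx
    have : fc.comp (graphCurve (ContinuousMap.const _ x)) = 0 := by
      ext t
      exact hx t t.2
    simp only [S, this, map_zero, sub_zero]
  have hSp : HasFDerivAt S ((ContinuousLinearEquiv.refl ℝ C(unitInterval, F) :
      C(unitInterval, F) →L[ℝ] C(unitInterval, F))) (ContinuousMap.const _ p₀) := by
    convert hS (ContinuousMap.const _ p₀) using 1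
    have : (pointwiseApply unitInterval (ℝ × F) F
        (fc'.comp (graphCurve (ContinuousMap.const _ p₀)))).comp
        ((ContinuousLinearMap.inr ℝ ℝ F).compLeftContinuous ℝ unitInterval) = 0 := by
      ext v t
      exact h1 t t.2 (v t)
    simp only [S', this, ContinuousLinearMap.comp_zero, sub_zero]
    rfl
  obtain ⟨e, hpe, -, he, -, hes⟩ := exists_smooth_inverse isOpen_univ hSs.contDiffOn
    (mem_univ _) hSp
  have hc : Continuous (fun x : F => ContinuousMap.const unitInterval x) :=
    ContinuousMap.continuous_const'
  let cst : F →L[ℝ] C(unitInterval, F) :=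
    { toFun := fun x => ContinuousMap.const unitInterval x
      map_add' := fun x y => rfl
      map_smul' := fun c x => rfl
      cont := hc }
  have hcst : ∀ x, cst x = ContinuousMap.const unitInterval x := fun x => rfl
  let Γ : F → C(unitInterval, F) := fun x => e.symm (cst x)
  let N : Set F := cst ⁻¹' (e.target ∩ e.source)
  have hN : IsOpen N := (e.open_target.inter e.open_source).preimage cst.continuous
  have hΓs : ContDiffOn ℝ ∞ Γ N := hes.comp cst.contDiff.contDiffOn fun x hx => hx.1
  have hSΓ : ∀ x ∈ N, S (Γ x) = cst x := fun x hx => by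
    rw [← he]
    exact e.right_inv hx.1
  have hΓd : ∀ x ∈ N, HasFDerivAt Γ (fderiv ℝ Γ x) x := fun x hx =>
    ((hΓs.contDiffAt (hN.mem_nhds hx)).differentiableAt (by simp)).hasFDerivAt
  have hSd : ∀ x ∈ N, (S' (Γ x)).comp (fderiv ℝ Γ x) = cst := by
    intro x hx
    have hcomp := (hS (Γ x)).comp x (hΓd x hx)
    refine hcomp.unique (cst.hasFDerivAt.congr_of_eventuallyEq ?_)
    filter_upwards [hN.mem_nhds hx] with y hy using hSΓ y hy
  have hfixΓ : ∀ x ∈ N, (∀ t ∈ Icc (0 : ℝ) 1, f (t, x) = 0) → Γ x = ContinuousMap.const _ x := by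
    intro x hx hfx
    have : e (cst x) = cst x := by
      rw [he]
      exact hfix x hfx
    calc Γ x = e.symm (e (cst x)) := by rw [this]
      _ = cst x := e.left_inv hx.2
  have hp₀N : p₀ ∈ N := by
    refine ⟨?_, hpe⟩
    have := e.map_source hpe
    rwa [he, hfix p₀ h0] at this
  refine ⟨N, Γ, hN, hp₀N, hΓs, hfixΓ p₀ hp₀N h0, ?_, ?_, hfixΓ⟩
  · intro x hx
    have heq : Γ x = ContinuousMap.const _ x + primitiveCLM F (fc.comp (graphCurve (Γ x))) :=
      sub_eq_iff_eq_add.1 (hSΓ x hx)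
    refine ⟨?_, fun t ht => ?_⟩
    · rw [heq]
      simp [primitiveCLM_apply]
    · convert hasDerivWithinAt_of_eq_add_primitive heq ht using 1
      simp [extendCurve, fc, graphCurve, projIcc_of_mem _ ht]
  · intro x hx v
    have heq : fderiv ℝ Γ x v = ContinuousMap.const _ v + primitiveCLM F
        (pointwiseApply unitInterval (ℝ × F) F (fc'.comp (graphCurve (Γ x)))
          ((ContinuousLinearMap.inr ℝ ℝ F).compLeftContinuous ℝ unitInterval (fderiv ℝ Γ x v))) :=
      sub_eq_iff_eq_add.1 (DFunLike.congr_fun (hSd x hx) v)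
    refine ⟨?_, fun t ht => ?_⟩
    · rw [heq]
      simp [primitiveCLM_apply]
    · convert hasDerivWithinAt_of_eq_add_primitive heq ht using 1
      simp [extendCurve, fc', graphCurve, projIcc_of_mem _ ht]

end Flow

section Moser

universe u

variable {F : Type u} [NormedAddCommGroup F] [NormedSpace ℝ F]

/-- Antisymmetrization `b ↦ b(X, Y) - b(Y, X)` of bilinear forms. -/
def altCLM (F : Type u) [NormedAddCommGroup F] [NormedSpace ℝ F] :
    (F →L[ℝ] F →L[ℝ] ℝ) →L[ℝ] (F →L[ℝ] F →L[ℝ] ℝ) :=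
  ContinuousLinearMap.id ℝ _ -
    (ContinuousLinearMap.flipₗᵢ ℝ F F ℝ).toContinuousLinearEquiv.toContinuousLinearMap

@[simp]
theorem altCLM_apply (b : F →L[ℝ] F →L[ℝ] ℝ) (X Y : F) : altCLM F b X Y = b X Y - b Y X := rfl

/-- The exterior derivative of a `1`-form on a vector space. -/
def dForm (θ : F → F →L[ℝ] ℝ) (x : F) : F →L[ℝ] F →L[ℝ] ℝ :=
  altCLM F (fderiv ℝ θ x)

theorem dForm_apply (θ : F → F →L[ℝ] ℝ) (x X Y : F) :
    dForm θ x X Y = fderiv ℝ θ x X Y - fderiv ℝ θ x Y X := rfl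

theorem dForm_add {θ η : F → F →L[ℝ] ℝ} {x : F} (hθ : DifferentiableAt ℝ θ x)
    (hη : DifferentiableAt ℝ η x) : dForm (θ + η) x = dForm θ x + dForm η x := by
  rw [dForm, fderiv_add hθ hη, map_add]
  rfl

theorem contDiffOn_dForm {θ : F → F →L[ℝ] ℝ} {U : Set F} (hU : IsOpen U)
    (hθ : ContDiffOn ℝ ∞ θ U) : ContDiffOn ℝ ∞ (dForm θ) U :=
  (altCLM F).contDiff.comp_contDiffOn (hθ.fderiv_of_isOpen hU (by simp))

theorem isOpen_isInvertible {E G : Type*} [NormedAddCommGroup E] [NormedSpace ℝ E]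
    [CompleteSpace E] [NormedAddCommGroup G] [NormedSpace ℝ G] :
    IsOpen {T : E →L[ℝ] G | T.IsInvertible} :=
  ContinuousLinearEquiv.isOpen

theorem contDiffAt_inverse_of_isInvertible {E G : Type*} [NormedAddCommGroup E] [NormedSpace ℝ E]
    [CompleteSpace E] [NormedAddCommGroup G] [NormedSpace ℝ G] {T : E →L[ℝ] G}
    (hT : T.IsInvertible) : ContDiffAt ℝ ∞ ContinuousLinearMap.inverse T := by
  obtain ⟨e, rfl⟩ := hT
  exact contDiffAt_map_inverse e

theorem two_le_infty : (2 : WithTop ℕ∞) ≤ ∞ :=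
  WithTop.coe_le_coe.2 (le_top : (2 : ℕ∞) ≤ ⊤)

theorem hasFDerivAt_dForm {θ : F → F →L[ℝ] ℝ} {x : F}
    (hθ : DifferentiableAt ℝ (fderiv ℝ θ) x) :
    HasFDerivAt (dForm θ) ((altCLM F).comp (fderiv ℝ (fderiv ℝ θ) x)) x :=
  (altCLM F).hasFDerivAt.comp x hθ.hasFDerivAt

/-- The infinitesimal computation behind Moser's method: along a vector field `X` with
`i_X ω = -σ`, where `ω = d(α + t σ)`, the Lie derivative of `ω` compensates `dσ`. -/
theorem moser_derivative_eq_zero {U : Set F} (hU : IsOpen U) {α σ : F → F →L[ℝ] ℝ}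
    (hα : ContDiffOn ℝ ∞ α U) (hσ : ContDiffOn ℝ ∞ σ U) {X : ℝ × F → F} {t : ℝ} {y : F}
    (hy : y ∈ U) (hX : DifferentiableAt ℝ X (t, y))
    (hXσ : ∀ᶠ p in 𝓝 (t, y), (dForm α p.2 + p.1 • dForm σ p.2) (X p) = -σ p.2) :
    ∃ Ω' : ℝ × F →L[ℝ] F →L[ℝ] F →L[ℝ] ℝ,
      HasFDerivAt (fun p : ℝ × F => dForm α p.2 + p.1 • dForm σ p.2) Ω' (t, y) ∧
      ∀ u v : F, Ω' (1, X (t, y)) u v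
        + (dForm α y + t • dForm σ y) (fderiv ℝ X (t, y) (0, u)) v
        + (dForm α y + t • dForm σ y) u (fderiv ℝ X (t, y) (0, v)) = 0 := by
  have hyU := hU.mem_nhds hy
  have hα1 : DifferentiableAt ℝ (fderiv ℝ α) y :=
    ((hα.fderiv_of_isOpen (m := ∞) hU (by simp)).contDiffAt hyU).differentiableAt (by simp)
  have hσ1 : DifferentiableAt ℝ (fderiv ℝ σ) y :=
    ((hσ.fderiv_of_isOpen (m := ∞) hU (by simp)).contDiffAt hyU).differentiableAt (by simp)
  have hσ0 : DifferentiableAt ℝ σ y := (hσ.contDiffAt hyU).differentiableAt (by simp)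
  have hαs : ∀ a b, fderiv ℝ (fderiv ℝ α) y a b = fderiv ℝ (fderiv ℝ α) y b a :=
    fun a b => ((hα.contDiffAt hyU).isSymmSndFDerivAt (by simpa using two_le_infty)) a b
  have hσs : ∀ a b, fderiv ℝ (fderiv ℝ σ) y a b = fderiv ℝ (fderiv ℝ σ) y b a :=
    fun a b => ((hσ.contDiffAt hyU).isSymmSndFDerivAt (by simpa using two_le_infty)) a b
  have hα2 : HasFDerivAt (fun p : ℝ × F => dForm α p.2)
      (((altCLM F).comp (fderiv ℝ (fderiv ℝ α) y)).comp (ContinuousLinearMap.snd ℝ ℝ F)) (t, y) :=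
    (hasFDerivAt_dForm (x := (t, y).2) hα1).comp (t, y) hasFDerivAt_snd
  have hσ2 : HasFDerivAt (fun p : ℝ × F => dForm σ p.2)
      (((altCLM F).comp (fderiv ℝ (fderiv ℝ σ) y)).comp (ContinuousLinearMap.snd ℝ ℝ F)) (t, y) :=
    (hasFDerivAt_dForm (x := (t, y).2) hσ1).comp (t, y) hasFDerivAt_snd
  have hΩ : HasFDerivAt (fun p : ℝ × F => dForm α p.2 + p.1 • dForm σ p.2) _ (t, y) :=
    hα2.add ((hasFDerivAt_fst (𝕜 := ℝ) (p := (t, y))).smul hσ2)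
  refine ⟨_, hΩ, fun u v => ?_⟩
  have hl := hΩ.clm_apply hX.hasFDerivAt
  have hr : HasFDerivAt (fun p : ℝ × F => -σ p.2)
      (-(fderiv ℝ σ y).comp (ContinuousLinearMap.snd ℝ ℝ F)) (t, y) :=
    (hσ0.hasFDerivAt.comp (t, y) hasFDerivAt_snd).neg
  have heq := (hl.congr_of_eventuallyEq (hXσ.mono fun p hp => hp.symm)).unique hr
  have key : ∀ a b, _ := fun a b => DFunLike.congr_fun (DFunLike.congr_fun heq (0, a)) b
  have k1 := key u v
  have k2 := key v u
  simp [dForm_apply] at k1 k2 ⊢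
  have e1 := DFunLike.congr_fun (hαs (X (t, y)) u) v
  have e2 := DFunLike.congr_fun (hαs (X (t, y)) v) u
  have e3 := DFunLike.congr_fun (hαs u v) (X (t, y))
  have e4 := DFunLike.congr_fun (hσs (X (t, y)) u) v
  have e5 := DFunLike.congr_fun (hσs (X (t, y)) v) u
  have e6 := DFunLike.congr_fun (hσs u v) (X (t, y))
  linear_combination k1 - k2 + e1 - e2 + e3 + t * (e4 - e5 + e6)

end Moser

section Moser

universe u

variable {F : Type u} [NormedAddCommGroup F] [NormedSpace ℝ F]

theorem dForm_swap (θ : F → F →L[ℝ] ℝ) (x X Y : F) : dForm θ x X Y = -dForm θ x Y X := by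
  simp [dForm_apply]

/-- Multiplication by a product of bump functions makes a function which is smooth around
`[0, 1] × {p₀}` globally smooth. -/
theorem exists_cutoff {G : Type*} [NormedAddCommGroup G] [NormedSpace ℝ G]
    [FiniteDimensional ℝ F] {O : Set (ℝ × F)} (hO : IsOpen O) {p₀ : F}
    (hp₀ : ∀ t : ℝ, (t, p₀) ∈ O) {X : ℝ × F → G} (hX : ∀ p ∈ O, ContDiffAt ℝ ∞ X p) :
    ∃ (r : ℝ) (ρ : ℝ × F → ℝ), 0 < r ∧ ContDiff ℝ ∞ ρ ∧ ContDiff ℝ ∞ (fun p => ρ p • X p) ∧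
      (∀ t ∈ Icc (0 : ℝ) 1, ∀ y ∈ Metric.ball p₀ r, (t, y) ∈ O ∧ ∀ᶠ p in 𝓝 (t, y), ρ p = 1) := by
  obtain ⟨u, v, -, hv, hu', hv', huv⟩ := generalized_tube_lemma
    (isCompact_closedBall (1 / 2 : ℝ) 2) (isCompact_singleton (x := p₀)) hO
    (by rintro ⟨t, y⟩ ⟨-, rfl⟩; exact hp₀ t)
  obtain ⟨R, hR, hRv⟩ := Metric.nhds_basis_closedBall.mem_iff.1 (hv.mem_nhds (hv' rfl))
  let b₁ : ContDiffBump (1 / 2 : ℝ) := ⟨1, 2, by norm_num, by norm_num⟩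
  let b₂ : ContDiffBump p₀ := ⟨R / 2, R, by positivity, by linarith⟩
  have hρ : ContDiff ℝ ∞ (fun p : ℝ × F => b₁ p.1 * b₂ p.2) :=
    (b₁.contDiff.comp contDiff_fst).mul (b₂.contDiff.comp contDiff_snd)
  refine ⟨R / 2, fun p => b₁ p.1 * b₂ p.2, by positivity, hρ, ?_, ?_⟩
  · rw [contDiff_iff_contDiffAt]
    rintro ⟨t, y⟩
    by_cases h : t ∈ Metric.closedBall (1 / 2 : ℝ) 2 ∧ y ∈ Metric.closedBall p₀ R
    · exact hρ.contDiffAt.smul (hX _ (huv ⟨hu' h.1, hRv h.2⟩))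
    · have : (fun p : ℝ × F => (b₁ p.1 * b₂ p.2) • X p) =ᶠ[𝓝 (t, y)] fun _ => 0 := by
        rw [not_and_or] at h
        rcases h with h | h
        · filter_upwards [continuous_fst.continuousAt.preimage_mem_nhds
            (Metric.isClosed_closedBall.isOpen_compl.mem_nhds h)] with p hp
          rw [b₁.zero_of_le_dist (not_le.1 fun h' => hp (Metric.mem_closedBall.2 h')).le, zero_mul, zero_smul]
        · filter_upwards [continuous_snd.continuousAt.preimage_mem_nhds
            (Metric.isClosed_closedBall.isOpen_compl.mem_nhds h)] with p hp
          rw [b₂.zero_of_le_dist (not_le.1 fun h' => hp (Metric.mem_closedBall.2 h')).le, mul_zero, zero_smul]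
      exact contDiffAt_const.congr_of_eventuallyEq this
  · intro t ht y hy
    have ht' : t ∈ Metric.ball (1 / 2 : ℝ) 1 := by
      rw [Metric.mem_ball, Real.dist_eq, abs_lt]
      constructor <;> linarith [ht.1, ht.2]
    refine ⟨huv ⟨hu' (Metric.ball_subset_closedBall (Metric.ball_subset_ball (by norm_num) ht')),
      hRv (Metric.ball_subset_closedBall (Metric.ball_subset_ball (by linarith) hy))⟩, ?_⟩
    filter_upwards [continuous_fst.continuousAt.preimage_mem_nhds (Metric.isOpen_ball.mem_nhds ht'),
      continuous_snd.continuousAt.preimage_mem_nhds (Metric.isOpen_ball.mem_nhds hy)] with p hp hp'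
    rw [b₁.one_of_mem_closedBall (Metric.ball_subset_closedBall hp),
      b₂.one_of_mem_closedBall (Metric.ball_subset_closedBall hp'), one_mul]

/-- **Moser's method.** If the `1`-form `σ` vanishes to second order on a set `S`, then near a
point of `S` there is a diffeomorphism, tangent to the identity along `S`, which pulls back
`d(α + σ)` to `dα`. -/
theorem exists_moser [FiniteDimensional ℝ F] {U : Set F} (hU : IsOpen U) {α σ : F → F →L[ℝ] ℝ}
    (hα : ContDiffOn ℝ ∞ α U) (hσ : ContDiffOn ℝ ∞ σ U) {S : Set F} {p₀ : F} (hp₀ : p₀ ∈ U)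
    (hp₀S : p₀ ∈ S) (hS : ∀ p ∈ S, p ∈ U → σ p = 0 ∧ fderiv ℝ σ p = 0)
    (hnd : (dForm α p₀).IsInvertible) :
    ∃ e : OpenPartialHomeomorph F F, p₀ ∈ e.source ∧ e.source ⊆ U ∧ e.target ⊆ U ∧
      ContDiffOn ℝ ∞ e e.source ∧ ContDiffOn ℝ ∞ e.symm e.target ∧
      (∀ x ∈ e.source, ∀ X Y, dForm (α + σ) (e x) (fderiv ℝ e x X) (fderiv ℝ e x Y)
        = dForm α x X Y) ∧
      (∀ p ∈ S, p ∈ e.source → e p = p ∧ fderiv ℝ e p = ContinuousLinearMap.id ℝ F) := by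
  have : CompleteSpace F := FiniteDimensional.complete ℝ F
  let Ω : ℝ × F → F →L[ℝ] F →L[ℝ] ℝ := fun p => dForm α p.2 + p.1 • dForm σ p.2
  let UU : Set (ℝ × F) := Prod.snd ⁻¹' U
  have hUU : IsOpen UU := hU.preimage continuous_snd
  have hΩ : ContDiffOn ℝ ∞ Ω UU :=
    ((contDiffOn_dForm hU hα).comp contDiff_snd.contDiffOn fun p hp => hp).add
      (contDiff_fst.contDiffOn.smul
        ((contDiffOn_dForm hU hσ).comp contDiff_snd.contDiffOn fun p hp => hp))
  let O : Set (ℝ × F) := UU ∩ Ω ⁻¹' {T | T.IsInvertible}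
  have hO : IsOpen O := hΩ.continuousOn.isOpen_inter_preimage hUU isOpen_isInvertible
  have hdσ : ∀ p ∈ S, p ∈ U → dForm σ p = 0 := fun p hp hpU => by
    rw [dForm, (hS p hp hpU).2, map_zero]
  have hp₀O : ∀ t : ℝ, (t, p₀) ∈ O := fun t => by
    refine ⟨hp₀, ?_⟩
    have : dForm α p₀ + t • dForm σ p₀ = dForm α p₀ := by
      ext u v
      change dForm α p₀ u v + t * dForm σ p₀ u v = dForm α p₀ u v
      rw [hdσ p₀ hp₀S hp₀, zero_apply, zero_apply, mul_zero, add_zero]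
    show (dForm α p₀ + t • dForm σ p₀).IsInvertible
    rwa [this]
  let C : ℝ × F → (F →L[ℝ] ℝ) →L[ℝ] F := fun p => -(Ω p).inverse
  have hC : ∀ p ∈ O, ContDiffAt ℝ ∞ C p := fun p hp =>
    ((contDiffAt_inverse_of_isInvertible hp.2).comp p (hΩ.contDiffAt (hUU.mem_nhds hp.1))).neg
  let X : ℝ × F → F := fun p => C p (σ p.2)
  have hσp : ∀ p ∈ UU, ContDiffAt ℝ ∞ (fun p : ℝ × F => σ p.2) p := fun p hp =>
    (hσ.contDiffAt (hU.mem_nhds hp)).comp p contDiff_snd.contDiffAt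
  have hX : ∀ p ∈ O, ContDiffAt ℝ ∞ X p := fun p hp => (hC p hp).clm_apply (hσp p hp.1)
  have hXσ : ∀ p ∈ O, Ω p (X p) = -σ p.2 := fun p hp => by
    have : Ω p ((Ω p).inverse (σ p.2)) = σ p.2 := (hp.2.inverse_apply_eq.mp rfl).symm
    simp only [X, C, neg_apply, map_neg, this]
  obtain ⟨r, ρ, hr, hρ, hf, hρ1⟩ := exists_cutoff hO hp₀O hX
  set f : ℝ × F → F := fun p => ρ p • X p with hfdef
  -- the field and its derivative vanish on `S`
  have hfS : ∀ p ∈ S, p ∈ U → ∀ t, f (t, p) = 0 := fun p hp hpU t => by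
    simp [hfdef, X, (hS p hp hpU).1]
  have hfS' : ∀ p ∈ S, ∀ t, (t, p) ∈ O → fderiv ℝ f (t, p) = 0 := fun p hp t hpO => by
    have h1 : HasFDerivAt (fun q : ℝ × F => σ q.2) (0 : ℝ × F →L[ℝ] F →L[ℝ] ℝ) (t, p) := by
      have := ((hσ.contDiffAt (hU.mem_nhds hpO.1)).differentiableAt (by simp)).hasFDerivAt.comp
        (t, p) (hasFDerivAt_snd (𝕜 := ℝ) (p := (t, p)))
      rwa [(hS p hp hpO.1).2, ContinuousLinearMap.zero_comp] at this
    have h2 := (((hC _ hpO).differentiableAt (by simp)).hasFDerivAt).clm_apply h1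
    have h3 := ((hρ.differentiable (by simp)) (t, p)).hasFDerivAt.smul h2
    refine HasFDerivAt.fderiv (h3.congr_fderiv ?_)
    ext q <;> simp [(hS p hp hpO.1).1]
  have hball₀ : p₀ ∈ Metric.ball p₀ r := Metric.mem_ball_self hr
  obtain ⟨N, Γ, hN, hp₀N, hΓ, hΓ₀, hΓ1, hΓ2, hΓfix⟩ := exists_smooth_flow hf (p₀ := p₀)
    (fun t _ => hfS p₀ hp₀S hp₀ t)
    (fun t ht v => by rw [hfS' p₀ hp₀S t (hp₀O t)]; rfl)
  -- restriction to initial conditions whose trajectory stays where the cutoff is `1`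
  let N' : Set F := (N ∩ Γ ⁻¹' Metric.ball (ContinuousMap.const _ p₀) r) ∩ (U ∩ Metric.ball p₀ r)
  have hN' : IsOpen N' := (hΓ.continuousOn.isOpen_inter_preimage hN Metric.isOpen_ball).inter
    (hU.inter Metric.isOpen_ball)
  have hp₀N' : p₀ ∈ N' := ⟨⟨hp₀N, by simpa [hΓ₀] using hr⟩, hp₀, hball₀⟩
  have hin : ∀ x ∈ N', ∀ t : ℝ, extendCurve (Γ x) t ∈ Metric.ball p₀ r := fun x hx t =>
    (ContinuousMap.dist_apply_le_dist (f := Γ x) (g := ContinuousMap.const _ p₀)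
      (projIcc 0 1 zero_le_one t)).trans_lt hx.1.2
  let ev : C(unitInterval, F) →L[ℝ] F := ContinuousMap.evalCLM ℝ 1
  let ψ : F → F := fun x => ev (Γ x)
  have hψ : ContDiffOn ℝ ∞ ψ N' := ev.contDiff.comp_contDiffOn (hΓ.mono fun x hx => hx.1.1)
  have hψd : ∀ x ∈ N', HasFDerivAt ψ (ev.comp (fderiv ℝ Γ x)) x := fun x hx =>
    ev.hasFDerivAt.comp x
      ((hΓ.contDiffAt (hN.mem_nhds hx.1.1)).differentiableAt (by simp)).hasFDerivAt
  have h1ev : ∀ γ : C(unitInterval, F), extendCurve γ 1 = ev γ := fun γ => extendCurve_coe γ 1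
  have h0ev : ∀ γ : C(unitInterval, F), extendCurve γ 0 = γ 0 := fun γ => extendCurve_coe γ 0
  -- points of `S` are fixed to first order
  have hψS : ∀ p ∈ S, p ∈ N' → ψ p = p ∧ fderiv ℝ ψ p = ContinuousLinearMap.id ℝ F := by
    intro p hp hpN
    have hΓp : Γ p = ContinuousMap.const _ p :=
      hΓfix p hpN.1.1 fun t _ => hfS p hp hpN.2.1 t
    refine ⟨by simp [ψ, ev, hΓp], ?_⟩
    rw [(hψd p hpN).fderiv]
    ext v
    obtain ⟨hv0, hv⟩ := hΓ2 p hpN.1.1 v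
    have hconst : ∀ t ∈ Icc (0 : ℝ) 1,
        HasDerivWithinAt (extendCurve (fderiv ℝ Γ p v)) 0 (Icc 0 1) t := fun t ht => by
      have := hv t ht
      have hp' : extendCurve (Γ p) t = p := by simp [extendCurve, hΓp]
      rwa [hp', hfS' p hp t (hρ1 t ht p hpN.2.2).1, zero_apply] at this
    have := constant_of_derivWithin_zero (fun t ht => (hconst t ht).differentiableWithinAt)
      (fun t ht => (hconst t (Ico_subset_Icc_self ht)).derivWithin
        (uniqueDiffOn_Icc zero_lt_one t (Ico_subset_Icc_self ht))) 1 (by simp)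
    rw [h1ev, h0ev, hv0] at this
    exact this
  -- conservation of the symplectic form
  have hpull : ∀ x ∈ N', ψ x ∈ U ∧ ∀ u v, dForm (α + σ) (ψ x) (fderiv ℝ ψ x u) (fderiv ℝ ψ x v)
      = dForm α x u v := by
    intro x hx
    have hψO : (1, ψ x) ∈ O := by
      have := (hρ1 1 (by simp) _ (hin x hx 1)).1
      rwa [h1ev] at this
    refine ⟨hψO.1, fun u v => ?_⟩
    let h : ℝ → ℝ := fun t => Ω (t, extendCurve (Γ x) t) (extendCurve (fderiv ℝ Γ x u) t)
      (extendCurve (fderiv ℝ Γ x v) t)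
    have hh : ∀ t ∈ Icc (0 : ℝ) 1, HasDerivWithinAt h 0 (Icc 0 1) t := by
      intro t ht
      obtain ⟨hO1, hev⟩ := hρ1 t ht _ (hin x hx t)
      have hfX : f =ᶠ[𝓝 (t, extendCurve (Γ x) t)] X := hev.mono fun p hp => by
        simp [hfdef, hp]
      obtain ⟨Ω', hΩ', hzero⟩ := moser_derivative_eq_zero hU hα hσ hO1.1
        ((hX _ hO1).differentiableAt (by simp))
        (by filter_upwards [hO.mem_nhds hO1] with p hp using hXσ p hp)
      have hγ := (hΓ1 x hx.1.1).2 t ht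
      have hu := (hΓ2 x hx.1.1 u).2 t ht
      have hv := (hΓ2 x hx.1.1 v).2 t ht
      rw [hfX.eq_of_nhds] at hγ
      rw [hfX.fderiv_eq] at hu hv
      have hcurve : HasDerivWithinAt (fun s => (s, extendCurve (Γ x) s))
          (1, X (t, extendCurve (Γ x) t)) (Icc 0 1) t := (hasDerivWithinAt_id t _).prodMk hγ
      have hΩc := HasFDerivAt.comp_hasDerivWithinAt (f := fun s => (s, extendCurve (Γ x) s)) t
        hΩ' hcurve
      exact ((hΩc.clm_apply hu).clm_apply hv).congr_deriv (by simpa using hzero _ _)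
    have := constant_of_derivWithin_zero (fun t ht => (hh t ht).differentiableWithinAt)
      (fun t ht => (hh t (Ico_subset_Icc_self ht)).derivWithin
        (uniqueDiffOn_Icc zero_lt_one t (Ico_subset_Icc_self ht))) 1 (by simp)
    simp only [h, h1ev, h0ev, (hΓ1 x hx.1.1).1, (hΓ2 x hx.1.1 _).1] at this
    rw [(hψd x hx).fderiv, dForm_add
      ((hα.contDiffAt (hU.mem_nhds hψO.1)).differentiableAt (by simp))
      ((hσ.contDiffAt (hU.mem_nhds hψO.1)).differentiableAt (by simp))]
    simpa [Ω, ψ] using this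
  have hd₀ : HasFDerivAt ψ ((ContinuousLinearEquiv.refl ℝ F : F →L[ℝ] F)) p₀ := by
    have := hψd p₀ hp₀N'
    rwa [← this.fderiv, (hψS p₀ hp₀S hp₀N').2] at this
  obtain ⟨e, hpe, heN, he, hes, hes'⟩ := exists_smooth_inverse hN' hψ hp₀N' hd₀
  have heψ : (e : F → F) = ψ := funext he
  refine ⟨e, hpe, fun x hx => (heN hx).2.1, fun y hy => ?_, hes, hes', fun x hx X Y => ?_,
    fun p hp hpe => ?_⟩
  · have := (hpull _ (heN (e.map_target hy))).1
    rwa [← he, e.right_inv hy] at this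
  · rw [heψ]
    exact (hpull x (heN hx)).2 X Y
  · rw [heψ]
    exact hψS p hp (heN hpe)

end Moser

section RelativeDarboux

universe u

variable {F : Type u} [NormedAddCommGroup F] [NormedSpace ℝ F]

theorem dForm_fderiv_eq_zero {f : F → ℝ} {x : F} (hf : ContDiffAt ℝ ∞ f x) :
    dForm (fderiv ℝ f) x = 0 := by
  ext X Y
  rw [dForm_apply, (hf.isSymmSndFDerivAt (by simpa using two_le_infty)) X Y, sub_self]
  rfl

theorem dForm_sub {θ η : F → F →L[ℝ] ℝ} {x : F} (hθ : DifferentiableAt ℝ θ x)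
    (hη : DifferentiableAt ℝ η x) : dForm (θ - η) x = dForm θ x - dForm η x := by
  rw [dForm, fderiv_sub hθ hη, map_sub]
  rfl

theorem fderiv_apply_const {θ : F → F →L[ℝ] ℝ} {x : F} (hθ : DifferentiableAt ℝ θ x) (u v : F) :
    fderiv ℝ (fun y => θ y v) x u = fderiv ℝ θ x u v := by
  have := hθ.hasFDerivAt.clm_apply (hasFDerivAt_const v x)
  rw [this.fderiv]
  simp

set_option synthInstance.maxHeartbeats 200000 in
/-- A `1`-form `θ` whose exterior derivative vanishes along the range of a projection `P` can be
changed by an exact form so as to vanish to second order there. -/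
theorem exists_dForm_eq_vanishing_on_range [FiniteDimensional ℝ F] {P : F →L[ℝ] F}
    (hP : ∀ x, P (P x) = P x)
    {U : Set F} (hU : IsOpen U) {θ : F → F →L[ℝ] ℝ} (hθ : ContDiffOn ℝ ∞ θ U) {p₀ : F}
    (hp₀ : p₀ ∈ U) (hPp₀ : P p₀ = p₀) (hd : ∀ p ∈ U, P p = p → dForm θ p = 0) :
    ∃ (U' : Set F) (σ : F → F →L[ℝ] ℝ), IsOpen U' ∧ U' ⊆ U ∧ p₀ ∈ U' ∧ ContDiffOn ℝ ∞ σ U' ∧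
      (∀ x ∈ U', dForm σ x = dForm θ x) ∧
      (∀ p ∈ U', P p = p → σ p = 0 ∧ fderiv ℝ σ p = 0) := by
  have : CompleteSpace F := FiniteDimensional.complete ℝ F
  let R : F →L[ℝ] F := ContinuousLinearMap.id ℝ F - P
  have hRapply : ∀ x, R x = x - P x := fun x => rfl
  obtain ⟨r, hr, hrU⟩ := Metric.isOpen_iff.1 (hU.inter (hU.preimage P.continuous)) p₀
    ⟨hp₀, by simpa [hPp₀] using hp₀⟩
  let U' := Metric.ball p₀ r
  have hU' : IsOpen U' := Metric.isOpen_ball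
  have hθP : ContDiffOn ℝ ∞ (fun x => θ (P x)) U' :=
    hθ.comp P.contDiff.contDiffOn fun x hx => (hrU hx).2
  have hθ' : ContDiffOn ℝ ∞ (fderiv ℝ θ) U := hθ.fderiv_of_isOpen hU (by simp)
  have hθ'P : ContDiffOn ℝ ∞ (fun x => fderiv ℝ θ (P x)) U' :=
    hθ'.comp P.contDiff.contDiffOn fun x hx => (hrU hx).2
  have hθd : ∀ x ∈ U, HasFDerivAt θ (fderiv ℝ θ x) x := fun x hx =>
    ((hθ.contDiffAt (hU.mem_nhds hx)).differentiableAt (by simp)).hasFDerivAt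
  have hθd' : ∀ x ∈ U, HasFDerivAt (fderiv ℝ θ) (fderiv ℝ (fderiv ℝ θ) x) x := fun x hx =>
    ((hθ'.contDiffAt (hU.mem_nhds hx)).differentiableAt (by simp)).hasFDerivAt
  have hsymm : ∀ x ∈ U, P x = x → ∀ u v, fderiv ℝ θ x u v = fderiv ℝ θ x v u :=
    fun x hx hPx u v => by
      have := DFunLike.congr_fun (DFunLike.congr_fun (hd x hx hPx) u) v
      exact sub_eq_zero.1 this
  -- the pullback by the projection is closed
  let η : F → F →L[ℝ] ℝ := fun x => (θ (P x)).comp P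
  have hη : ContDiffOn ℝ ∞ η U' := hθP.clm_comp contDiffOn_const
  have hηd : ∀ x ∈ U', ∀ u v, fderiv ℝ η x u v = fderiv ℝ θ (P x) (P u) (P v) := by
    intro x hx u v
    have h1 : HasFDerivAt (fun x => θ (P x)) ((fderiv ℝ θ (P x)).comp P) x :=
      (hθd (P x) (hrU hx).2).comp x P.hasFDerivAt
    have h2 := h1.clm_comp (hasFDerivAt_const P x)
    rw [h2.fderiv]
    simp
  obtain ⟨f₀, hf₀⟩ := (convex_ball p₀ r).exists_forall_hasFDerivAt_of_fderiv_symmetric hU'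
    (hη.differentiableOn (by simp)) (fun a ha x y => by
      rw [hηd a ha, hηd a ha, hsymm _ (hrU ha).2 (hP a)])
  have hf₀s : ContDiffOn ℝ ∞ f₀ U' := by
    rw [contDiffOn_infty_iff_fderiv_of_isOpen hU']
    exact ⟨fun x hx => (hf₀ x hx).differentiableAt.differentiableWithinAt,
      hη.congr fun x hx => (hf₀ x hx).fderiv⟩
  let f : F → ℝ := fun x => f₀ x + (θ (P x) (R x) + (1 / 2 : ℝ) * fderiv ℝ θ (P x) (R x) (R x))
  have hf : ContDiffOn ℝ ∞ f U' :=
    hf₀s.add ((hθP.clm_apply R.contDiff.contDiffOn).add (contDiffOn_const.mul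
      ((hθ'P.clm_apply R.contDiff.contDiffOn).clm_apply R.contDiff.contDiffOn)))
  have hf' : ContDiffOn ℝ ∞ (fderiv ℝ f) U' := hf.fderiv_of_isOpen hU' (by simp)
  have hfd : ∀ x ∈ U', ∀ v, fderiv ℝ f x v = θ (P x) v + (fderiv ℝ θ (P x) (P v) (R x)
      + (1 / 2 : ℝ) * (fderiv ℝ (fderiv ℝ θ) (P x) (P v) (R x) (R x)
        + fderiv ℝ θ (P x) (R v) (R x) + fderiv ℝ θ (P x) (R x) (R v))) := by
    intro x hx v
    have h1 : HasFDerivAt (fun x => θ (P x)) ((fderiv ℝ θ (P x)).comp P) x :=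
      (hθd (P x) (hrU hx).2).comp x P.hasFDerivAt
    have h2 : HasFDerivAt (fun x => fderiv ℝ θ (P x))
        ((fderiv ℝ (fderiv ℝ θ) (P x)).comp P) x :=
      (hθd' (P x) (hrU hx).2).comp x P.hasFDerivAt
    have h3 := (hf₀ x hx).add ((h1.clm_apply R.hasFDerivAt).add
      (((h2.clm_apply R.hasFDerivAt).clm_apply R.hasFDerivAt).const_mul (1 / 2 : ℝ)))
    have h4 : fderiv ℝ f x = _ := h3.fderiv
    rw [h4]
    have hPR : θ (P x) v = θ (P x) (P v) + θ (P x) (R v) := by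
      rw [← map_add, hRapply, add_sub_cancel]
    rw [hPR]
    simp [η]
    ring
  have hσ : ContDiffOn ℝ ∞ (θ - fderiv ℝ f) U' := (hθ.mono fun x hx => (hrU hx).1).sub hf'
  refine ⟨U', θ - fderiv ℝ f, hU', fun x hx => (hrU hx).1, Metric.mem_ball_self hr, hσ, ?_, ?_⟩
  · intro x hx
    rw [dForm_sub (hθd x (hrU hx).1).differentiableAt
      ((hf'.contDiffAt (hU'.mem_nhds hx)).differentiableAt (by simp)),
      dForm_fderiv_eq_zero (hf.contDiffAt (hU'.mem_nhds hx)), sub_zero]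
  · intro p hp hPp
    have hRp : R p = 0 := by rw [hRapply, hPp, sub_self]
    constructor
    · ext v
      change θ p v - fderiv ℝ f p v = 0
      rw [hfd p hp, hRp, hPp]
      simp
    · ext u v
      have hσd : DifferentiableAt ℝ (θ - fderiv ℝ f) p :=
        (hσ.contDiffAt (hU'.mem_nhds hp)).differentiableAt (by simp)
      rw [← fderiv_apply_const hσd]
      have hev : (fun y => (θ - fderiv ℝ f) y v) =ᶠ[𝓝 p] fun x => θ x v - (θ (P x) v +
          (fderiv ℝ θ (P x) (P v) (R x)
          + (1 / 2 : ℝ) * (fderiv ℝ (fderiv ℝ θ) (P x) (P v) (R x) (R x)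
          + fderiv ℝ θ (P x) (R v) (R x) + fderiv ℝ θ (P x) (R x) (R v)))) := by
        filter_upwards [hU'.mem_nhds hp] with y hy
        rw [← hfd y hy]
        rfl
      rw [hev.fderiv_eq]
      have h0 := hθd p (hrU hp).1
      have h1 : HasFDerivAt (fun x => θ (P x)) ((fderiv ℝ θ (P p)).comp P) p :=
        (hθd (P p) (hrU hp).2).comp p P.hasFDerivAt
      have h2 : HasFDerivAt (fun x => fderiv ℝ θ (P x))
          ((fderiv ℝ (fderiv ℝ θ) (P p)).comp P) p :=
        (hθd' (P p) (hrU hp).2).comp p P.hasFDerivAt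
      have hθ'' : ContDiffOn ℝ ∞ (fderiv ℝ (fderiv ℝ θ)) U := hθ'.fderiv_of_isOpen hU (by simp)
      have h3 : HasFDerivAt (fun x => fderiv ℝ (fderiv ℝ θ) (P x))
          ((fderiv ℝ (fderiv ℝ (fderiv ℝ θ)) (P p)).comp P) p :=
        (((hθ''.contDiffAt (hU.mem_nhds (hrU hp).2)).differentiableAt
          (by simp)).hasFDerivAt).comp p P.hasFDerivAt
      have hv : ∀ w : F, HasFDerivAt (fun _ : F => w) (0 : F →L[ℝ] F) p :=
        fun w => hasFDerivAt_const w p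
      have hR := R.hasFDerivAt (x := p)
      have key := (h0.clm_apply (hv v)).sub ((h1.clm_apply (hv v)).add
        (((h2.clm_apply (hv (P v))).clm_apply hR).add
        ((((((h3.clm_apply (hv (P v))).clm_apply hR).clm_apply hR).add
          ((h2.clm_apply (hv (R v))).clm_apply hR)).add
          ((h2.clm_apply hR).clm_apply (hv (R v)))).const_mul (1 / 2 : ℝ))))
      have key' := key.fderiv
      refine (DFunLike.congr_fun key' u).trans ?_
      have s1 := hsymm p (hrU hp).1 hPp (P v) (R u)
      have s2 := hsymm p (hrU hp).1 hPp (R v) (R u)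
      have s3 : fderiv ℝ θ p u v = fderiv ℝ θ p (P u) v + fderiv ℝ θ p (R u) (P v)
          + fderiv ℝ θ p (R u) (R v) := by
        have e1 : fderiv ℝ θ p u = fderiv ℝ θ p (P u) + fderiv ℝ θ p (R u) := by
          rw [← map_add, hRapply, add_sub_cancel]
        have e2 : fderiv ℝ θ p (R u) v = fderiv ℝ θ p (R u) (P v)
            + fderiv ℝ θ p (R u) (R v) := by
          rw [← map_add, hRapply v, add_sub_cancel]
        rw [e1, add_apply, e2, add_assoc]
      simp [hRp, hPp]
      linarith

/-- **Relative Darboux theorem.** If the exact forms `dα₀` and `dα₁` agree along the range of a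
projection `P` and are nondegenerate at a point `p₀` of it, then near `p₀` there is a
diffeomorphism tangent to the identity along the range of `P` that pulls `dα₁` back to `dα₀`. -/
theorem exists_relative_darboux [FiniteDimensional ℝ F] {P : F →L[ℝ] F} (hP : ∀ x, P (P x) = P x)
    {U : Set F} (hU : IsOpen U) {α₀ α₁ : F → F →L[ℝ] ℝ} (hα₀ : ContDiffOn ℝ ∞ α₀ U)
    (hα₁ : ContDiffOn ℝ ∞ α₁ U) {p₀ : F} (hp₀ : p₀ ∈ U) (hPp₀ : P p₀ = p₀)
    (hd : ∀ p ∈ U, P p = p → dForm α₁ p = dForm α₀ p) (hnd : (dForm α₀ p₀).IsInvertible) :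
    ∃ e : OpenPartialHomeomorph F F, p₀ ∈ e.source ∧ e.source ⊆ U ∧ e.target ⊆ U ∧
      ContDiffOn ℝ ∞ e e.source ∧ ContDiffOn ℝ ∞ e.symm e.target ∧
      (∀ x ∈ e.source, ∀ X Y, dForm α₁ (e x) (fderiv ℝ e x X) (fderiv ℝ e x Y)
        = dForm α₀ x X Y) ∧
      (∀ p ∈ e.source, P p = p → e p = p ∧ fderiv ℝ e p = ContinuousLinearMap.id ℝ F) := by
  have hd₀ : ∀ x ∈ U, DifferentiableAt ℝ α₀ x := fun x hx =>
    (hα₀.contDiffAt (hU.mem_nhds hx)).differentiableAt (by simp)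
  have hd₁ : ∀ x ∈ U, DifferentiableAt ℝ α₁ x := fun x hx =>
    (hα₁.contDiffAt (hU.mem_nhds hx)).differentiableAt (by simp)
  obtain ⟨U', σ, hU', hU'U, hpU', hσ, hdσ, hσP⟩ := exists_dForm_eq_vanishing_on_range hP hU
    (hα₁.sub hα₀) hp₀ hPp₀ (fun p hp hPp => by
      have : dForm (α₁ - α₀) p = 0 := by
        rw [dForm_sub (hd₁ p hp) (hd₀ p hp), hd p hp hPp, sub_self]
      exact this)
  obtain ⟨e, h1, h2, h3, h4, h5, h6, h7⟩ := exists_moser hU' (hα₀.mono hU'U) hσ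
    (S := {p | P p = p}) hpU' hPp₀ (fun p hp hpU => hσP p hpU hp) hnd
  refine ⟨e, h1, h2.trans hU'U, h3.trans hU'U, h4, h5, fun x hx X Y => ?_,
    fun p hp hPp => h7 p hPp hp⟩
  rw [← h6 x hx]
  have hex : e x ∈ U' := h3 (e.map_source hx)
  rw [dForm_add (hd₀ _ (hU'U hex))
    ((hσ.contDiffAt (hU'.mem_nhds hex)).differentiableAt (by simp)), hdσ _ hex]
  have : dForm (fun x => α₁ x - α₀ x) (e x) = dForm α₁ (e x) - dForm α₀ (e x) :=
    dForm_sub (hd₁ _ (hU'U hex)) (hd₀ _ (hU'U hex))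
  rw [this, add_sub_cancel]

end RelativeDarboux

section Eigenvalues

variable {E : Type*} [AddCommGroup E] [Module ℝ E] [FiniteDimensional ℝ E]

open Matrix in
/-- `a + i b` is an eigenvalue of a real operator iff there is a complex eigenvector `u + i v`. -/
theorem mem_roots_charpoly_iff (T : E →ₗ[ℝ] E) (c : ℂ) :
    c ∈ (T.charpoly.map (algebraMap ℝ ℂ)).roots ↔
      ∃ u v : E, (u ≠ 0 ∨ v ≠ 0) ∧ T u = c.re • u - c.im • v ∧ T v = c.re • v + c.im • u := by
  let b := Module.finBasis ℝ E
  let M := LinearMap.toMatrix b b T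
  have hM : ∀ x : E, M *ᵥ b.equivFun x = b.equivFun (T x) := fun x =>
    LinearMap.toMatrix_mulVec_repr b b T x
  have hne : T.charpoly.map (algebraMap ℝ ℂ) ≠ 0 := (T.charpoly_monic.map _).ne_zero
  have hre : ∀ (w : Fin _ → ℂ) i, ((M.map (algebraMap ℝ ℂ)) *ᵥ w) i =
      ((M *ᵥ fun j => (w j).re) i : ℝ) + ((M *ᵥ fun j => (w j).im) i : ℝ) * Complex.I := by
    intro w i
    simp only [mulVec, dotProduct, Matrix.map_apply, Complex.coe_algebraMap, Complex.ofReal_sum,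
      Finset.sum_mul, ← Finset.sum_add_distrib, Complex.ofReal_mul]
    refine Finset.sum_congr rfl fun j _ => ?_
    conv_lhs => rw [← Complex.re_add_im (w j)]
    ring
  have hiff : ∀ w : Fin _ → ℂ, (Matrix.scalar _ c - M.map (algebraMap ℝ ℂ)) *ᵥ w = 0 ↔
      (M *ᵥ fun j => (w j).re) = (fun j => c.re * (w j).re - c.im * (w j).im) ∧
      (M *ᵥ fun j => (w j).im) = (fun j => c.re * (w j).im + c.im * (w j).re) := by
    intro w
    rw [sub_mulVec, sub_eq_zero, funext_iff, funext_iff, funext_iff, ← forall_and]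
    refine forall_congr' fun i => ?_
    rw [hre, Complex.ext_iff]
    simp [Matrix.scalar_apply, mulVec_diagonal, eq_comm]
  rw [Polynomial.mem_roots hne, Polynomial.IsRoot.def, ← LinearMap.charpoly_toMatrix T b,
    ← Matrix.charpoly_map, Matrix.eval_charpoly, ← Matrix.exists_mulVec_eq_zero_iff]
  constructor
  · rintro ⟨w, hw, hcw⟩
    obtain ⟨h1, h2⟩ := (hiff w).1 hcw
    refine ⟨b.equivFun.symm fun j => (w j).re, b.equivFun.symm fun j => (w j).im, ?_, ?_, ?_⟩
    · by_contra! h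
      apply hw
      have e1 := (LinearEquiv.map_eq_zero_iff _).1 h.1
      have e2 := (LinearEquiv.map_eq_zero_iff _).1 h.2
      ext j
      exact Complex.ext (congrFun e1 j) (congrFun e2 j)
    · apply b.equivFun.injective
      rw [← hM, LinearEquiv.apply_symm_apply, h1]
      simp only [map_sub, map_smul, LinearEquiv.apply_symm_apply]
      rfl
    · apply b.equivFun.injective
      rw [← hM, LinearEquiv.apply_symm_apply, h2]
      simp only [map_add, map_smul, LinearEquiv.apply_symm_apply]
      rfl
  · rintro ⟨u, v, huv, hu, hv⟩
    refine ⟨fun j => ⟨b.equivFun u j, b.equivFun v j⟩, ?_, (hiff _).2 ⟨?_, ?_⟩⟩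
    · intro h
      have h' : ∀ j, (b.equivFun u j = 0) ∧ (b.equivFun v j = 0) := fun j =>
        Complex.ext_iff.1 (congrFun h j)
      rcases huv with h1 | h1
      · exact h1 ((LinearEquiv.map_eq_zero_iff b.equivFun).1 (funext fun j => (h' j).1))
      · exact h1 ((LinearEquiv.map_eq_zero_iff b.equivFun).1 (funext fun j => (h' j).2))
    · have := hM u
      rw [hu] at this
      refine this.trans ?_
      ext j
      simp
    · have := hM v
      rw [hv] at this
      refine this.trans ?_
      ext j
      simp

theorem card_roots_charpoly (T : E →ₗ[ℝ] E) :
    Multiset.card (T.charpoly.map (algebraMap ℝ ℂ)).roots = Module.finrank ℝ E := by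
  rw [IsAlgClosed.card_roots_eq_natDegree, (T.charpoly_monic).natDegree_map,
    LinearMap.charpoly_natDegree]

end Eigenvalues

section SkewOperators

variable {E : Type*} [NormedAddCommGroup E] [NormedSpace ℝ E]

/-- `g` is an inner product for which `T` is skew-symmetric. -/
structure IsSkew (g : E →L[ℝ] E →L[ℝ] ℝ) (T : E →L[ℝ] E) : Prop where
  symm : ∀ X Y, g X Y = g Y X
  pos : ∀ X, X ≠ 0 → 0 < g X X
  skew : ∀ X Y, g (T X) Y = -g X (T Y)

/-- `u + i v` is a complex eigenvector of `T` for the eigenvalue `i b`. -/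
structure IsRotationPair (T : E →L[ℝ] E) (b : ℝ) (u v : E) : Prop where
  left : T u = -(b • v)
  right : T v = b • u

variable {g : E →L[ℝ] E →L[ℝ] ℝ} {T : E →L[ℝ] E}

theorem IsSkew.eq_zero_of_self (h : IsSkew g T) {x : E} (hx : g x x = 0) : x = 0 := by
  by_contra h'
  exact (h.pos x h').ne' hx

theorem IsSkew.nonneg (h : IsSkew g T) (x : E) : 0 ≤ g x x := by
  by_cases hx : x = 0
  · simp [hx]
  · exact (h.pos x hx).le

theorem IsSkew.re_eq_zero (h : IsSkew g T) {a b : ℝ} {u v : E} (huv : u ≠ 0 ∨ v ≠ 0)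
    (hu : T u = a • u - b • v) (hv : T v = a • v + b • u) : a = 0 := by
  have h1 := h.skew u u
  have h2 := h.skew v v
  rw [hu] at h1
  rw [hv] at h2
  simp only [map_sub, map_add, map_smul, sub_apply, add_apply, smul_apply, smul_eq_mul] at h1 h2
  have h4 : a * (g u u + g v v) = 0 := by
    linear_combination (h1 + h2) / 2
  have h5 : 0 < g u u + g v v := by
    rcases huv with h5 | h5
    · linarith [h.pos u h5, h.nonneg v]
    · linarith [h.pos v h5, h.nonneg u]
  exact (mul_eq_zero.1 h4).resolve_right h5.ne'

variable {b : ℝ} {u v : E}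

theorem IsRotationPair.inner_eq_zero (hp : IsRotationPair T b u v) (h : IsSkew g T) (hb : b ≠ 0) :
    g u v = 0 := by
  have h1 := h.skew u u
  rw [hp.left] at h1
  simp only [map_neg, map_smul, neg_apply, smul_apply, smul_eq_mul] at h1
  have h3 := h.symm u v
  have : b * g u v = 0 := by rw [← h3] at h1; linarith
  exact (mul_eq_zero.1 this).resolve_left hb

theorem IsRotationPair.inner_self_eq (hp : IsRotationPair T b u v) (h : IsSkew g T) (hb : b ≠ 0) :
    g u u = g v v := by
  have h1 := h.skew u v
  rw [hp.left, hp.right] at h1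
  simp only [map_neg, map_smul, neg_apply, smul_apply, smul_eq_mul] at h1
  exact mul_left_cancel₀ hb (by linarith)

theorem IsRotationPair.orthogonal (hp : IsRotationPair T b u v) (h : IsSkew g T) {b' : ℝ}
    {u' v' : E} (hp' : IsRotationPair T b' u' v') (hb : b ^ 2 ≠ b' ^ 2) :
    g u u' = 0 ∧ g u v' = 0 ∧ g v u' = 0 ∧ g v v' = 0 := by
  have e1 := h.skew u u'
  have e2 := h.skew u v'
  have e3 := h.skew v u'
  have e4 := h.skew v v'
  rw [hp.left, hp'.left] at e1
  rw [hp.left, hp'.right] at e2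
  rw [hp.right, hp'.left] at e3
  rw [hp.right, hp'.right] at e4
  simp only [map_neg, map_smul, neg_apply, smul_apply, smul_eq_mul] at e1 e2 e3 e4
  have hb' : b ^ 2 - b' ^ 2 ≠ 0 := sub_ne_zero.2 hb
  refine ⟨?_, ?_, ?_, ?_⟩
  · refine (mul_eq_zero.1 (?_ : (b ^ 2 - b' ^ 2) * g u u' = 0)).resolve_left hb'
    linear_combination b * e3 - b' * e2
  · refine (mul_eq_zero.1 (?_ : (b ^ 2 - b' ^ 2) * g u v' = 0)).resolve_left hb'
    linear_combination b * e4 + b' * e1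
  · refine (mul_eq_zero.1 (?_ : (b ^ 2 - b' ^ 2) * g v u' = 0)).resolve_left hb'
    linear_combination - b * e1 - b' * e4
  · refine (mul_eq_zero.1 (?_ : (b ^ 2 - b' ^ 2) * g v v' = 0)).resolve_left hb'
    linear_combination -b * e2 + b' * e3

/-- A family of nonzero `g`-orthogonal vectors, as many as the dimension. -/
theorem IsSkew.eq_zero_of_orthogonal [FiniteDimensional ℝ E] (h : IsSkew g T) {ι : Type*} [Fintype ι]
    (hι : Fintype.card ι = Module.finrank ℝ E) {w : ι → E} (hw : ∀ i, w i ≠ 0)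
    (ho : ∀ i j, i ≠ j → g (w i) (w j) = 0) {x : E} (hx : ∀ i, g x (w i) = 0) : x = 0 := by
  have hli : LinearIndependent ℝ w :=
    LinearMap.linearIndependent_of_isOrthoᵢ (B := g.toBilinForm)
      (by intro i j hij; exact ho i j hij) (fun i => (h.pos _ (hw i)).ne')
  have hspan := hli.span_eq_top_of_card_eq_finrank' hι
  have hmem : x ∈ Submodule.span ℝ (range w) := hspan ▸ Submodule.mem_top
  apply h.eq_zero_of_self
  have : ∀ y ∈ Submodule.span ℝ (range w), g x y = 0 := by
    intro y hy
    induction hy using Submodule.span_induction with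
    | mem y hy => obtain ⟨i, rfl⟩ := hy; exact hx i
    | zero => simp
    | add y z _ _ hy hz => simp [hy, hz]
    | smul c y _ hy => simp [hy]
  exact this x hmem

end SkewOperators

section Implicit

variable {X Y Z : Type*} [NormedAddCommGroup X] [NormedSpace ℝ X] [CompleteSpace X]
  [NormedAddCommGroup Y] [NormedSpace ℝ Y] [CompleteSpace Y] [NormedAddCommGroup Z]
  [NormedSpace ℝ Z]

/-- The implicit function theorem for smooth maps, with smoothness on an open set. -/
theorem exists_smooth_implicit {U : Set (X × Y)} (hU : IsOpen U) {f : X × Y → Z}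
    (hf : ContDiffOn ℝ ∞ f U) {x₀ : X} {y₀ : Y} (h₀ : (x₀, y₀) ∈ U) (hf₀ : f (x₀, y₀) = 0)
    {L : Y ≃L[ℝ] Z} (hL : ∀ y, fderiv ℝ f (x₀, y₀) (0, y) = L y) :
    ∃ (N : Set X) (h : X → Y), IsOpen N ∧ x₀ ∈ N ∧ ContDiffOn ℝ ∞ h N ∧ h x₀ = y₀ ∧
      ∀ x ∈ N, f (x, h x) = 0 := by
  have hfd : HasFDerivAt f (fderiv ℝ f (x₀, y₀)) (x₀, y₀) :=
    ((hf.contDiffAt (hU.mem_nhds h₀)).differentiableAt (by simp)).hasFDerivAt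
  let A : (X × Y) ≃L[ℝ] (X × Z) := (ContinuousLinearEquiv.refl ℝ X).skewProd L
    ((fderiv ℝ f (x₀, y₀)).comp (ContinuousLinearMap.inl ℝ X Y))
  have hd : HasFDerivAt (fun p : X × Y => (p.1, f p)) (A : X × Y →L[ℝ] X × Z) (x₀, y₀) := by
    refine ((hasFDerivAt_fst (𝕜 := ℝ) (p := (x₀, y₀))).prodMk hfd).congr_fderiv ?_
    refine ContinuousLinearMap.ext fun p => Prod.ext rfl (Eq.symm ?_)
    change L p.2 + fderiv ℝ f (x₀, y₀) (p.1, 0) = fderiv ℝ f (x₀, y₀) p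
    rw [← hL, ← map_add]
    simp
  obtain ⟨e, he₀, heU, he, -, hes⟩ := exists_smooth_inverse hU
    (contDiff_fst.contDiffOn.prodMk hf) h₀ hd
  have hmap : Continuous (fun x : X => (x, (0 : Z))) := by fun_prop
  have hcan : ∀ q ∈ e.target, (e.symm q).1 = q.1 ∧ f (e.symm q) = q.2 := fun q hq => by
    have := e.right_inv hq
    rw [he] at this
    exact ⟨congrArg Prod.fst this, congrArg Prod.snd this⟩
  have he0 : e (x₀, y₀) = (x₀, 0) := by rw [he, hf₀]
  refine ⟨(fun x : X => (x, (0 : Z))) ⁻¹' e.target, fun x => (e.symm (x, 0)).2,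
    e.open_target.preimage hmap, ?_, ?_, ?_, ?_⟩
  · have := e.map_source he₀
    rwa [he0] at this
  · exact contDiff_snd.comp_contDiffOn (hes.comp
      (contDiff_id.prodMk contDiff_const).contDiffOn fun x hx => hx)
  · simp only
    rw [← he0, e.left_inv he₀]
  · intro x hx
    have h1 := hcan _ hx
    have h2 : (x, (e.symm (x, 0)).2) = e.symm (x, 0) := Prod.ext h1.1.symm rfl
    simp only [h2]
    exact h1.2

end Implicit

section Frame

variable {E : Type*} [NormedAddCommGroup E] [NormedSpace ℝ E] [FiniteDimensional ℝ E]

/-- At one point: a skew invertible operator with simple eigenvalues has `n` rotation pairs with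
different frequencies. -/
theorem IsSkew.exists_rotationPairs {g : E →L[ℝ] E →L[ℝ] ℝ} {T : E →L[ℝ] E} (h : IsSkew g T)
    {n : ℕ} (hn : Module.finrank ℝ E = 2 * n) (hT : Function.Injective T)
    (hs : ((T : E →ₗ[ℝ] E).charpoly.map (algebraMap ℝ ℂ)).roots.Nodup) :
    ∃ (b : Fin n → ℝ) (u v : Fin n → E), Function.Injective b ∧ ∀ j, 0 < b j ∧ u j ≠ 0 ∧
      IsRotationPair T (b j) (u j) (v j) := by
  classical
  set R := ((T : E →ₗ[ℝ] E).charpoly.map (algebraMap ℝ ℂ)).roots with hR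
  let S : Finset ℂ := ⟨R, hs⟩
  have hScard : S.card = 2 * n := by
    rw [← hn, ← card_roots_charpoly (T : E →ₗ[ℝ] E)]
    rfl
  have hmem : ∀ c, c ∈ S ↔ ∃ u v : E, (u ≠ 0 ∨ v ≠ 0) ∧ T u = c.re • u - c.im • v ∧
      T v = c.re • v + c.im • u := fun c => mem_roots_charpoly_iff (T : E →ₗ[ℝ] E) c
  have hre : ∀ c ∈ S, c.re = 0 := fun c hc => by
    obtain ⟨u, v, huv, hu, hv⟩ := (hmem c).1 hc
    exact h.re_eq_zero huv hu hv
  have him : ∀ c ∈ S, c.im ≠ 0 := fun c hc hc0 => by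
    obtain ⟨u, v, huv, hu, hv⟩ := (hmem c).1 hc
    simp only [hre c hc, hc0, zero_smul, sub_zero, add_zero] at hu hv
    rw [← map_zero T] at hu hv
    rcases huv with h1 | h1
    · exact h1 (hT hu)
    · exact h1 (hT hv)
  have hconj : ∀ c ∈ S, (starRingEnd ℂ) c ∈ S := fun c hc => by
    obtain ⟨u, v, huv, hu, hv⟩ := (hmem c).1 hc
    refine (hmem _).2 ⟨u, -v, by simpa using huv, ?_, ?_⟩
    · simp [hu]
    · rw [map_neg, hv]
      simp only [Complex.conj_re, Complex.conj_im]
      module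
  have hcard : (S.filter fun c => 0 < c.im).card = (S.filter fun c => ¬ 0 < c.im).card := by
    refine Finset.card_bij' (fun c _ => (starRingEnd ℂ) c) (fun c _ => (starRingEnd ℂ) c)
      ?_ ?_ ?_ ?_
    · intro c hc
      rw [Finset.mem_filter] at hc ⊢
      refine ⟨hconj c hc.1, ?_⟩
      rw [Complex.conj_im]
      linarith [hc.2]
    · intro c hc
      rw [Finset.mem_filter] at hc ⊢
      refine ⟨hconj c hc.1, ?_⟩
      rw [Complex.conj_im]
      have := lt_of_le_of_ne (not_lt.1 hc.2) (him c hc.1)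
      linarith
    · intro c _
      simp
    · intro c _
      simp
  have hcard' : (S.filter fun c => 0 < c.im).card = n := by
    have := S.card_filter_add_card_filter_not (fun c => 0 < c.im)
    omega
  let e := (Finset.equivFinOfCardEq hcard').symm
  have hex : ∀ j : Fin n, ∃ u v : E, u ≠ 0 ∧ IsRotationPair T ((e j : ℂ).im) u v := by
    intro j
    have hj := Finset.mem_filter.1 (e j).2
    obtain ⟨u, v, huv, hu, hv⟩ := (hmem _).1 hj.1
    rw [hre _ hj.1] at hu hv
    have hp : IsRotationPair T ((e j : ℂ).im) u v := ⟨by simpa using hu, by simpa using hv⟩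
    refine ⟨u, v, fun h0 => ?_, hp⟩
    have h1 := hp.inner_self_eq h (him _ hj.1)
    rw [h0, map_zero] at h1
    rcases huv with h2 | h2
    · exact h2 h0
    · exact h2 (h.eq_zero_of_self h1.symm)
  choose u v hu hp using hex
  refine ⟨fun j => (e j : ℂ).im, u, v, fun i j hij => ?_, fun j =>
    ⟨(Finset.mem_filter.1 (e j).2).2, hu j, hp j⟩⟩
  apply e.injective
  apply Subtype.ext
  exact Complex.ext (by rw [hre _ (Finset.mem_filter.1 (e i).2).1,
    hre _ (Finset.mem_filter.1 (e j).2).1]) hij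

/-- The vectors of `n` rotation pairs with different frequencies detect zero. -/
theorem IsSkew.eq_zero_of_rotationPairs {g : E →L[ℝ] E →L[ℝ] ℝ} {T : E →L[ℝ] E} (h : IsSkew g T)
    {n : ℕ} (hn : Module.finrank ℝ E = 2 * n) {b : Fin n → ℝ} {u v : Fin n → E}
    (hb : Function.Injective b) (hp : ∀ j, 0 < b j ∧ u j ≠ 0 ∧ IsRotationPair T (b j) (u j) (v j))
    {x : E} (hu : ∀ j, g x (u j) = 0) (hv : ∀ j, g x (v j) = 0) : x = 0 := by
  have hsq : ∀ i j, i ≠ j → b i ^ 2 ≠ b j ^ 2 := fun i j hij hbb =>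
    hij (hb ((sq_eq_sq₀ (hp i).1.le (hp j).1.le).1 hbb))
  have hv0 : ∀ j, v j ≠ 0 := fun j hv0 => by
    have := (hp j).2.2.inner_self_eq h (hp j).1.ne'
    rw [hv0, map_zero] at this
    exact (hp j).2.1 (h.eq_zero_of_self this)
  refine h.eq_zero_of_orthogonal (ι := Fin n ⊕ Fin n) (w := Sum.elim u v)
    (by simp [hn]; omega) ?_ ?_ ?_
  · rintro (j | j)
    · exact (hp j).2.1
    · exact hv0 j
  · rintro (i | i) (j | j) hij
    · exact ((hp i).2.2.orthogonal h (hp j).2.2 (hsq i j fun h => hij (by rw [h]))).1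
    · by_cases hij' : i = j
      · subst hij'
        exact (hp i).2.2.inner_eq_zero h (hp i).1.ne'
      · exact ((hp i).2.2.orthogonal h (hp j).2.2 (hsq i j hij')).2.1
    · by_cases hij' : i = j
      · subst hij'
        exact (h.symm _ _).trans ((hp i).2.2.inner_eq_zero h (hp i).1.ne')
      · exact ((hp i).2.2.orthogonal h (hp j).2.2 (hsq i j hij')).2.2.1
    · exact ((hp i).2.2.orthogonal h (hp j).2.2 (hsq i j fun h => hij (by rw [h]))).2.2.2
  · rintro (j | j)
    · exact hu j
    · exact hv j

end Frame

section Frame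

variable {E : Type*} [NormedAddCommGroup E] [NormedSpace ℝ E]

/-- The equation of a normalized complex eigenvector: the unknown `((a, b), (u, v))` stands for the
eigenvector `u + i v` and the eigenvalue `a + i b`. -/
def eigenEquation (g : E →L[ℝ] E →L[ℝ] ℝ) (u₀ v₀ : E) (p : (E →L[ℝ] E) × (ℝ × ℝ) × E × E) :
    (E × E) × ℝ × ℝ :=
  ((p.1 p.2.2.1 - p.2.1.1 • p.2.2.1 + p.2.1.2 • p.2.2.2,
    p.1 p.2.2.2 - p.2.1.1 • p.2.2.2 - p.2.1.2 • p.2.2.1),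
    g u₀ p.2.2.1 + g v₀ p.2.2.2 - (g u₀ u₀ + g v₀ v₀), g u₀ p.2.2.2 - g v₀ p.2.2.1)

theorem contDiff_eigenEquation (g : E →L[ℝ] E →L[ℝ] ℝ) (u₀ v₀ : E) :
    ContDiff ℝ ∞ (eigenEquation g u₀ v₀) := by
  unfold eigenEquation
  fun_prop

theorem fderiv_eigenEquation (g : E →L[ℝ] E →L[ℝ] ℝ) (u₀ v₀ : E) (T : E →L[ℝ] E) (b : ℝ)
    (y : (ℝ × ℝ) × E × E) :
    fderiv ℝ (eigenEquation g u₀ v₀) (T, (0, b), u₀, v₀) (0, y) =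
      ((T y.2.1 - y.1.1 • u₀ + (b • y.2.2 + y.1.2 • v₀),
        T y.2.2 - y.1.1 • v₀ - (b • y.2.1 + y.1.2 • u₀)),
        g u₀ y.2.1 + g v₀ y.2.2, g u₀ y.2.2 - g v₀ y.2.1) := by
  have hd := ((contDiff_eigenEquation g u₀ v₀).differentiable (by simp)
    (T, (0, b), u₀, v₀)).hasFDerivAt
  have hline : HasDerivAt (fun s : ℝ => ((T, (0, b), u₀, v₀) : (E →L[ℝ] E) × (ℝ × ℝ) × E × E)
      + s • (0, y)) (0, y) 0 := by
    simpa using ((hasDerivAt_id (0 : ℝ)).smul_const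
      ((0, y) : (E →L[ℝ] E) × (ℝ × ℝ) × E × E)).const_add (T, (0, b), u₀, v₀)
  have h1 := HasFDerivAt.comp_hasDerivAt (f := fun s : ℝ => ((T, (0, b), u₀, v₀) :
    (E →L[ℝ] E) × (ℝ × ℝ) × E × E) + s • (0, y)) (0 : ℝ) (by simpa using hd) hline
  refine h1.unique ?_
  have hs := hasDerivAt_id (0 : ℝ)
  have hu : HasDerivAt (fun s : ℝ => u₀ + s • y.2.1) y.2.1 0 := by
    simpa using (hs.smul_const y.2.1).const_add u₀
  have hv : HasDerivAt (fun s : ℝ => v₀ + s • y.2.2) y.2.2 0 := by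
    simpa using (hs.smul_const y.2.2).const_add v₀
  have ha : HasDerivAt (fun s : ℝ => s * y.1.1) y.1.1 0 := by
    simpa using hs.mul_const y.1.1
  have hb : HasDerivAt (fun s : ℝ => b + s * y.1.2) y.1.2 0 := by
    simpa using (hs.mul_const y.1.2).const_add b
  have hTu := T.hasFDerivAt.comp_hasDerivAt (0 : ℝ) hu
  have hTv := T.hasFDerivAt.comp_hasDerivAt (0 : ℝ) hv
  have key := ((((hTu.sub (ha.smul hu)).add (hb.smul hv)).prodMk
    ((hTv.sub (ha.smul hv)).sub (hb.smul hu)))).prodMk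
    ((((((g u₀).hasFDerivAt.comp_hasDerivAt (0 : ℝ) hu)).add
      ((g v₀).hasFDerivAt.comp_hasDerivAt (0 : ℝ) hv)).sub_const (g u₀ u₀ + g v₀ v₀)).prodMk
      (((g u₀).hasFDerivAt.comp_hasDerivAt (0 : ℝ) hv).sub
        ((g v₀).hasFDerivAt.comp_hasDerivAt (0 : ℝ) hu)))
  refine (key.congr_of_eventuallyEq (Eventually.of_forall fun s => ?_)).congr_deriv ?_
  · simp [eigenEquation]
  · simp

variable [FiniteDimensional ℝ E]

/-- Near an operator with `n` rotation pairs of different frequencies, each of the pairs extends to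
a smooth family. -/
theorem IsSkew.exists_smooth_eigenpair {g : E →L[ℝ] E →L[ℝ] ℝ} {T : E →L[ℝ] E} (h : IsSkew g T)
    {n : ℕ} (hn : Module.finrank ℝ E = 2 * n) {b : Fin n → ℝ} {u v : Fin n → E}
    (hb : Function.Injective b) (hp : ∀ j, 0 < b j ∧ u j ≠ 0 ∧ IsRotationPair T (b j) (u j) (v j))
    (j : Fin n) :
    ∃ (N : Set (E →L[ℝ] E)) (a' b' : (E →L[ℝ] E) → ℝ) (u' v' : (E →L[ℝ] E) → E), IsOpen N ∧ T ∈ N ∧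
      ContDiffOn ℝ ∞ b' N ∧ ContDiffOn ℝ ∞ u' N ∧ ContDiffOn ℝ ∞ v' N ∧ b' T = b j ∧ u' T = u j ∧
      ∀ S ∈ N, S (u' S) = a' S • u' S - b' S • v' S ∧ S (v' S) = a' S • v' S + b' S • u' S := by
  obtain ⟨hbj, huj, hpj⟩ := hp j
  have huv := hpj.inner_eq_zero h hbj.ne'
  have huu := hpj.inner_self_eq h hbj.ne'
  have hpos := h.pos _ huj
  have hvu := (h.symm (v j) (u j)).trans huv
  let D : ((ℝ × ℝ) × E × E) →L[ℝ] (E × E) × ℝ × ℝ :=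
    (fderiv ℝ (eigenEquation g (u j) (v j)) (T, (0, b j), u j, v j)).comp
      (ContinuousLinearMap.inr ℝ _ _)
  have hD : ∀ y, D y = _ := fun y => fderiv_eigenEquation g (u j) (v j) T (b j) y
  have hinj : Function.Injective D.toLinearMap := by
    rw [← LinearMap.ker_eq_bot, LinearMap.ker_eq_bot']
    rintro ⟨⟨a', b'⟩, u', v'⟩ hy
    have hy' := (hD ((a', b'), u', v')).symm.trans hy
    simp only [Prod.mk_eq_zero] at hy'
    obtain ⟨⟨e1, e2⟩, e3, e4⟩ := hy'
    have f1 := congrArg (g (u j)) e1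
    have f2 := congrArg (g (v j)) e2
    have f3 := congrArg (g (v j)) e1
    have f4 := congrArg (g (u j)) e2
    have s1 := h.skew (u j) u'
    have s2 := h.skew (v j) v'
    have s3 := h.skew (v j) u'
    have s4 := h.skew (u j) v'
    rw [hpj.left] at s1 s4
    rw [hpj.right] at s2 s3
    simp only [map_add, map_sub, map_smul, map_neg, map_zero, neg_apply, smul_apply, smul_eq_mul]
      at f1 f2 f3 f4 s1 s2 s3 s4
    have ha' : a' = 0 := by
      have : a' * g (u j) (u j) = 0 := by
        linear_combination (-1 / 2) * (f1 + f2 - s1 - s2) + a' / 2 * huu + b' / 2 * huv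
          - b' / 2 * hvu
      exact (mul_eq_zero.1 this).resolve_right hpos.ne'
    have hb' : b' = 0 := by
      have : b' * g (u j) (u j) = 0 := by
        linear_combination (1 / 2) * (f3 - f4 - s3 + s4) + b' / 2 * huu - a' / 2 * huv
          + a' / 2 * hvu
      exact (mul_eq_zero.1 this).resolve_right hpos.ne'
    subst ha' hb'
    have hp' : IsRotationPair T (b j) u' v' := by
      constructor
      · have := e1
        simp only [zero_smul, sub_zero, add_zero] at this
        exact eq_neg_of_add_eq_zero_left this
      · have := e2
        simp only [zero_smul, sub_zero, add_zero] at this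
        exact sub_eq_zero.1 this
    have hsq : ∀ k, k ≠ j → b j ^ 2 ≠ b k ^ 2 := fun k hk hbb =>
      hk (hb ((sq_eq_sq₀ (hp j).1.le (hp k).1.le).1 hbb)).symm
    have t1 := h.skew u' (u j)
    have t2 := h.skew u' (v j)
    rw [hp'.left, hpj.left] at t1
    rw [hp'.left, hpj.right] at t2
    simp only [map_smul, map_neg, neg_apply, smul_apply, smul_eq_mul] at t1 t2
    have t1' : g v' (u j) + g u' (v j) = 0 := by
      refine (mul_eq_zero.1 (?_ : b j * _ = 0)).resolve_left hbj.ne'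
      linear_combination -t1
    have t2' : g v' (v j) - g u' (u j) = 0 := by
      refine (mul_eq_zero.1 (?_ : b j * _ = 0)).resolve_left hbj.ne'
      linear_combination -t2
    rw [h.symm (u j), h.symm (v j)] at e3 e4
    have hu' : u' = 0 := by
      refine h.eq_zero_of_rotationPairs hn hb hp (fun k => ?_) (fun k => ?_)
      · by_cases hk : k = j
        · subst hk; linarith
        · exact (hp'.orthogonal h (hp k).2.2 (hsq k hk)).1
      · by_cases hk : k = j
        · subst hk; linarith
        · exact (hp'.orthogonal h (hp k).2.2 (hsq k hk)).2.1
    have hv' : v' = 0 := by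
      refine h.eq_zero_of_rotationPairs hn hb hp (fun k => ?_) (fun k => ?_)
      · by_cases hk : k = j
        · subst hk; linarith
        · exact (hp'.orthogonal h (hp k).2.2 (hsq k hk)).2.2.1
      · by_cases hk : k = j
        · subst hk; linarith
        · exact (hp'.orthogonal h (hp k).2.2 (hsq k hk)).2.2.2
    rw [hu', hv']
    rfl
  let L : ((ℝ × ℝ) × E × E) ≃L[ℝ] ((E × E) × ℝ × ℝ) :=
    (LinearMap.linearEquivOfInjective D.toLinearMap hinj
      (by simp [Module.finrank_prod]; ring)).toContinuousLinearEquiv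
  have : CompleteSpace E := FiniteDimensional.complete ℝ E
  have hzero : eigenEquation g (u j) (v j) (T, (0, b j), u j, v j) = 0 := by
    simp [eigenEquation, hpj.left, hpj.right, huv, hvu]
  obtain ⟨N, y, hN, hTN, hy, hyT, hsol⟩ := exists_smooth_implicit isOpen_univ
    (contDiff_eigenEquation g (u j) (v j)).contDiffOn (mem_univ _) hzero
    (L := L) (fun y => rfl)
  refine ⟨N, fun S => (y S).1.1, fun S => (y S).1.2, fun S => (y S).2.1, fun S => (y S).2.2,
    hN, hTN, ?_, ?_, ?_, by simp [hyT], by simp [hyT], fun S hS => ?_⟩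
  · exact (contDiff_snd.comp contDiff_fst).comp_contDiffOn hy
  · exact (contDiff_fst.comp contDiff_snd).comp_contDiffOn hy
  · exact (contDiff_snd.comp contDiff_snd).comp_contDiffOn hy
  · have := hsol S hS
    simp only [eigenEquation, Prod.mk_eq_zero] at this
    obtain ⟨⟨e1, e2⟩, -⟩ := this
    constructor
    · rw [← sub_eq_zero, ← e1]; abel
    · rw [← sub_eq_zero, ← e2]; abel

end Frame

section Frame

variable {E : Type*} [NormedAddCommGroup E] [NormedSpace ℝ E] [FiniteDimensional ℝ E]

/-- The complex eigenvalues of an operator with `n` rotation pairs of different frequencies. -/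
theorem roots_charpoly_of_rotationPairs {T : E →L[ℝ] E}
    {n : ℕ} (hn : Module.finrank ℝ E = 2 * n) {b : Fin n → ℝ} {u v : Fin n → E}
    (hb : Function.Injective b)
    (hp : ∀ j, 0 < b j ∧ u j ≠ 0 ∧ IsRotationPair T (b j) (u j) (v j)) :
    ((T : E →ₗ[ℝ] E).charpoly.map (algebraMap ℝ ℂ)).roots.Nodup ∧
      ((T : E →ₗ[ℝ] E).charpoly.map (algebraMap ℝ ℂ)).roots =
        ∑ j, {(b j : ℂ) * Complex.I, -((b j : ℂ) * Complex.I)} := by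
  set R := ((T : E →ₗ[ℝ] E).charpoly.map (algebraMap ℝ ℂ)).roots with hR
  let f : Fin n → Multiset ℂ := fun j => {(b j : ℂ) * Complex.I, -((b j : ℂ) * Complex.I)}
  have hf : ∀ j c, c ∈ f j ↔ c.re = 0 ∧ (c.im = b j ∨ c.im = -b j) := by
    intro j c
    simp only [f, Multiset.insert_eq_cons, Multiset.mem_cons, Multiset.mem_singleton,
      Complex.ext_iff]
    simp
    tauto
  have hnd : (∑ j, f j).Nodup := by
    change (Multiset.bind Finset.univ.val f).Nodup
    rw [Multiset.nodup_bind]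
    constructor
    · intro j _
      simp only [f, Multiset.insert_eq_cons, Multiset.nodup_cons, Multiset.mem_singleton,
        Multiset.nodup_singleton, and_true, Complex.ext_iff]
      simp
      linarith [(hp j).1]
    · refine (Finset.univ.nodup.pairwise fun i _ j _ hij => ?_)
      change Disjoint (f i) (f j)
      rw [Multiset.disjoint_left]
      intro c hi hj
      obtain ⟨-, h1⟩ := (hf i c).1 hi
      obtain ⟨-, h2⟩ := (hf j c).1 hj
      apply hij
      apply hb
      have := (hp i).1
      have := (hp j).1
      rcases h1 with h1 | h1 <;> rcases h2 with h2 | h2 <;> linarith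
  have hmem : ∀ c ∈ ∑ j, f j, c ∈ R := by
    intro c hc
    obtain ⟨j, -, hj⟩ := Multiset.mem_sum.1 hc
    obtain ⟨hre, him⟩ := (hf j c).1 hj
    rw [hR, mem_roots_charpoly_iff]
    obtain ⟨-, hu, hpair⟩ := hp j
    rcases him with him | him
    · refine ⟨u j, v j, Or.inl hu, ?_, ?_⟩
      · simpa [hre, him] using hpair.left
      · simpa [hre, him] using hpair.right
    · refine ⟨u j, -v j, Or.inl hu, ?_, ?_⟩
      · simpa [hre, him] using hpair.left
      · simpa [hre, him] using hpair.right
  have hcard : Multiset.card R ≤ Multiset.card (∑ j, f j) := by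
    rw [hR, card_roots_charpoly, hn]
    simp [f, mul_comm]
  have heq := Multiset.eq_of_le_of_card_le ((Multiset.le_iff_subset hnd).2 hmem) hcard
  exact ⟨heq ▸ hnd, heq.symm⟩

/-- Smooth dependence of frequencies and of an adapted orthogonal frame. -/
theorem exists_smooth_eigenframe {n : ℕ} (hn : Module.finrank ℝ E = 2 * n) {O : Set E}
    (hO : IsOpen O) {x₀ : E} (hx₀ : x₀ ∈ O) {g : E → E →L[ℝ] E →L[ℝ] ℝ} {T : E → E →L[ℝ] E}
    (hg : ContDiffOn ℝ ∞ g O) (hT : ContDiffOn ℝ ∞ T O) (h : ∀ x ∈ O, IsSkew (g x) (T x))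
    (hinj : Function.Injective (T x₀))
    (hs : ((T x₀ : E →ₗ[ℝ] E).charpoly.map (algebraMap ℝ ℂ)).roots.Nodup) :
    ∃ (N : Set E) (β : Fin n → E → ℝ) (u v : Fin n → E → E), IsOpen N ∧ N ⊆ O ∧ x₀ ∈ N ∧
      (∀ j, ContDiffOn ℝ ∞ (β j) N ∧ ContDiffOn ℝ ∞ (u j) N ∧ ContDiffOn ℝ ∞ (v j) N) ∧
      ∀ x ∈ N, Function.Injective (fun j => β j x) ∧
        (∀ j, 0 < β j x ∧ v j x ≠ 0 ∧ IsRotationPair (T x) (β j x) (v j x) (u j x)) ∧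
        (∀ j, g x (u j x) (u j x) = (β j x)⁻¹) := by
  obtain ⟨b, u₀, v₀, hb, hp⟩ := (h x₀ hx₀).exists_rotationPairs hn hinj hs
  choose N a' b' u' v' hN hTN hb's hu's hv's hb'T hu'T hsol using
    (h x₀ hx₀).exists_smooth_eigenpair hn hb hp
  let W : Fin n → Set E := fun j => O ∩ T ⁻¹' N j
  have hW : ∀ j, IsOpen (W j) := fun j => hT.continuousOn.isOpen_inter_preimage hO (hN j)
  have hxW : ∀ j, x₀ ∈ W j := fun j => ⟨hx₀, hTN j⟩
  have hTW : ∀ j, ContDiffOn ℝ ∞ T (W j) := fun j => hT.mono inter_subset_left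
  have hbW : ∀ j, ContDiffOn ℝ ∞ (fun x => b' j (T x)) (W j) := fun j =>
    (hb's j).comp (hTW j) fun x hx => hx.2
  have huW : ∀ j, ContDiffOn ℝ ∞ (fun x => u' j (T x)) (W j) := fun j =>
    (hu's j).comp (hTW j) fun x hx => hx.2
  have hvW : ∀ j, ContDiffOn ℝ ∞ (fun x => v' j (T x)) (W j) := fun j =>
    (hv's j).comp (hTW j) fun x hx => hx.2
  have hbc : ∀ j, ContinuousAt (fun x => b' j (T x)) x₀ := fun j =>
    (hbW j).continuousOn.continuousAt ((hW j).mem_nhds (hxW j))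
  have huc : ∀ j, ContinuousAt (fun x => u' j (T x)) x₀ := fun j =>
    (huW j).continuousOn.continuousAt ((hW j).mem_nhds (hxW j))
  have hev : ∀ᶠ x in 𝓝 x₀, x ∈ O ∧ (∀ j, x ∈ W j) ∧ (∀ j, 0 < b' j (T x)) ∧
      (∀ j, u' j (T x) ≠ 0) ∧ ∀ i j, i ≠ j → b' i (T x) ≠ b' j (T x) := by
    refine (hO.eventually_mem hx₀).and
      ((eventually_all.2 fun j => (hW j).eventually_mem (hxW j)).and
      ((eventually_all.2 fun j => ?_).and ((eventually_all.2 fun j => ?_).and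
      (eventually_all.2 fun i => eventually_all.2 fun j => ?_))))
    · exact (hbc j).eventually_const_lt (by simpa [hb'T] using (hp j).1)
    · exact (huc j).eventually_ne (by simpa [hu'T] using (hp j).2.1)
    · by_cases hij : i = j
      · exact Eventually.of_forall fun x hne => (hne hij).elim
      · have hne : b' i (T x₀) - b' j (T x₀) ≠ 0 := by
          rw [hb'T, hb'T, sub_ne_zero]
          exact fun h' => hij (hb h')
        exact (((hbc i).sub (hbc j)).eventually_ne hne).mono fun x hx _ => sub_ne_zero.1 hx
  obtain ⟨N', hN', hN'o, hxN'⟩ := eventually_nhds_iff.1 hev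
  have hpair : ∀ x ∈ N', ∀ j, IsRotationPair (T x) (b' j (T x)) (u' j (T x)) (v' j (T x)) := by
    intro x hx j
    obtain ⟨hxO, hxW, hb, hu, -⟩ := hN' x hx
    obtain ⟨e1, e2⟩ := hsol j (T x) (hxW j).2
    have ha := (h x hxO).re_eq_zero (Or.inl (hu j)) e1 e2
    rw [ha] at e1 e2
    exact ⟨by simpa using e1, by simpa using e2⟩
  let s : Fin n → E → ℝ := fun j x => (√(b' j (T x) * g x (u' j (T x)) (u' j (T x))))⁻¹
  have hpos : ∀ x ∈ N', ∀ j, 0 < b' j (T x) * g x (u' j (T x)) (u' j (T x)) := fun x hx j =>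
    mul_pos ((hN' x hx).2.2.1 j) ((h x (hN' x hx).1).pos _ ((hN' x hx).2.2.2.1 j))
  have hN'O : N' ⊆ O := fun x hx => (hN' x hx).1
  have hN'W : ∀ j, N' ⊆ W j := fun j x hx => (hN' x hx).2.1 j
  have hss : ∀ j, ContDiffOn ℝ ∞ (s j) N' := fun j => by
    refine ContDiffOn.inv (ContDiffOn.sqrt (((hbW j).mono (hN'W j)).mul
      (((hg.mono hN'O).clm_apply ((huW j).mono (hN'W j))).clm_apply ((huW j).mono (hN'W j)))) ?_) ?_
    · exact fun x hx => (hpos x hx j).ne'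
    · exact fun x hx => (Real.sqrt_pos.2 (hpos x hx j)).ne'
  have hspos : ∀ x ∈ N', ∀ j, 0 < s j x := fun x hx j => inv_pos.2 (Real.sqrt_pos.2 (hpos x hx j))
  refine ⟨N', fun j x => b' j (T x), fun j x => s j x • v' j (T x), fun j x => s j x • u' j (T x),
    hN'o, hN'O, hxN', fun j => ⟨(hbW j).mono (hN'W j), (hss j).smul ((hvW j).mono (hN'W j)),
      (hss j).smul ((huW j).mono (hN'W j))⟩, fun x hx => ⟨?_, fun j => ⟨?_, ?_, ?_⟩, fun j => ?_⟩⟩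
  · intro i j hij
    by_contra hne
    exact (hN' x hx).2.2.2.2 i j hne hij
  · exact (hN' x hx).2.2.1 j
  · exact smul_ne_zero (hspos x hx j).ne' ((hN' x hx).2.2.2.1 j)
  · have := hpair x hx j
    exact ⟨by rw [map_smul, this.left, smul_neg, smul_comm],
      by rw [map_smul, this.right, smul_comm]⟩
  · have hb := (hN' x hx).2.2.1 j
    have huu := (hpair x hx j).inner_self_eq (h x (hN'O hx)) hb.ne'
    have hs2 : s j x * s j x = (b' j (T x) * g x (u' j (T x)) (u' j (T x)))⁻¹ := by
      simp only [s]
      rw [← mul_inv, Real.mul_self_sqrt (hpos x hx j).le]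
    have hgpos := (h x (hN'O hx)).pos _ ((hN' x hx).2.2.2.1 j)
    simp only [map_smul, smul_apply, smul_eq_mul, ← huu]
    rw [← mul_assoc, hs2]
    field_simp

end Frame

section Forms

variable {F F' : Type*} [NormedAddCommGroup F'] [NormedSpace ℝ F'] [NormedAddCommGroup F]
  [NormedSpace ℝ F]

/-- The exterior derivative of `1`-forms on vector spaces commutes with pullbacks. -/
theorem dForm_pullback {f : F → F'} {θ : F' → F' →L[ℝ] ℝ} {x : F} (hf : ContDiffAt ℝ ∞ f x)
    (hθ : DifferentiableAt ℝ θ (f x)) (X Y : F) :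
    dForm (fun y => (θ (f y)).comp (fderiv ℝ f y)) x X Y =
      dForm θ (f x) (fderiv ℝ f x X) (fderiv ℝ f x Y) := by
  have hfd := (hf.differentiableAt (by simp)).hasFDerivAt
  have hf2 : DifferentiableAt ℝ (fderiv ℝ f) x :=
    (hf.fderiv_right (m := 1) (by exact two_le_infty)).differentiableAt (by simp)
  have hs := hf.isSymmSndFDerivAt (by simpa using two_le_infty)
  have h1 : HasFDerivAt (fun y => θ (f y)) ((fderiv ℝ θ (f x)).comp (fderiv ℝ f x)) x :=
    hθ.hasFDerivAt.comp x hfd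
  have h2 := h1.clm_comp hf2.hasFDerivAt
  rw [dForm_apply, dForm_apply, h2.fderiv]
  simp [hs X Y]

theorem contDiffOn_pullback {f : F → F'} {θ : F' → F' →L[ℝ] ℝ} {U : Set F} {U' : Set F'}
    (hU : IsOpen U) (hf : ContDiffOn ℝ ∞ f U) (hθ : ContDiffOn ℝ ∞ θ U') (h : MapsTo f U U') :
    ContDiffOn ℝ ∞ (fun y => (θ (f y)).comp (fderiv ℝ f y)) U :=
  (hθ.comp hf h).clm_comp (hf.fderiv_of_isOpen hU (by simp))

theorem isInvertible_of_injective {F F' : Type*} [NormedAddCommGroup F] [NormedSpace ℝ F]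
    [NormedAddCommGroup F'] [NormedSpace ℝ F'] [FiniteDimensional ℝ F] [FiniteDimensional ℝ F']
    (hfin : Module.finrank ℝ F = Module.finrank ℝ F') {T : F →L[ℝ] F'}
    (hT : Function.Injective T) : T.IsInvertible :=
  ⟨(LinearMap.linearEquivOfInjective T.toLinearMap hT hfin).toContinuousLinearEquiv,
    by ext v; rfl⟩

theorem finrank_dual_eq [FiniteDimensional ℝ F] :
    Module.finrank ℝ (F →L[ℝ] ℝ) = Module.finrank ℝ F := by
  rw [← (LinearMap.toContinuousLinearMap (𝕜 := ℝ) (E := F) (F' := ℝ)).finrank_eq]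
  exact Subspace.dual_finrank_eq

theorem dForm_linear (b : F →L[ℝ] F →L[ℝ] ℝ) (x : F) : dForm (fun y => b y) x = altCLM F b := by
  rw [dForm, b.hasFDerivAt.fderiv]

/-- The coordinate functionals on phase space. -/
def coordCLM {n : ℕ} (i : Fin n ⊕ Fin n) : PhaseSpace n →L[ℝ] ℝ := EuclideanSpace.proj i

@[simp]
theorem coordCLM_apply {n : ℕ} (i : Fin n ⊕ Fin n) (z : PhaseSpace n) : coordCLM i z = z i := rfl

/-- The bilinear form `(w, w') ↦ ∑ η_j y'_j`, i.e. the primitive `η dy` of the standard form. -/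
def stdPrimitive (n : ℕ) : PhaseSpace n →L[ℝ] PhaseSpace n →L[ℝ] ℝ :=
  ∑ j : Fin n, (coordCLM (Sum.inr j)).smulRight (coordCLM (Sum.inl j))

theorem stdPrimitive_apply (n : ℕ) (X Y : PhaseSpace n) :
    stdPrimitive n X Y = ∑ j : Fin n, X (Sum.inr j) * Y (Sum.inl j) := by
  simp [stdPrimitive, sum_apply]

/-- The standard form as a continuous bilinear map. -/
def stdFormCLM (n : ℕ) : PhaseSpace n →L[ℝ] PhaseSpace n →L[ℝ] ℝ := altCLM _ (stdPrimitive n)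

theorem stdFormCLM_apply (n : ℕ) (X Y : PhaseSpace n) : stdFormCLM n X Y = stdForm n X Y := by
  simp [stdFormCLM, stdPrimitive_apply, stdForm, Finset.sum_sub_distrib]

theorem dForm_stdPrimitive (n : ℕ) (w X Y : PhaseSpace n) :
    dForm (fun w => stdPrimitive n w) w X Y = stdForm n X Y := by
  rw [dForm_linear, ← stdFormCLM_apply]
  rfl

/-- The primitive `η dy + ξ dx` of the product form. -/
def prodPrimitive (n : ℕ) :
    (PhaseSpace n × PhaseSpace n) →L[ℝ] (PhaseSpace n × PhaseSpace n) →L[ℝ] ℝ :=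
  ((stdPrimitive n).bilinearComp (ContinuousLinearMap.fst ℝ _ _) (ContinuousLinearMap.fst ℝ _ _)) +
    ((stdPrimitive n).bilinearComp (ContinuousLinearMap.snd ℝ _ _)
      (ContinuousLinearMap.snd ℝ _ _))

theorem dForm_prodPrimitive (n : ℕ) (w X Y : PhaseSpace n × PhaseSpace n) :
    dForm (fun w => prodPrimitive n w) w X Y = prodForm n X Y := by
  rw [dForm_linear, prodForm, ← stdFormCLM_apply,
    ← stdFormCLM_apply]
  simp [prodPrimitive, stdFormCLM]

theorem eq_zero_of_stdForm {n : ℕ} {X : PhaseSpace n} (h : ∀ Y, stdForm n X Y = 0) : X = 0 := by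
  classical
  ext i
  rcases i with j | j
  · have := h (EuclideanSpace.single (Sum.inr j) 1)
    simpa [stdForm] using this
  · have := h (EuclideanSpace.single (Sum.inl j) 1)
    simpa [stdForm] using this

theorem eq_zero_of_prodForm {n : ℕ} {X : PhaseSpace n × PhaseSpace n}
    (h : ∀ Y, prodForm n X Y = 0) : X = 0 := by
  have h0 : ∀ X : PhaseSpace n, stdForm n X 0 = 0 := fun X => by simp [stdForm]
  refine Prod.ext (eq_zero_of_stdForm fun Y => ?_) (eq_zero_of_stdForm fun Y => ?_)
  · simpa [prodForm, h0] using h (Y, 0)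
  · simpa [prodForm, h0] using h (0, Y)

theorem isInvertible_dForm_stdPrimitive (n : ℕ) (w : PhaseSpace n) :
    (dForm (fun w => stdPrimitive n w) w).IsInvertible := by
  refine isInvertible_of_injective finrank_dual_eq.symm ?_
  rw [injective_iff_map_eq_zero]
  exact fun X hX => eq_zero_of_stdForm fun Y => by rw [← dForm_stdPrimitive n w, hX]; rfl

theorem isInvertible_dForm_prodPrimitive (n : ℕ) (w : PhaseSpace n × PhaseSpace n) :
    (dForm (fun w => prodPrimitive n w) w).IsInvertible := by
  refine isInvertible_of_injective finrank_dual_eq.symm ?_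
  rw [injective_iff_map_eq_zero]
  exact fun X hX => eq_zero_of_prodForm fun Y => by rw [← dForm_prodPrimitive n w, hX]; rfl

/-- The bilinear form underlying the Liouville form `p dx` on `E × E*`. -/
def liouvilleCLM (E : Type*) [NormedAddCommGroup E] [NormedSpace ℝ E] :
    (E × (E →L[ℝ] ℝ)) →L[ℝ] (E × (E →L[ℝ] ℝ)) →L[ℝ] ℝ :=
  (ContinuousLinearMap.precomp ℝ (ContinuousLinearMap.fst ℝ E (E →L[ℝ] ℝ))).comp
    (ContinuousLinearMap.snd ℝ E (E →L[ℝ] ℝ))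

theorem liouvilleCLM_apply (E : Type*) [NormedAddCommGroup E] [NormedSpace ℝ E]
    (X Y : E × (E →L[ℝ] ℝ)) : liouvilleCLM E X Y = X.2 Y.1 := rfl

theorem dForm_liouvilleCLM {E : Type*} [NormedAddCommGroup E] [NormedSpace ℝ E]
    (x X Y : E × (E →L[ℝ] ℝ)) :
    dForm (fun x => liouvilleCLM E x) x X Y = X.2 Y.1 - Y.2 X.1 := by
  rw [dForm_linear]
  rfl

end Forms

section FrameMap

variable {E : Type*} [NormedAddCommGroup E] [NormedSpace ℝ E] {n : ℕ}

/-- The linear map `(x, ξ) ↦ ∑ x_j u_j + ξ_j v_j`. -/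
def frameMap (u v : Fin n → E) : PhaseSpace n →L[ℝ] E :=
  ∑ j : Fin n, ((coordCLM (Sum.inl j)).smulRight (u j) + (coordCLM (Sum.inr j)).smulRight (v j))

theorem frameMap_apply (u v : Fin n → E) (z : PhaseSpace n) :
    frameMap u v z = ∑ j : Fin n, (z (Sum.inl j) • u j + z (Sum.inr j) • v j) := by
  simp [frameMap, sum_apply]

theorem contDiffOn_frameMap {X : Type*} [NormedAddCommGroup X] [NormedSpace ℝ X] {N : Set X}
    {u v : Fin n → X → E} (hu : ∀ j, ContDiffOn ℝ ∞ (u j) N) (hv : ∀ j, ContDiffOn ℝ ∞ (v j) N) :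
    ContDiffOn ℝ ∞ (fun x => frameMap (fun j => u j x) (fun j => v j x)) N := by
  have hsm : ∀ (c : PhaseSpace n →L[ℝ] ℝ) (w : X → E), ContDiffOn ℝ ∞ w N →
      ContDiffOn ℝ ∞ (fun x => c.smulRight (w x)) N := fun c w hw =>
    (ContinuousLinearMap.smulRightL ℝ (PhaseSpace n) E c).contDiff.comp_contDiffOn hw
  exact ContDiffOn.sum fun j _ => (hsm _ _ (hu j)).add (hsm _ _ (hv j))

variable {g : E →L[ℝ] E →L[ℝ] ℝ} {T : E →L[ℝ] E} {β : Fin n → ℝ}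
  {u v : Fin n → E}

/-- An adapted frame: rotation pairs of different frequencies, normalized by
`g(u_j, u_j) = 1 / β_j`. -/
structure IsAdaptedFrame (g : E →L[ℝ] E →L[ℝ] ℝ) (T : E →L[ℝ] E) (β : Fin n → ℝ)
    (u v : Fin n → E) : Prop where
  isSkew : IsSkew g T
  injective : Function.Injective β
  pair : ∀ j, 0 < β j ∧ v j ≠ 0 ∧ IsRotationPair T (β j) (v j) (u j)
  norm : ∀ j, g (u j) (u j) = (β j)⁻¹

theorem IsAdaptedFrame.inner_frameMap (h : IsAdaptedFrame g T β u v) (a b : PhaseSpace n) :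
    g (frameMap u v a) (frameMap u v b) =
      ∑ j, (β j)⁻¹ * (a (Sum.inl j) * b (Sum.inl j) + a (Sum.inr j) * b (Sum.inr j)) := by
  have hsq : ∀ i j, i ≠ j → β i ^ 2 ≠ β j ^ 2 := fun i j hij hbb =>
    hij (h.injective ((sq_eq_sq₀ (h.pair i).1.le (h.pair j).1.le).1 hbb))
  rw [frameMap_apply u v a, map_sum, sum_apply]
  refine Finset.sum_congr rfl fun i _ => ?_
  rw [frameMap_apply, map_sum, Finset.sum_eq_single i]
  · obtain ⟨hb, hv, hp⟩ := h.pair i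
    have e1 := hp.inner_eq_zero h.isSkew hb.ne'
    have e2 := (h.isSkew.symm (u i) (v i)).trans e1
    have e3 := hp.inner_self_eq h.isSkew hb.ne'
    simp only [map_add, map_smul, add_apply, smul_apply, smul_eq_mul, e1, e2, e3, h.norm]
    ring
  · intro j _ hij
    obtain ⟨e1, e2, e3, e4⟩ := (h.pair i).2.2.orthogonal h.isSkew (h.pair j).2.2
      (hsq i j hij.symm)
    simp [e1, e2, e3, e4]
  · simp

theorem IsAdaptedFrame.apply_frameMap (h : IsAdaptedFrame g T β u v) (z : PhaseSpace n) :
    T (frameMap u v z) = frameMap u v (WithLp.toLp 2 (Sum.elim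
      (fun j => -(β j * z (Sum.inr j))) (fun j => β j * z (Sum.inl j)))) := by
  rw [frameMap_apply, frameMap_apply, map_sum]
  refine Finset.sum_congr rfl fun j _ => ?_
  obtain ⟨-, -, hp⟩ := h.pair j
  simp only [map_add, map_smul, hp.left, hp.right, Sum.elim_inl, Sum.elim_inr]
  module

theorem IsAdaptedFrame.form_frameMap (h : IsAdaptedFrame g T β u v) (a b : PhaseSpace n) :
    g (T (frameMap u v a)) (frameMap u v b) = -stdForm n a b := by
  rw [h.apply_frameMap, h.inner_frameMap, stdForm, ← Finset.sum_neg_distrib]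
  refine Finset.sum_congr rfl fun j _ => ?_
  have := (h.pair j).1
  simp only [Sum.elim_inl, Sum.elim_inr]
  field_simp
  ring

theorem IsAdaptedFrame.normSq_frameMap (h : IsAdaptedFrame g T β u v) (z : PhaseSpace n) :
    g (T (frameMap u v z)) (T (frameMap u v z)) = ∑ j, β j * normSqAt z j := by
  rw [h.apply_frameMap, h.inner_frameMap]
  refine Finset.sum_congr rfl fun j _ => ?_
  have := (h.pair j).1
  simp only [Sum.elim_inl, Sum.elim_inr, normSqAt]
  field_simp
  ring

theorem IsAdaptedFrame.injective_frameMap (h : IsAdaptedFrame g T β u v) :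
    Function.Injective (frameMap u v) := by
  rw [injective_iff_map_eq_zero]
  refine fun z hz => eq_zero_of_stdForm fun b => ?_
  have := h.form_frameMap z b
  rw [hz, map_zero, map_zero, zero_apply] at this
  linarith

/-- Exchanging `x` and `ξ`. -/
def swapCLE (n : ℕ) : PhaseSpace n ≃L[ℝ] PhaseSpace n :=
  (LinearIsometryEquiv.piLpCongrLeft 2 ℝ ℝ (Equiv.sumComm (Fin n) (Fin n))).toContinuousLinearEquiv

theorem stdForm_swapCLE (n : ℕ) (a b : PhaseSpace n) :
    stdForm n (swapCLE n a) (swapCLE n b) = -stdForm n a b := by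
  simp only [stdForm, ← Finset.sum_neg_distrib]
  refine Finset.sum_congr rfl fun j _ => ?_
  have h1 : ∀ (a : PhaseSpace n) j, swapCLE n a (Sum.inl j) = a (Sum.inr j) := fun a j => rfl
  have h2 : ∀ (a : PhaseSpace n) j, swapCLE n a (Sum.inr j) = a (Sum.inl j) := fun a j => rfl
  rw [h1, h1, h2, h2]
  ring

end FrameMap

section Taylor

variable {W Z Y : Type*} [NormedAddCommGroup W] [NormedSpace ℝ W] [NormedAddCommGroup Z]
  [NormedSpace ℝ Z] [NormedAddCommGroup Y] [NormedSpace ℝ Y]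

/-- A smooth function vanishing on `z = 0` is `O(|z|)`, locally uniformly. -/
theorem exists_norm_le_of_vanishing {U : Set (W × Z)} (hU : IsOpen U) {f : W × Z → Y}
    (hf : ContDiffOn ℝ ∞ f U) {w₀ : W} (h₀ : (w₀, (0 : Z)) ∈ U)
    (hv : ∀ w, (w, (0 : Z)) ∈ U → f (w, 0) = 0) :
    ∃ C : ℝ, 0 ≤ C ∧ ∀ᶠ p in 𝓝 (w₀, (0 : Z)), ‖f p‖ ≤ C * ‖p.2‖ := by
  have hc : ContinuousAt (fderiv ℝ f) (w₀, 0) :=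
    (hf.continuousOn_fderiv_of_isOpen hU (by simp)).continuousAt (hU.mem_nhds h₀)
  set C := ‖fderiv ℝ f (w₀, 0)‖ + 1
  have hev : ∀ᶠ p in 𝓝 (w₀, (0 : Z)), ‖fderiv ℝ f p‖ < C ∧ p ∈ U :=
    (hc.norm.eventually_lt_const (lt_add_one _)).and (hU.eventually_mem h₀)
  obtain ⟨r, hr, hball⟩ := Metric.eventually_nhds_iff_ball.1 hev
  refine ⟨C, by positivity, ?_⟩
  filter_upwards [Metric.ball_mem_nhds _ hr] with p hp
  have hp0 : (p.1, (0 : Z)) ∈ Metric.ball (w₀, (0 : Z)) r := by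
    rw [Metric.mem_ball, Prod.dist_eq] at hp ⊢
    simpa using (max_lt_iff.1 hp).1
  have key := (convex_ball (w₀, (0 : Z)) r).norm_image_sub_le_of_norm_fderiv_le (𝕜 := ℝ) (f := f)
    (fun x hx => (hf.contDiffAt (hU.mem_nhds (hball x hx).2)).differentiableAt (by simp))
    (fun x hx => (hball x hx).1.le) hp0 hp
  rw [hv _ (hball _ hp0).2, sub_zero] at key
  have : p - (p.1, (0 : Z)) = (0, p.2) := by ext <;> simp
  rw [this] at key
  simpa using key

/-- A smooth function vanishing to first order on `z = 0` is `O(|z|²)`, locally uniformly. -/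
theorem exists_norm_le_sq_of_vanishing {U : Set (W × Z)} (hU : IsOpen U) {f : W × Z → Y}
    (hf : ContDiffOn ℝ ∞ f U) {w₀ : W} (h₀ : (w₀, (0 : Z)) ∈ U)
    (hv : ∀ w, (w, (0 : Z)) ∈ U → f (w, 0) = 0)
    (hd : ∀ w, (w, (0 : Z)) ∈ U → ∀ z, fderiv ℝ f (w, 0) (0, z) = 0) :
    ∃ C : ℝ, 0 ≤ C ∧ ∀ᶠ p in 𝓝 (w₀, (0 : Z)), ‖f p‖ ≤ C * ‖p.2‖ ^ 2 := by
  have hf' : ContDiffOn ℝ ∞ (fun p => (fderiv ℝ f p).comp (ContinuousLinearMap.inr ℝ W Z)) U :=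
    (hf.fderiv_of_isOpen hU (by simp)).clm_comp contDiffOn_const
  obtain ⟨C, hC, hev⟩ := exists_norm_le_of_vanishing hU hf' h₀
    (fun w hw => by ext z; exact hd w hw z)
  obtain ⟨r, hr, hball⟩ := Metric.eventually_nhds_iff_ball.1 (hev.and (hU.eventually_mem h₀))
  refine ⟨C, hC, ?_⟩
  filter_upwards [Metric.ball_mem_nhds _ hr] with p hp
  have hin : ∀ z ∈ Metric.closedBall (0 : Z) ‖p.2‖,
      (p.1, z) ∈ Metric.ball (w₀, (0 : Z)) r := by
    intro z hz
    rw [Metric.mem_ball, Prod.dist_eq] at hp ⊢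
    have h1 := max_lt_iff.1 hp
    rw [mem_closedBall_zero_iff] at hz
    refine max_lt h1.1 ?_
    simp only [dist_zero_right] at h1 ⊢
    exact hz.trans_lt h1.2
  have key := (convex_closedBall (0 : Z) ‖p.2‖).norm_image_sub_le_of_norm_hasFDerivWithin_le
    (f := fun z => f (p.1, z))
    (f' := fun z => (fderiv ℝ f (p.1, z)).comp (ContinuousLinearMap.inr ℝ W Z)) (C := C * ‖p.2‖)
    (x := 0) (y := p.2) (fun z hz => ?_) (fun z hz => ?_) (by simp) (by simp)
  · have h0 := hin 0 (by simp)
    rw [hv _ (hball _ h0).2, sub_zero, sub_zero] at key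
    rw [pow_two, ← mul_assoc]
    exact key
  · have h1 := ((hf.contDiffAt (hU.mem_nhds (hball _ (hin z hz)).2)).differentiableAt
      (by simp)).hasFDerivAt
    exact (h1.comp z (hasFDerivAt_prodMk_right p.1 z)).hasFDerivWithinAt
  · refine (hball _ (hin z hz)).1.trans ?_
    rw [mem_closedBall_zero_iff] at hz
    exact mul_le_mul_of_nonneg_left hz hC

end Taylor

section Darboux

variable {n : ℕ}

/-- **Darboux's theorem** for an exact form `da`, given a symplectic basis at the point. -/
theorem exists_darboux_chart {E : Type*} [NormedAddCommGroup E] [NormedSpace ℝ E]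
    {N : Set E} (hN : IsOpen N) {x₀ : E} (hx₀ : x₀ ∈ N)
    {a : E → E →L[ℝ] ℝ} (ha : ContDiffOn ℝ ∞ a N) (L : PhaseSpace n ≃L[ℝ] E)
    (hL : ∀ X Y, dForm a x₀ (L X) (L Y) = stdForm n X Y) :
    ∃ κ : OpenPartialHomeomorph (PhaseSpace n) E, 0 ∈ κ.source ∧ κ 0 = x₀ ∧ κ.target ⊆ N ∧
      ContDiffOn ℝ ∞ κ κ.source ∧ ContDiffOn ℝ ∞ κ.symm κ.target ∧
      ∀ w ∈ κ.source, ∀ X Y,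
        dForm a (κ w) (fderiv ℝ κ w X) (fderiv ℝ κ w Y) = stdForm n X Y := by
  let h : PhaseSpace n ≃ₜ E := L.toHomeomorph.trans (Homeomorph.addLeft x₀)
  have hh : ∀ w, h w = x₀ + L w := fun w => rfl
  have hhs : ∀ x, h.symm x = L.symm (-x₀ + x) := fun x => rfl
  have hsm : ContDiff ℝ ∞ h := contDiff_const.add L.contDiff
  have hsm' : ContDiff ℝ ∞ h.symm := L.symm.contDiff.comp (contDiff_const.add contDiff_id)
  have hd : ∀ w, HasFDerivAt h (L : PhaseSpace n →L[ℝ] E) w := fun w => L.hasFDerivAt.const_add x₀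
  let U : Set (PhaseSpace n) := h ⁻¹' N
  have hU : IsOpen U := hN.preimage h.continuous
  have hh0 : h 0 = x₀ := by simp [hh]
  have h0U : (0 : PhaseSpace n) ∈ U := by
    change h 0 ∈ N
    rwa [hh0]
  have had : ∀ x ∈ N, DifferentiableAt ℝ a x := fun x hx =>
    (ha.contDiffAt (hN.mem_nhds hx)).differentiableAt (by simp)
  have hpb : ∀ w ∈ U, ∀ X Y, dForm (fun y => (a (h y)).comp (fderiv ℝ h y)) w X Y =
      dForm a (h w) (L X) (L Y) := fun w hw X Y => by
    rw [dForm_pullback hsm.contDiffAt (had _ hw), (hd w).fderiv]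
    rfl
  obtain ⟨e, h1, h2, h3, h4, h5, h6, h7⟩ := exists_relative_darboux
    (P := (0 : PhaseSpace n →L[ℝ] PhaseSpace n)) (fun x => rfl) hU
    (stdPrimitive n).contDiff.contDiffOn
    (contDiffOn_pullback hU hsm.contDiffOn ha fun x hx => hx) h0U rfl
    (fun p hp hp0 => by
      have hp0 : p = 0 := hp0.symm
      subst hp0
      ext X Y
      rw [hpb _ hp, hh0, hL]
      exact (dForm_stdPrimitive n 0 X Y).symm)
    (isInvertible_dForm_stdPrimitive n 0)
  refine ⟨e.transHomeomorph h, h1, ?_, ?_, hsm.comp_contDiffOn h4, ?_, ?_⟩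
  · change h (e 0) = x₀
    rw [(h7 0 h1 rfl).1, hh0]
  · intro x hx
    have := h3 hx
    change h (h.symm x) ∈ N at this
    rwa [h.apply_symm_apply] at this
  · exact h5.comp hsm'.contDiffOn fun x hx => hx
  · intro w hw X Y
    have hw' : w ∈ e.source := hw
    have hed := ((h4.contDiffAt (e.open_source.mem_nhds hw')).differentiableAt
      (by simp)).hasFDerivAt
    have hκ : HasFDerivAt (e.transHomeomorph h)
      ((L : PhaseSpace n →L[ℝ] E).comp (fderiv ℝ e w)) w := (hd (e w)).comp w hed
    rw [hκ.fderiv, ← dForm_stdPrimitive n w, ← h6 w hw', hpb _ (h3 (e.map_source hw'))]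
    rfl

end Darboux

section Weinstein

variable {n : ℕ} {E : Type*} [NormedAddCommGroup E] [NormedSpace ℝ E]

instance normedAddCommGroupDualProd : NormedAddCommGroup (E × (E →L[ℝ] ℝ) →L[ℝ] ℝ) :=
  ContinuousLinearMap.toNormedAddCommGroup

instance normedSpaceDualProd : NormedSpace ℝ (E × (E →L[ℝ] ℝ) →L[ℝ] ℝ) :=
  ContinuousLinearMap.toNormedSpace

/-- The embedding of a neighbourhood of the zero section of the symplectic normal bundle of the
graph of `a` into phase space `E × E*`. -/
def normalEmbedding (κ : PhaseSpace n → E) (a : E → E →L[ℝ] ℝ) (Q : E → PhaseSpace n →L[ℝ] E)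
    (p : PhaseSpace n × PhaseSpace n) : E × (E →L[ℝ] ℝ) :=
  (κ p.1 + Q (κ p.1) p.2, a (κ p.1) + (fderiv ℝ a (κ p.1)).flip (Q (κ p.1) p.2))

theorem contDiffOn_flip_apply {X F : Type*} [NormedAddCommGroup X] [NormedSpace ℝ X]
    [NormedAddCommGroup F] [NormedSpace ℝ F] {U : Set X} {b : X → F →L[ℝ] F →L[ℝ] ℝ} {v : X → F}
    (hb : ContDiffOn ℝ ∞ b U) (hv : ContDiffOn ℝ ∞ v U) :
    ContDiffOn ℝ ∞ (fun x => (b x).flip (v x)) U :=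
  (((ContinuousLinearMap.flipₗᵢ ℝ F F ℝ).contDiff).comp_contDiffOn hb).clm_apply hv

theorem contDiffOn_normalEmbedding {κ : PhaseSpace n → E} {V : Set (PhaseSpace n)}
    (hκ : ContDiffOn ℝ ∞ κ V) {N : Set E} (hN : IsOpen N) (hκN : MapsTo κ V N)
    {a : E → E →L[ℝ] ℝ} (ha : ContDiffOn ℝ ∞ a N)
    {Q : E → PhaseSpace n →L[ℝ] E} (hQ : ContDiffOn ℝ ∞ Q N) :
    ContDiffOn ℝ ∞ (normalEmbedding κ a Q) (V ×ˢ univ) := by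
  have h1 : ContDiffOn ℝ ∞ (fun p : PhaseSpace n × PhaseSpace n => κ p.1) (V ×ˢ univ) :=
    hκ.comp contDiff_fst.contDiffOn fun p hp => hp.1
  have hm : MapsTo (fun p : PhaseSpace n × PhaseSpace n => κ p.1) (V ×ˢ univ) N :=
    fun p hp => hκN hp.1
  have h2 : ContDiffOn ℝ ∞ (fun p : PhaseSpace n × PhaseSpace n => Q (κ p.1) p.2) (V ×ˢ univ) :=
    (hQ.comp h1 hm).clm_apply contDiff_snd.contDiffOn
  have h3 := (ha.fderiv_of_isOpen (m := ∞) hN (by simp)).comp h1 hm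
  exact (h1.add h2).prodMk ((ha.comp h1 hm).add (contDiffOn_flip_apply h3 h2))

theorem hasFDerivAt_flip_apply_of_eq_zero {X F : Type*} [NormedAddCommGroup X] [NormedSpace ℝ X]
    [NormedAddCommGroup F] [NormedSpace ℝ F] {b : X → F →L[ℝ] F →L[ℝ] ℝ} {v : X → F}
    {v' : X →L[ℝ] F} {x : X} (hb : DifferentiableAt ℝ b x) (hv : HasFDerivAt v v' x)
    (hvx : v x = 0) :
    HasFDerivAt (fun x => (b x).flip (v x)) ((b x).flip.comp v') x := by
  have h1 : HasFDerivAt (fun x => (b x).flip)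
      ((ContinuousLinearMap.flipₗᵢ ℝ F F ℝ).toContinuousLinearEquiv.toContinuousLinearMap.comp
        (fderiv ℝ b x)) x :=
    (ContinuousLinearMap.flipₗᵢ ℝ F F ℝ).toContinuousLinearEquiv.toContinuousLinearMap.hasFDerivAt.comp
      x hb.hasFDerivAt
  refine (h1.clm_apply hv).congr_fderiv ?_
  ext p q
  simp [hvx]

theorem fderiv_normalEmbedding {κ : PhaseSpace n → E} {N : Set E} (hN : IsOpen N)
    {w : PhaseSpace n} (hκ : DifferentiableAt ℝ κ w) (hw : κ w ∈ N)
    {a : E → E →L[ℝ] ℝ} (ha : ContDiffOn ℝ ∞ a N)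
    {Q : E → PhaseSpace n →L[ℝ] E} (hQ : ContDiffOn ℝ ∞ Q N) (p : PhaseSpace n × PhaseSpace n) :
    fderiv ℝ (normalEmbedding κ a Q) (w, 0) p =
      (fderiv ℝ κ w p.1 + Q (κ w) p.2,
        fderiv ℝ a (κ w) (fderiv ℝ κ w p.1) + (fderiv ℝ a (κ w)).flip (Q (κ w) p.2)) := by
  have hNw := hN.mem_nhds hw
  have h1 : HasFDerivAt (fun p : PhaseSpace n × PhaseSpace n => κ p.1)
      ((fderiv ℝ κ w).comp (ContinuousLinearMap.fst ℝ _ _)) (w, 0) :=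
    HasFDerivAt.comp (g := κ) (w, (0 : PhaseSpace n)) hκ.hasFDerivAt hasFDerivAt_fst
  have had := (ha.contDiffAt hNw).differentiableAt (by simp)
  have hQd := (hQ.contDiffAt hNw).differentiableAt (by simp)
  have hbd := ((ha.fderiv_of_isOpen (m := ∞) hN (by simp)).contDiffAt hNw).differentiableAt
    (by simp)
  have hQ1 : HasFDerivAt (fun p : PhaseSpace n × PhaseSpace n => Q (κ p.1)) _ (w, 0) :=
    HasFDerivAt.comp (g := Q) (w, (0 : PhaseSpace n)) hQd.hasFDerivAt h1
  have h2 : HasFDerivAt (fun p : PhaseSpace n × PhaseSpace n => Q (κ p.1) p.2)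
      ((Q (κ w)).comp (ContinuousLinearMap.snd ℝ _ _)) (w, 0) := by
    refine (hQ1.clm_apply hasFDerivAt_snd).congr_fderiv ?_
    refine ContinuousLinearMap.ext fun p => ?_
    simp
  have hb1 : DifferentiableAt ℝ (fun p : PhaseSpace n × PhaseSpace n => fderiv ℝ a (κ p.1))
      (w, 0) := DifferentiableAt.comp (g := fderiv ℝ a) (w, (0 : PhaseSpace n)) hbd
        h1.differentiableAt
  have ha1 : HasFDerivAt (fun p : PhaseSpace n × PhaseSpace n => a (κ p.1)) _ (w, 0) :=
    HasFDerivAt.comp (g := a) (w, (0 : PhaseSpace n)) had.hasFDerivAt h1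
  have key : HasFDerivAt (normalEmbedding κ a Q) _ (w, 0) := (h1.add h2).prodMk
    (ha1.add (hasFDerivAt_flip_apply_of_eq_zero hb1 h2 (by simp)))
  rw [key.fderiv]
  rfl

/-- **Symplectic normal form near the graph of `a`.** Given a Darboux chart `κ` for `da` and a
frame `Q` of `T E` with `da(Q z, Q z') = -(dξ ∧ dx)(z, z')`, there is a symplectic map `Φ` from a
neighbourhood of `0` to `E × E*` that maps `z = 0` to the graph of `a`, with the normal derivative
prescribed by `Q`. -/
theorem exists_symplectic_normalForm [FiniteDimensional ℝ E]
    (hn : Module.finrank ℝ E = 2 * n) {N : Set E} (hN : IsOpen N)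
    {a : E → E →L[ℝ] ℝ} (ha : ContDiffOn ℝ ∞ a N) {Q : E → PhaseSpace n →L[ℝ] E}
    (hQ : ContDiffOn ℝ ∞ Q N)
    (hQa : ∀ x ∈ N, ∀ X Y, dForm a x (Q x X) (Q x Y) = -stdForm n X Y)
    (κ : OpenPartialHomeomorph (PhaseSpace n) E) (h0 : 0 ∈ κ.source) (hκN : κ.target ⊆ N)
    (hκ : ContDiffOn ℝ ∞ κ κ.source)
    (hκa : ∀ w ∈ κ.source, ∀ X Y,
        dForm a (κ w) (fderiv ℝ κ w X) (fderiv ℝ κ w Y) = stdForm n X Y) :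
    ∃ Φ : OpenPartialHomeomorph (PhaseSpace n × PhaseSpace n) (E × (E →L[ℝ] ℝ)),
      ((0, 0) : PhaseSpace n × PhaseSpace n) ∈ Φ.source ∧ (∀ p ∈ Φ.source, p.1 ∈ κ.source) ∧
      (∀ q ∈ Φ.target, q.1 ∈ N) ∧
      ContDiffOn ℝ ∞ Φ Φ.source ∧ ContDiffOn ℝ ∞ Φ.symm Φ.target ∧
      (∀ p ∈ Φ.source, ∀ X Y, (fderiv ℝ Φ p X).2 (fderiv ℝ Φ p Y).1
        - (fderiv ℝ Φ p Y).2 (fderiv ℝ Φ p X).1 = prodForm n X Y) ∧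
      ∀ w, (w, (0 : PhaseSpace n)) ∈ Φ.source → Φ (w, 0) = (κ w, a (κ w)) ∧
        ∀ z, fderiv ℝ Φ (w, 0) (0, z) = (Q (κ w) z, (fderiv ℝ a (κ w)).flip (Q (κ w) z)) := by
  set Ψ := normalEmbedding κ a Q with hΨdef
  let U : Set (PhaseSpace n × PhaseSpace n) := κ.source ×ˢ univ
  have hU : IsOpen U := κ.open_source.prod isOpen_univ
  have hmaps : MapsTo κ κ.source N := fun w hw => hκN (κ.map_source hw)
  have hΨ : ContDiffOn ℝ ∞ Ψ U := contDiffOn_normalEmbedding hκ hN hmaps ha hQ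
  have hΨd : ∀ w ∈ κ.source, ∀ p, fderiv ℝ Ψ (w, 0) p = _ := fun w hw p =>
    fderiv_normalEmbedding hN
      ((hκ.contDiffAt (κ.open_source.mem_nhds hw)).differentiableAt (by simp)) (hmaps hw) ha hQ p
  have hpb : ∀ p ∈ U, ∀ X Y,
      dForm (fun y => (liouvilleCLM E (Ψ y)).comp (fderiv ℝ Ψ y)) p X Y =
        (fderiv ℝ Ψ p X).2 (fderiv ℝ Ψ p Y).1 - (fderiv ℝ Ψ p Y).2 (fderiv ℝ Ψ p X).1 :=
    fun p hp X Y => by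
      have := dForm_pullback (θ := fun x => liouvilleCLM E x) (hΨ.contDiffAt (hU.mem_nhds hp))
        (liouvilleCLM E).differentiableAt X Y
      rw [dForm_liouvilleCLM] at this
      exact this
  let P : (PhaseSpace n × PhaseSpace n) →L[ℝ] (PhaseSpace n × PhaseSpace n) :=
    (ContinuousLinearMap.inl ℝ _ _).comp (ContinuousLinearMap.fst ℝ _ _)
  obtain ⟨e, h1, h2, h3, h4, h5, h6, h7⟩ := exists_relative_darboux
    (P := P) (fun x => rfl) hU (prodPrimitive n).contDiff.contDiffOn
    (contDiffOn_pullback hU hΨ ((liouvilleCLM E).contDiff.contDiffOn (s := univ))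
      fun x _ => mem_univ _)
    (p₀ := ((0, 0) : PhaseSpace n × PhaseSpace n)) ⟨h0, mem_univ _⟩ rfl
    (fun p hp hPp => by
      obtain ⟨w, z⟩ := p
      have hz : z = 0 := (congrArg Prod.snd hPp).symm
      subst hz
      refine ContinuousLinearMap.ext fun X => ContinuousLinearMap.ext fun Y => ?_
      rw [hpb _ hp, hΨd w hp.1, hΨd w hp.1, dForm_prodPrimitive]
      have e1 := hκa w hp.1 X.1 Y.1
      have e2 := hQa _ (hmaps hp.1) X.2 Y.2
      rw [dForm_apply] at e1 e2
      simp only [map_add, add_apply, ContinuousLinearMap.flip_apply, prodForm]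
      linarith)
    (isInvertible_dForm_prodPrimitive n _)
  -- the composite
  let Φ₀ : PhaseSpace n × PhaseSpace n → E × (E →L[ℝ] ℝ) := fun p => Ψ (e p)
  have hΦ₀ : ContDiffOn ℝ ∞ Φ₀ e.source := hΨ.comp h4 fun p hp => h3 (e.map_source hp)
  have hΦ₀d : ∀ p ∈ e.source, HasFDerivAt Φ₀ ((fderiv ℝ Ψ (e p)).comp (fderiv ℝ e p)) p :=
    fun p hp => HasFDerivAt.comp p
      ((hΨ.contDiffAt (hU.mem_nhds (h3 (e.map_source hp)))).differentiableAt (by simp)).hasFDerivAt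
      ((h4.contDiffAt (e.open_source.mem_nhds hp)).differentiableAt (by simp)).hasFDerivAt
  have hsymp : ∀ p ∈ e.source, ∀ X Y, (fderiv ℝ Φ₀ p X).2 (fderiv ℝ Φ₀ p Y).1
        - (fderiv ℝ Φ₀ p Y).2 (fderiv ℝ Φ₀ p X).1 = prodForm n X Y := by
    intro p hp X Y
    rw [← dForm_prodPrimitive n p, ← h6 p hp, hpb _ (h3 (e.map_source hp)), (hΦ₀d p hp).fderiv]
    rfl
  have hfix : ∀ w, (w, (0 : PhaseSpace n)) ∈ e.source → Φ₀ (w, 0) = (κ w, a (κ w)) ∧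
      ∀ z, fderiv ℝ Φ₀ (w, 0) (0, z) = (Q (κ w) z, (fderiv ℝ a (κ w)).flip (Q (κ w) z)) := by
    intro w hw
    obtain ⟨e1, e2⟩ := h7 (w, 0) hw rfl
    constructor
    · simp [Φ₀, e1, hΨdef, normalEmbedding]
    · intro z
      rw [(hΦ₀d _ hw).fderiv, e1, e2, ContinuousLinearMap.comp_id, hΨd w (h2 hw).1]
      simp
  have hinj : Function.Injective (fderiv ℝ Φ₀ (0, 0)) := by
    rw [injective_iff_map_eq_zero]
    intro X hX
    refine eq_zero_of_prodForm fun Y => ?_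
    rw [← hsymp _ h1, hX]
    simp
  obtain ⟨L, hL⟩ := isInvertible_of_injective (by
    rw [Module.finrank_prod, Module.finrank_prod, finrank_dual_eq, hn]
    simp
    ring) hinj
  let U' := e.source ∩ Φ₀ ⁻¹' (N ×ˢ univ)
  have hU' : IsOpen U' := hΦ₀.continuousOn.isOpen_inter_preimage e.open_source
    (hN.prod isOpen_univ)
  have h0U' : ((0, 0) : PhaseSpace n × PhaseSpace n) ∈ U' := by
    refine ⟨h1, ?_⟩
    change Φ₀ (0, 0) ∈ N ×ˢ (univ : Set (E →L[ℝ] ℝ))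
    rw [(hfix 0 h1).1]
    exact ⟨hmaps h0, mem_univ _⟩
  obtain ⟨Φ, hΦ1, hΦ2, hΦ3, hΦ4, hΦ5⟩ := exists_smooth_inverse hU' (hΦ₀.mono inter_subset_left)
    h0U' (f' := L) (by rw [hL]; exact (hΦ₀d _ h1).differentiableAt.hasFDerivAt)
  have hΦeq : (Φ : PhaseSpace n × PhaseSpace n → E × (E →L[ℝ] ℝ)) = Φ₀ := funext hΦ3
  refine ⟨Φ, hΦ1, fun p hp => (h2 (hΦ2 hp).1).1, fun q hq => ?_, hΦ4, hΦ5, ?_, ?_⟩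
  · have := (hΦ2 (Φ.map_target hq)).2
    change Φ₀ (Φ.symm q) ∈ N ×ˢ (univ : Set (E →L[ℝ] ℝ)) at this
    rw [← hΦeq, Φ.right_inv hq] at this
    exact this.1
  · rw [hΦeq]
    exact fun p hp => hsymp p (hΦ2 hp).1
  · rw [hΦeq]
    exact fun w hw => hfix w (hΦ2 hw).1

end Weinstein

section Expansion

variable {n : ℕ} {E : Type*} [NormedAddCommGroup E] [NormedSpace ℝ E]

instance normedAddCommGroupOfDual : NormedAddCommGroup ((E →L[ℝ] ℝ) →L[ℝ] E) :=
  ContinuousLinearMap.toNormedAddCommGroup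

instance normedSpaceOfDual : NormedSpace ℝ ((E →L[ℝ] ℝ) →L[ℝ] E) :=
  ContinuousLinearMap.toNormedSpace

/-- The cubic error made when evaluating a family of quadratic forms `r(G r)` at nearby
arguments. -/
theorem abs_sub_quadratic_le {G G₀ : (E →L[ℝ] ℝ) →L[ℝ] E} {r ρ : E →L[ℝ] ℝ} {C t : ℝ}
    (ht : 0 ≤ t) (hC : 0 ≤ C) (hr : ‖r‖ ≤ C * t) (hρ : ‖ρ‖ ≤ C * t) (hrρ : ‖r - ρ‖ ≤ C * t ^ 2)
    (hG : ‖G - G₀‖ ≤ C * t) (hG₀ : ‖G₀‖ ≤ C) :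
    |r (G r) - ρ (G₀ ρ)| ≤ 3 * C ^ 3 * t ^ 3 := by
  have key : r (G r) - ρ (G₀ ρ) = r ((G - G₀) r) + (r - ρ) (G₀ r) + ρ (G₀ (r - ρ)) := by
    simp only [sub_apply, map_sub]
    ring
  have hb : ∀ (p q : E →L[ℝ] ℝ) (A : (E →L[ℝ] ℝ) →L[ℝ] E), |p (A q)| ≤ ‖p‖ * (‖A‖ * ‖q‖) :=
    fun p q A => (p.le_opNorm _).trans (mul_le_mul_of_nonneg_left (A.le_opNorm q) (norm_nonneg _))
  have hCt : 0 ≤ C * t := by positivity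
  have hCt2 : 0 ≤ C * t ^ 2 := by positivity
  have b1 : |r ((G - G₀) r)| ≤ (C * t) * ((C * t) * (C * t)) :=
    (hb _ _ _).trans (by gcongr)
  have b2 : |(r - ρ) (G₀ r)| ≤ (C * t ^ 2) * (C * (C * t)) :=
    (hb _ _ _).trans (by gcongr)
  have b3 : |ρ (G₀ (r - ρ))| ≤ (C * t) * (C * (C * t ^ 2)) :=
    (hb _ _ _).trans (by gcongr)
  rw [key]
  calc _ ≤ |r ((G - G₀) r)| + |(r - ρ) (G₀ r)| + |ρ (G₀ (r - ρ))| := abs_add_three _ _ _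
    _ ≤ _ := by linarith

/-- Expansion of the Hamiltonian in the symplectic normal form. -/
theorem exists_hamiltonian_expansion {N : Set E} (hN : IsOpen N)
    {a : E → E →L[ℝ] ℝ} (ha : ContDiffOn ℝ ∞ a N) {Q : E → PhaseSpace n →L[ℝ] E}
    (hQ : ContDiffOn ℝ ∞ Q N) {G : E → (E →L[ℝ] ℝ) →L[ℝ] E} (hG : ContDiffOn ℝ ∞ G N)
    (κ : OpenPartialHomeomorph (PhaseSpace n) E) (hκN : κ.target ⊆ N)
    (hκ : ContDiffOn ℝ ∞ κ κ.source)
    {Φ : PhaseSpace n × PhaseSpace n → E × (E →L[ℝ] ℝ)} {U : Set (PhaseSpace n × PhaseSpace n)}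
    (hU : IsOpen U) (h0 : ((0, 0) : PhaseSpace n × PhaseSpace n) ∈ U)
    (hUκ : ∀ p ∈ U, p.1 ∈ κ.source) (hUN : ∀ p ∈ U, (Φ p).1 ∈ N) (hΦ : ContDiffOn ℝ ∞ Φ U)
    (hΦ0 : ∀ w, (w, (0 : PhaseSpace n)) ∈ U → Φ (w, 0) = (κ w, a (κ w)) ∧
        ∀ z, fderiv ℝ Φ (w, 0) (0, z) = (Q (κ w) z, (fderiv ℝ a (κ w)).flip (Q (κ w) z))) :
    ∃ C : ℝ, ∀ᶠ p in 𝓝 ((0, 0) : PhaseSpace n × PhaseSpace n),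
      |((Φ p).2 - a (Φ p).1) (G (Φ p).1 ((Φ p).2 - a (Φ p).1))
        - (dForm a (κ p.1) (Q (κ p.1) p.2)) (G (κ p.1) (dForm a (κ p.1) (Q (κ p.1) p.2)))|
      ≤ C * ‖p.2‖ ^ 3 := by
  let r : PhaseSpace n × PhaseSpace n → E →L[ℝ] ℝ := fun p => (Φ p).2 - a (Φ p).1
  let ρ : PhaseSpace n × PhaseSpace n → E →L[ℝ] ℝ := fun p => -dForm a (κ p.1) (Q (κ p.1) p.2)
  have hΦ1 : ContDiffOn ℝ ∞ (fun p => (Φ p).1) U := contDiff_fst.comp_contDiffOn hΦ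
  have hr : ContDiffOn ℝ ∞ r U := (contDiff_snd.comp_contDiffOn hΦ).sub (ha.comp hΦ1 hUN)
  have hκ1 : ContDiffOn ℝ ∞ (fun p : PhaseSpace n × PhaseSpace n => κ p.1) U :=
    hκ.comp contDiff_fst.contDiffOn hUκ
  have hκ1N : MapsTo (fun p : PhaseSpace n × PhaseSpace n => κ p.1) U N := fun p hp =>
    hκN (κ.map_source (hUκ p hp))
  have hA : ContDiffOn ℝ ∞ (fun p : PhaseSpace n × PhaseSpace n => dForm a (κ p.1)) U :=
    (contDiffOn_dForm hN ha).comp hκ1 hκ1N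
  have hQ1 : ContDiffOn ℝ ∞ (fun p : PhaseSpace n × PhaseSpace n => Q (κ p.1)) U :=
    hQ.comp hκ1 hκ1N
  have hρ : ContDiffOn ℝ ∞ ρ U := (hA.clm_apply (hQ1.clm_apply contDiff_snd.contDiffOn)).neg
  have hG1 : ContDiffOn ℝ ∞ (fun p => G (Φ p).1 - G (κ p.1)) U :=
    (hG.comp hΦ1 hUN).sub (hG.comp hκ1 hκ1N)
  have hr0 : ∀ w, (w, (0 : PhaseSpace n)) ∈ U → r (w, 0) = 0 := fun w hw => by
    simp [r, (hΦ0 w hw).1]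
  have hρ0 : ∀ w, (w, (0 : PhaseSpace n)) ∈ U → ρ (w, 0) = 0 := fun w _ => by
    simp [ρ]
  obtain ⟨C₁, hC₁, e₁⟩ := exists_norm_le_of_vanishing hU hr h0 hr0
  obtain ⟨C₂, hC₂, e₂⟩ := exists_norm_le_of_vanishing hU hρ h0 hρ0
  obtain ⟨C₃, hC₃, e₃⟩ := exists_norm_le_of_vanishing hU hG1 h0
    (fun w hw => by simp [(hΦ0 w hw).1])
  obtain ⟨C₄, hC₄, e₄⟩ := exists_norm_le_sq_of_vanishing hU (hr.sub hρ) h0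
    (fun w hw => by simp [hr0 w hw, hρ0 w hw]) (fun w hw z => by
      have hUw := hU.mem_nhds hw
      have hNw : κ w ∈ N := hκ1N hw
      have hΦd := ((hΦ.contDiffAt hUw).differentiableAt (by simp)).hasFDerivAt
      have had : HasFDerivAt a (fderiv ℝ a (κ w)) (Φ (w, 0)).1 := by
        rw [(hΦ0 w hw).1]
        exact ((ha.contDiffAt (hN.mem_nhds hNw)).differentiableAt (by simp)).hasFDerivAt
      have hrd : HasFDerivAt r _ (w, 0) := hΦd.snd.sub (had.comp (w, 0) hΦd.fst)
      have hρd : HasFDerivAt ρ _ (w, 0) :=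
        ((((hA.contDiffAt hUw).differentiableAt (by simp)).hasFDerivAt).clm_apply
          ((((hQ1.contDiffAt hUw).differentiableAt (by simp)).hasFDerivAt).clm_apply
          hasFDerivAt_snd)).neg
      have hsub : fderiv ℝ (fun p => r p - ρ p) (w, 0) = _ := (hrd.sub hρd).fderiv
      rw [hsub]
      ext Y
      simp [(hΦ0 w hw).2, dForm_apply])
  have hGc : ContinuousAt (fun p : PhaseSpace n × PhaseSpace n => G (κ p.1)) (0, 0) :=
    (hG.comp hκ1 hκ1N).continuousOn.continuousAt (hU.mem_nhds h0)
  have e₅ := hGc.norm.eventually_lt_const (lt_add_one _)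
  set C₅ := ‖G (κ (0 : PhaseSpace n))‖ + 1
  have hC₅ : 0 ≤ C₅ := by positivity
  refine ⟨3 * (C₁ + C₂ + C₃ + C₄ + C₅) ^ 3, ?_⟩
  filter_upwards [e₁, e₂, e₃, e₄, e₅] with p h₁ h₂ h₃ h₄ h₅
  have := abs_sub_quadratic_le (G := G (Φ p).1) (G₀ := G (κ p.1)) (r := r p) (ρ := ρ p)
    (C := C₁ + C₂ + C₃ + C₄ + C₅) (t := ‖p.2‖) (norm_nonneg _) (by positivity)
    (h₁.trans (by gcongr; linarith)) (h₂.trans (by gcongr; linarith))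
    (h₄.trans (by gcongr; linarith)) (h₃.trans (by gcongr; linarith)) (h₅.le.trans (by linarith))
  simp only [ρ, map_neg, neg_apply, neg_neg] at this
  exact this

end Expansion

section LocalNormalForm

variable {n : ℕ} {E : Type*} [NormedAddCommGroup E] [NormedSpace ℝ E] [FiniteDimensional ℝ E]

/-- The theorem in a chart: `g` is a Riemannian metric and `a` a `1`-form on an open set `O` of the
vector space `E`. -/
theorem exists_local_normalForm (hn : Module.finrank ℝ E = 2 * n) {O : Set E} (hO : IsOpen O)
    {x₀ : E} (hx₀ : x₀ ∈ O) {a : E → E →L[ℝ] ℝ} (ha : ContDiffOn ℝ ∞ a O)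
    {g : E → E →L[ℝ] E →L[ℝ] ℝ} (hg : ContDiffOn ℝ ∞ g O)
    (hsymm : ∀ x ∈ O, ∀ X Y, g x X Y = g x Y X) (hpos : ∀ x ∈ O, ∀ X, X ≠ 0 → 0 < g x X X)
    (hinj : Function.Injective ((g x₀).inverse.comp (dForm a x₀)))
    (hs : ((((g x₀).inverse.comp (dForm a x₀) : E →L[ℝ] E) : E →ₗ[ℝ] E).charpoly.map
      (algebraMap ℝ ℂ)).roots.Nodup) :
    ∃ (β : Fin n → E → ℝ) (χ : OpenPartialHomeomorph E (PhaseSpace n))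
      (Φ : OpenPartialHomeomorph (PhaseSpace n × PhaseSpace n) (E × (E →L[ℝ] ℝ))) (ε C : ℝ),
      x₀ ∈ χ.source ∧ χ.source ⊆ O ∧ (∀ q ∈ Φ.target, q.1 ∈ O) ∧ 0 < ε ∧
      ContDiffOn ℝ ∞ χ χ.source ∧ ContDiffOn ℝ ∞ χ.symm χ.target ∧
      ContDiffOn ℝ ∞ Φ Φ.source ∧ ContDiffOn ℝ ∞ Φ.symm Φ.target ∧
      (∀ j, ContDiffOn ℝ ∞ (β j) χ.source) ∧
      (∀ x ∈ χ.source, (∀ j, 0 < β j x) ∧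
        ((((g x).inverse.comp (dForm a x) : E →L[ℝ] E) : E →ₗ[ℝ] E).charpoly.map
          (algebraMap ℝ ℂ)).roots.Nodup ∧
        ((((g x).inverse.comp (dForm a x) : E →L[ℝ] E) : E →ₗ[ℝ] E).charpoly.map
          (algebraMap ℝ ℂ)).roots =
          ∑ j, {(β j x : ℂ) * Complex.I, -((β j x : ℂ) * Complex.I)}) ∧
      (∀ w ∈ χ.target, ∀ X Y,
        dForm a (χ.symm w) (fderiv ℝ χ.symm w X) (fderiv ℝ χ.symm w Y) = stdForm n X Y) ∧
      χ.target ×ˢ Metric.closedBall 0 ε ⊆ Φ.source ∧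
      (∀ p ∈ Φ.source, ∀ X Y, (fderiv ℝ Φ p X).2 (fderiv ℝ Φ p Y).1
        - (fderiv ℝ Φ p Y).2 (fderiv ℝ Φ p X).1 = prodForm n X Y) ∧
      (∀ x ∈ χ.source, Φ (χ x, 0) = (x, a x)) ∧
      ∀ w ∈ χ.target, ∀ z, ‖z‖ ≤ ε →
        |((Φ (w, z)).2 - a (Φ (w, z)).1) ((g (Φ (w, z)).1).inverse ((Φ (w, z)).2 - a (Φ (w, z)).1))
          - ∑ j, β j (χ.symm w) * normSqAt z j| ≤ C * ‖z‖ ^ 3 := by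
  have : CompleteSpace E := FiniteDimensional.complete ℝ E
  have hginv : ∀ x ∈ O, (g x).IsInvertible := fun x hx => by
    refine isInvertible_of_injective finrank_dual_eq.symm ?_
    rw [injective_iff_map_eq_zero]
    intro X hX
    by_contra h
    have := hpos x hx X h
    rw [hX] at this
    exact lt_irrefl _ this
  let G : E → (E →L[ℝ] ℝ) →L[ℝ] E := fun x => (g x).inverse
  let T : E → E →L[ℝ] E := fun x => (G x).comp (dForm a x)
  have hG : ContDiffOn ℝ ∞ G O := fun x hx =>
    ((contDiffAt_inverse_of_isInvertible (hginv x hx)).comp x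
      (hg.contDiffAt (hO.mem_nhds hx))).contDiffWithinAt
  have hT : ContDiffOn ℝ ∞ T O := hG.clm_comp (contDiffOn_dForm hO ha)
  have hgG : ∀ x ∈ O, ∀ p, g x (G x p) = p := fun x hx p =>
    ((hginv x hx).inverse_apply_eq.mp rfl).symm
  have hgT : ∀ x ∈ O, ∀ X Y, g x (T x X) Y = dForm a x X Y := fun x hx X Y => by
    change g x (G x (dForm a x X)) Y = _
    rw [hgG x hx]
  have hskew : ∀ x ∈ O, IsSkew (g x) (T x) := fun x hx => by
    refine ⟨hsymm x hx, hpos x hx, fun X Y => ?_⟩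
    rw [hsymm x hx X, hgT x hx, hgT x hx, dForm_swap]
  obtain ⟨N, β, u, v, hN, hNO, hx₀N, hsm, hframe⟩ :=
    exists_smooth_eigenframe hn hO hx₀ hg hT hskew hinj hs
  have hadapt : ∀ x ∈ N, IsAdaptedFrame (g x) (T x) (fun j => β j x) (fun j => u j x)
      (fun j => v j x) := fun x hx =>
    ⟨hskew x (hNO hx), (hframe x hx).1, (hframe x hx).2.1, (hframe x hx).2.2⟩
  let Q : E → PhaseSpace n →L[ℝ] E := fun x => frameMap (fun j => u j x) (fun j => v j x)
  have hQ : ContDiffOn ℝ ∞ Q N := contDiffOn_frameMap (fun j => (hsm j).2.1) fun j => (hsm j).2.2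
  have hQa : ∀ x ∈ N, ∀ X Y, dForm a x (Q x X) (Q x Y) = -stdForm n X Y := fun x hx X Y => by
    rw [← hgT x (hNO hx)]
    exact (hadapt x hx).form_frameMap X Y
  have haN := ha.mono hNO
  obtain ⟨L₀, hL₀⟩ := isInvertible_of_injective (by rw [hn]; simp; ring)
    (hadapt x₀ hx₀N).injective_frameMap
  have hL₀' : ∀ z, L₀ z = Q x₀ z := fun z => DFunLike.congr_fun hL₀ z
  obtain ⟨κ, hκ0, hκx, hκN, hκs, hκs', hκa⟩ := exists_darboux_chart hN hx₀N haN
    ((swapCLE n).trans L₀) (fun X Y => by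
      change dForm a x₀ (L₀ (swapCLE n X)) (L₀ (swapCLE n Y)) = _
      rw [hL₀', hL₀', hQa x₀ hx₀N, stdForm_swapCLE, neg_neg])
  obtain ⟨Φ, hΦ0, hΦκ, hΦN, hΦs, hΦs', hΦsymp, hΦfix⟩ := exists_symplectic_normalForm hn hN haN hQ
    hQa κ hκ0 hκN hκs hκa
  obtain ⟨C, hC⟩ := exists_hamiltonian_expansion hN haN hQ (hG.mono hNO) κ hκN hκs
    Φ.open_source hΦ0 hΦκ (fun p hp => hΦN _ (Φ.map_source hp)) hΦs hΦfix
  obtain ⟨r, hr, hball⟩ := Metric.eventually_nhds_iff_ball.1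
    (hC.and (Φ.open_source.eventually_mem hΦ0))
  let V : Set (PhaseSpace n) := Metric.ball 0 r
  let χ : OpenPartialHomeomorph E (PhaseSpace n) := (κ.restrOpen V Metric.isOpen_ball).symm
  have hχt : χ.target = κ.source ∩ V := rfl
  have hχs : χ.source ⊆ κ.target := fun x hx => hx.1
  have hχ : ∀ x, χ x = κ.symm x := fun x => rfl
  have hχ' : ∀ x, χ.symm x = κ x := fun x => rfl
  have hχN : χ.source ⊆ N := hχs.trans hκN
  have hin : ∀ w ∈ χ.target, ∀ z : PhaseSpace n, ‖z‖ ≤ r / 2 →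
      (w, z) ∈ Metric.ball ((0, 0) : PhaseSpace n × PhaseSpace n) r := by
    intro w hw z hz
    rw [Metric.mem_ball, Prod.dist_eq]
    refine max_lt hw.2 ?_
    simp only [dist_zero_right]
    linarith
  refine ⟨β, χ, Φ, r / 2, C, ?_, hχN.trans hNO, fun q hq => hNO (hΦN q hq), by positivity,
    hκs'.mono hχs, hκs.mono fun w hw => hw.1, hΦs, hΦs', fun j => (hsm j).1.mono hχN, ?_, ?_, ?_,
    hΦsymp, ?_, ?_⟩
  · have h0 : (0 : PhaseSpace n) ∈ χ.target := ⟨hκ0, Metric.mem_ball_self hr⟩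
    have := χ.map_target h0
    rwa [hχ', hκx] at this
  · intro x hx
    have h1 := hframe x (hχN hx)
    exact ⟨fun j => (h1.2.1 j).1, roots_charpoly_of_rotationPairs hn h1.1 h1.2.1⟩
  · intro w hw X Y
    exact hκa w hw.1 X Y
  · rintro ⟨w, z⟩ ⟨hw, hz⟩
    exact (hball _ (hin w hw z (by simpa using hz))).2
  · intro x hx
    have hw := χ.map_source hx
    have := (hΦfix (χ x) (hball _ (hin _ hw 0 (by simpa using by positivity))).2).1
    rw [this, hχ, κ.right_inv (hχs hx)]
  · intro w hw z hz
    have h1 := (hball _ (hin w hw z hz)).1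
    have hwN : κ w ∈ N := hκN (κ.map_source hw.1)
    have h2 : (dForm a (κ w) (Q (κ w) z)) (G (κ w) (dForm a (κ w) (Q (κ w) z))) =
        ∑ j, β j (κ w) * normSqAt z j := by
      rw [← (hadapt _ hwN).normSq_frameMap z, hgT _ (hNO hwN)]
      rfl
    simp only at h1
    rw [h2] at h1
    exact h1

end LocalNormalForm

section Naturality

variable {E' : Type*} [NormedAddCommGroup E'] [NormedSpace ℝ E']
  {F : Type*} [NormedAddCommGroup F] [NormedSpace ℝ F]
  {G : Type*} [TopologicalSpace G] {J : ModelWithCorners ℝ F G}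
  {N : Type*} [TopologicalSpace N] [ChartedSpace G N]

/-- The pullback of a `1`-form on a manifold by a map defined on a vector space. -/
def pullbackOneForm (α : ∀ q : N, TangentSpace J q →L[ℝ] ℝ) (f : E' → N) (y : E') : E' →L[ℝ] ℝ :=
  (α (f y)).comp (mfderiv 𝓘(ℝ, E') J f y)

theorem oneForm_apply_congr (α : ∀ q : N, TangentSpace J q →L[ℝ] ℝ) {q q' : N} (h : q = q')
    (v : F) : (α q : F →L[ℝ] ℝ) v = (α q' : F →L[ℝ] ℝ) v := by
  subst h
  rfl

variable [IsManifold J ∞ N]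

theorem hasMFDerivAt_of_chart {f : E' → N} {y : E'} {c : N} (hc : f y ∈ (chartAt G c).source)
    (hf : MDifferentiableAt 𝓘(ℝ, E') J f y) :
    HasMFDerivAt 𝓘(ℝ, E') J f y
      ((mfderivWithin 𝓘(ℝ, F) J (extChartAt J c).symm (range J) (extChartAt J c (f y))).comp
        (fderiv ℝ (fun y => extChartAt J c (f y)) y)) := by
  have : IsManifold J 1 N := IsManifold.of_le (n := ∞) (by simp)
  have hsrc : f y ∈ (extChartAt J c).source := by rwa [extChartAt_source]
  have hF : MDifferentiableAt 𝓘(ℝ, E') 𝓘(ℝ, F) (fun y => extChartAt J c (f y)) y :=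
    (mdifferentiableAt_extChartAt hc).comp y hf
  have hF' : HasMFDerivAt 𝓘(ℝ, E') 𝓘(ℝ, F) (fun y => extChartAt J c (f y)) y
      (fderiv ℝ (fun y => extChartAt J c (f y)) y) :=
    (mdifferentiableAt_iff_differentiableAt.mp hF).hasFDerivAt.hasMFDerivAt
  have hK := (mdifferentiableWithinAt_extChartAt_symm
    ((extChartAt J c).map_source hsrc)).hasMFDerivWithinAt
  have hev : ∀ᶠ t in 𝓝 y, f t ∈ (extChartAt J c).source :=
    hf.continuousAt.preimage_mem_nhds (extChartAt_source_mem_nhds' hsrc)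
  have h1 := (hK.comp y hF'.hasMFDerivWithinAt (s := univ) (fun t _ => mem_range_self _))
  rw [hasMFDerivWithinAt_univ] at h1
  refine h1.congr_of_eventuallyEq ?_
  filter_upwards [hev] with t ht
  exact ((extChartAt J c).left_inv ht).symm

theorem pullbackOneForm_eq_of_chart (α : ∀ q : N, TangentSpace J q →L[ℝ] ℝ) {f : E' → N} {y : E'}
    {c : N} (hc : f y ∈ (chartAt G c).source) (hf : MDifferentiableAt 𝓘(ℝ, E') J f y) :
    pullbackOneForm α f y = (oneFormInChart J α c (extChartAt J c (f y))).comp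
      (fderiv ℝ (fun y => extChartAt J c (f y)) y) := by
  have hsrc : f y ∈ (extChartAt J c).source := by rwa [extChartAt_source]
  ext X
  rw [pullbackOneForm, (hasMFDerivAt_of_chart hc hf).mfderiv]
  exact oneForm_apply_congr α ((extChartAt J c).left_inv hsrc).symm _

/-- The exterior derivative on a manifold commutes with pullback to a vector space. -/
theorem extDerivOneForm_pullback (α : ∀ q : N, TangentSpace J q →L[ℝ] ℝ) {f : E' → N} {x : E'}
    (hf : ContMDiffAt 𝓘(ℝ, E') J ∞ f x)
    (hα : DifferentiableWithinAt ℝ (oneFormInChart J α (f x)) (range J)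
      (extChartAt J (f x) (f x))) (X Y : E') :
    extDerivOneForm J α (f x) (mfderiv 𝓘(ℝ, E') J f x X) (mfderiv 𝓘(ℝ, E') J f x Y) =
      dForm (pullbackOneForm α f) x X Y := by
  have : IsManifold J 1 N := IsManifold.of_le (n := ∞) (by simp)
  have : IsManifold J 2 N := IsManifold.of_le (n := ∞) (by exact two_le_infty)
  set F₀ : E' → F := fun y => extChartAt J (f x) (f y)
  have hF₀s : ContDiffAt ℝ ∞ F₀ x := by
    rw [← contMDiffAt_iff_contDiffAt]
    exact (contMDiffAt_extChartAt (n := ∞)).comp x hf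
  have hfev : ∀ᶠ y in 𝓝 x, MDifferentiableAt 𝓘(ℝ, E') J f y := by
    have h2 : ContMDiffAt 𝓘(ℝ, E') J 2 f x := hf.of_le (by exact two_le_infty)
    filter_upwards [(contMDiffAt_iff_contMDiffAt_nhds (by simp)).mp h2] with y hy
    exact hy.mdifferentiableAt (by simp)
  have hsev : ∀ᶠ y in 𝓝 x, f y ∈ (chartAt G (f x)).source :=
    hf.continuousAt.preimage_mem_nhds (chart_source_mem_nhds G (f x))
  have hpull : pullbackOneForm α f =ᶠ[𝓝 x]
      fun y => (oneFormInChart J α (f x) (F₀ y)).comp (fderiv ℝ F₀ y) := by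
    filter_upwards [hfev, hsev] with y hy hy'
    exact pullbackOneForm_eq_of_chart α hy' hy
  have hfd := (hF₀s.differentiableAt (by simp)).hasFDerivAt
  have hf2 : DifferentiableAt ℝ (fderiv ℝ F₀) x :=
    (hF₀s.fderiv_right (m := 1) (by exact two_le_infty)).differentiableAt (by simp)
  have hs := hF₀s.isSymmSndFDerivAt (by simpa using two_le_infty)
  have h1 : HasFDerivAt (fun y => oneFormInChart J α (f x) (F₀ y))
      ((fderivWithin ℝ (oneFormInChart J α (f x)) (range J) (F₀ x)).comp (fderiv ℝ F₀ x)) x := by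
    have := HasFDerivWithinAt.comp x (t := range J) hα.hasFDerivWithinAt
      hfd.hasFDerivWithinAt (s := univ) (fun t _ => mem_range_self _)
    rwa [hasFDerivWithinAt_univ] at this
  have h2 := h1.clm_comp hf2.hasFDerivAt
  have h3 : ∀ Z : E', mfderiv J 𝓘(ℝ, F) (extChartAt J (f x)) (f x) (mfderiv 𝓘(ℝ, E') J f x Z) =
      fderiv ℝ F₀ x Z := by
    intro Z
    have hd := (mdifferentiableAt_extChartAt (I := J) (mem_chart_source G (f x)))
    have := mfderiv_comp_apply (x := x) hd (hf.mdifferentiableAt (by simp)) Z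
    rw [← this]
    rw [← mfderiv_eq_fderiv]
    rfl
  rw [extDerivOneForm_apply, h3, h3, dForm_apply, hpull.fderiv_eq, h2.fderiv]
  change fderivWithin ℝ (oneFormInChart J α (f x)) (range J) (F₀ x) _ _ -
    fderivWithin ℝ (oneFormInChart J α (f x)) (range J) (F₀ x) _ _ = _
  clear_value F₀
  simp [hs X Y]

end Naturality

section InteriorChart

variable {F : Type*} [NormedAddCommGroup F] [NormedSpace ℝ F]
  {G : Type*} [TopologicalSpace G] (J : ModelWithCorners ℝ F G)
  {N : Type*} [TopologicalSpace N] [ChartedSpace G N]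

/-- The preferred chart at `c`, restricted to the preimage of the interior of its target. -/
def interiorChart (c : N) : OpenPartialHomeomorph N F where
  toFun := extChartAt J c
  invFun := (extChartAt J c).symm
  source := (extChartAt J c).source ∩ extChartAt J c ⁻¹' interior (extChartAt J c).target
  target := interior (extChartAt J c).target
  map_source' _ hq := hq.2
  map_target' x hx := ⟨(extChartAt J c).map_target (interior_subset hx), by
    rw [mem_preimage, (extChartAt J c).right_inv (interior_subset hx)]; exact hx⟩
  left_inv' _ hq := (extChartAt J c).left_inv hq.1
  right_inv' _ hx := (extChartAt J c).right_inv (interior_subset hx)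
  open_source := isOpen_extChartAt_preimage' c isOpen_interior
  open_target := isOpen_interior
  continuousOn_toFun := (continuousOn_extChartAt c).mono inter_subset_left
  continuousOn_invFun := (continuousOn_extChartAt_symm c).mono interior_subset

theorem interiorChart_target (c : N) :
    (interiorChart J c).target = interior (extChartAt J c).target := rfl

theorem interiorChart_source_subset (c : N) :
    (interiorChart J c).source ⊆ (chartAt G c).source := fun _ hq => by
  rw [← extChartAt_source J]
  exact hq.1

theorem mfderivWithin_extChartAt_symm_eq {c : N} {x : F}
    (hx : x ∈ (interiorChart J c).target) :
    mfderivWithin 𝓘(ℝ, F) J (extChartAt J c).symm (range J) x =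
      mfderiv 𝓘(ℝ, F) J (extChartAt J c).symm x :=
  mfderivWithin_of_mem_nhds (mem_of_superset (isOpen_interior.mem_nhds hx)
    (interior_subset.trans (extChartAt_target_subset_range c)))

theorem pullbackOneForm_extChartAt_symm (α : ∀ q : N, TangentSpace J q →L[ℝ] ℝ) {c : N} {x : F}
    (hx : x ∈ (interiorChart J c).target) :
    pullbackOneForm α (extChartAt J c).symm x = oneFormInChart J α c x := by
  rw [pullbackOneForm, oneFormInChart, mfderivWithin_extChartAt_symm_eq J hx]

variable [IsManifold J ∞ N]

theorem contMDiffOn_interiorChart (c : N) :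
    ContMDiffOn J 𝓘(ℝ, F) ∞ (interiorChart J c) (interiorChart J c).source :=
  contMDiffOn_extChartAt.mono (interiorChart_source_subset J c)

theorem contMDiffOn_interiorChart_symm (c : N) :
    ContMDiffOn 𝓘(ℝ, F) J ∞ (interiorChart J c).symm (interiorChart J c).target :=
  (contMDiffOn_extChartAt_symm c).mono interior_subset

/-- In an interior chart, the exterior derivative is the exterior derivative of the coordinate
expression. -/
theorem extDerivOneForm_chart (α : ∀ q : N, TangentSpace J q →L[ℝ] ℝ) {c : N} {x : F}
    (hx : x ∈ (interiorChart J c).target)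
    (hα : DifferentiableWithinAt ℝ (oneFormInChart J α ((extChartAt J c).symm x)) (range J)
      (extChartAt J ((extChartAt J c).symm x) ((extChartAt J c).symm x))) (X Y : F) :
    extDerivOneForm J α ((extChartAt J c).symm x)
        (mfderiv 𝓘(ℝ, F) J (extChartAt J c).symm x X)
        (mfderiv 𝓘(ℝ, F) J (extChartAt J c).symm x Y) =
      dForm (oneFormInChart J α c) x X Y := by
  have hsm := (contMDiffOn_interiorChart_symm J c).contMDiffAt
    ((interiorChart J c).open_target.mem_nhds hx)
  have hev : pullbackOneForm α (extChartAt J c).symm =ᶠ[𝓝 x] oneFormInChart J α c := by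
    filter_upwards [(interiorChart J c).open_target.mem_nhds hx] with y hy
    exact pullbackOneForm_extChartAt_symm J α hy
  have h := extDerivOneForm_pullback α hsm hα X Y
  rw [dForm, ← hev.fderiv_eq]
  exact h

end InteriorChart

section Cotangent

variable {E : Type*} [NormedAddCommGroup E] [NormedSpace ℝ E]
  {H : Type*} [TopologicalSpace H] {I : ModelWithCorners ℝ E H}
  {M : Type*} [TopologicalSpace M] [ChartedSpace H M] [IsManifold I ∞ M]

/-- The standard trivialization of `T*M` is the composition with the derivative of the inverse
chart. -/
theorem cotangent_trivializationAt_apply {c : M} (ζ : CotangentBundle I M)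
    (hζ : ζ.1 ∈ (chartAt H c).source) :
    (trivializationAt (E →L[ℝ] ℝ) (fun q : M => TangentSpace I q →L[ℝ] Trivial M ℝ q) c ζ).2 =
      (ζ.2 : TangentSpace I ζ.1 →L[ℝ] ℝ).comp
        (mfderivWithin 𝓘(ℝ, E) I (extChartAt I c).symm (range I) (extChartAt I c ζ.1)) := by
  have : IsManifold I 1 M := IsManifold.of_le (n := ∞) (by simp)
  rw [← TangentBundle.symmL_trivializationAt hζ]
  ext X
  change (Trivial.trivialization M ℝ).continuousLinearMapAt ℝ ζ.1 _ = _
  rw [Trivial.continuousLinearMapAt_trivialization]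
  rfl

theorem cotangent_baseSet (c : M) :
    (trivializationAt (E →L[ℝ] ℝ) (fun q : M => TangentSpace I q →L[ℝ] Trivial M ℝ q) c).baseSet =
      (chartAt H c).source := by
  rw [hom_trivializationAt_baseSet]
  simp

theorem oneFormInChart_eq_trivializationAt (A : ∀ q : M, TangentSpace I q →L[ℝ] Trivial M ℝ q)
    {c : M} {x : E} (hx : x ∈ (extChartAt I c).target) :
    oneFormInChart I A c x = (trivializationAt (E →L[ℝ] ℝ)
      (fun q : M => TangentSpace I q →L[ℝ] Trivial M ℝ q) c
        ⟨(extChartAt I c).symm x, A ((extChartAt I c).symm x)⟩).2 := by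
  have hs : (extChartAt I c).symm x ∈ (chartAt H c).source := by
    rw [← extChartAt_source I]
    exact (extChartAt I c).map_target hx
  rw [cotangent_trivializationAt_apply _ hs]
  change _ = ContinuousLinearMap.comp _ (mfderivWithin 𝓘(ℝ, E) I (extChartAt I c).symm (range I)
    (extChartAt I c ((extChartAt I c).symm x)))
  rw [(extChartAt I c).right_inv hx]
  rfl

theorem contDiffOn_oneFormInChart [FiniteDimensional ℝ E] (A : OneForm I M) (c : M) :
    ContDiffOn ℝ ∞ (oneFormInChart I (fun q => A q) c) (extChartAt I c).target := by
  have h1 := (Trivialization.contMDiffOn_section_iff (IB := I) (n := ∞) (s := fun q => A q)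
    (trivializationAt (E →L[ℝ] ℝ) (fun q : M => TangentSpace I q →L[ℝ] Trivial M ℝ q) c)
    (Trivialization.open_baseSet _) le_rfl).mp A.contMDiff.contMDiffOn
  rw [cotangent_baseSet] at h1
  rw [← contMDiffOn_iff_contDiffOn]
  refine (h1.comp (contMDiffOn_extChartAt_symm c) fun x hx => ?_).congr fun x hx =>
    oneFormInChart_eq_trivializationAt A hx
  rw [mem_preimage, ← extChartAt_source I]
  exact (extChartAt I c).map_target hx

theorem cotangent_extChartAt_target (ζ : CotangentBundle I M) :
    (extChartAt (I.prod 𝓘(ℝ, E →L[ℝ] ℝ)) ζ).target = (extChartAt I ζ.1).target ×ˢ univ := by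
  rw [FiberBundle.extChartAt_target, cotangent_baseSet]
  congr 1
  refine inter_eq_left.mpr fun x hx => ?_
  rw [mem_preimage, ← extChartAt_source I]
  exact (extChartAt I ζ.1).map_target hx

theorem cotangent_extChartAt_symm_proj (ζ : CotangentBundle I M) {y : E × (E →L[ℝ] ℝ)}
    (hy : y.1 ∈ (extChartAt I ζ.1).target) :
    ((extChartAt (I.prod 𝓘(ℝ, E →L[ℝ] ℝ)) ζ).symm y).1 = (extChartAt I ζ.1).symm y.1 := by
  rw [FiberBundle.extChartAt]
  refine Trivialization.proj_symm_apply' (trivializationAt (E →L[ℝ] ℝ)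
    (fun q : M => TangentSpace I q →L[ℝ] Trivial M ℝ q) ζ.1) ?_
  rw [cotangent_baseSet, ← extChartAt_source I]
  exact (extChartAt I ζ.1).map_target hy

/-- In the canonical coordinates, the momentum is the pullback of the covector by the inverse
chart. -/
theorem cotangent_extChartAt_symm_snd (ζ : CotangentBundle I M) {y : E × (E →L[ℝ] ℝ)}
    (hy : y.1 ∈ (extChartAt I ζ.1).target) (X : E) :
    (((extChartAt (I.prod 𝓘(ℝ, E →L[ℝ] ℝ)) ζ).symm y).2 : E →L[ℝ] ℝ)
      (mfderivWithin 𝓘(ℝ, E) I (extChartAt I ζ.1).symm (range I) y.1 X : E) = y.2 X := by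
  have hproj := cotangent_extChartAt_symm_proj ζ hy
  have hs : (extChartAt I ζ.1).symm y.1 ∈ (chartAt H ζ.1).source := by
    rw [← extChartAt_source I]
    exact (extChartAt I ζ.1).map_target hy
  have h := cotangent_trivializationAt_apply (c := ζ.1)
    ((extChartAt (I.prod 𝓘(ℝ, E →L[ℝ] ℝ)) ζ).symm y) (by rw [hproj]; exact hs)
  have hr := (extChartAt (I.prod 𝓘(ℝ, E →L[ℝ] ℝ)) ζ).right_inv (x := y)
    (by rw [cotangent_extChartAt_target]; exact ⟨hy, mem_univ _⟩)
  rw [FiberBundle.extChartAt] at hr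
  have hr2 : (trivializationAt (E →L[ℝ] ℝ) (fun q : M => TangentSpace I q →L[ℝ] Trivial M ℝ q) ζ.1
      ((extChartAt (I.prod 𝓘(ℝ, E →L[ℝ] ℝ)) ζ).symm y)).2 = y.2 := by
    rw [FiberBundle.extChartAt]
    exact congrArg Prod.snd hr
  rw [hr2] at h
  rw [h]
  have e1 : extChartAt I ζ.1 ((extChartAt (I.prod 𝓘(ℝ, E →L[ℝ] ℝ)) ζ).symm y).1 = y.1 := by
    rw [hproj, (extChartAt I ζ.1).right_inv hy]
  rw [e1]
  rfl

/-- In the canonical coordinates, the Liouville form is `p dx`. -/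
theorem oneFormInChart_liouvilleForm (ζ : CotangentBundle I M) {y : E × (E →L[ℝ] ℝ)}
    (hy : y.1 ∈ (extChartAt I ζ.1).target) :
    oneFormInChart (I.prod 𝓘(ℝ, E →L[ℝ] ℝ)) (liouvilleForm I M) ζ y = liouvilleCLM E y := by
  have : IsManifold I 1 M := IsManifold.of_le (n := ∞) (by simp)
  have : IsManifold (I.prod 𝓘(ℝ, E →L[ℝ] ℝ)) 1 (CotangentBundle I M) :=
    IsManifold.of_le (n := ∞) (by simp)
  have hyt : y ∈ (extChartAt (I.prod 𝓘(ℝ, E →L[ℝ] ℝ)) ζ).target := by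
    rw [cotangent_extChartAt_target]
    exact ⟨hy, mem_univ _⟩
  have hK := (mdifferentiableWithinAt_extChartAt_symm hyt).hasMFDerivWithinAt
  have hπ : MDifferentiableAt (I.prod 𝓘(ℝ, E →L[ℝ] ℝ)) I (fun ζ : CotangentBundle I M => ζ.1)
      ((extChartAt (I.prod 𝓘(ℝ, E →L[ℝ] ℝ)) ζ).symm y) :=
    ((contMDiff_proj (n := 1) (fun q : M => TangentSpace I q →L[ℝ] Trivial M ℝ q)).contMDiffAt
      ).mdifferentiableAt (by simp)
  have h1 := hπ.hasMFDerivAt.comp_hasMFDerivWithinAt y hK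
  have hfst : HasMFDerivWithinAt 𝓘(ℝ, E × (E →L[ℝ] ℝ)) 𝓘(ℝ, E)
      (fun y : E × (E →L[ℝ] ℝ) => y.1) (range (I.prod 𝓘(ℝ, E →L[ℝ] ℝ))) y
      (ContinuousLinearMap.fst ℝ E (E →L[ℝ] ℝ)) :=
    (hasFDerivAt_fst (𝕜 := ℝ) (p := y)).hasMFDerivAt.hasMFDerivWithinAt
  have h2 := (mdifferentiableWithinAt_extChartAt_symm hy).hasMFDerivWithinAt.comp y hfst (by
    rintro _ ⟨t, rfl⟩
    exact mem_range_self t.1)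
  have hev : ((fun ζ : CotangentBundle I M => ζ.1) ∘
      (extChartAt (I.prod 𝓘(ℝ, E →L[ℝ] ℝ)) ζ).symm) =ᶠ[𝓝[range (I.prod 𝓘(ℝ, E →L[ℝ] ℝ))] y]
      ((extChartAt I ζ.1).symm ∘ fun y : E × (E →L[ℝ] ℝ) => y.1) := by
    filter_upwards [extChartAt_target_mem_nhdsWithin_of_mem hyt] with t ht
    rw [cotangent_extChartAt_target] at ht
    exact cotangent_extChartAt_symm_proj ζ ht.1
  have h3 := h2.congr_of_eventuallyEq hev (cotangent_extChartAt_symm_proj ζ hy)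
  have hu := (I.prod 𝓘(ℝ, E →L[ℝ] ℝ)).uniqueMDiffOn y (extChartAt_target_subset_range ζ hyt)
  have heq := hu.eq h1 h3
  refine ContinuousLinearMap.ext fun X => ?_
  rw [liouvilleCLM_apply]
  refine Eq.trans ?_ (cotangent_extChartAt_symm_snd ζ hy X.1)
  exact congrArg (fun v : E => (((extChartAt (I.prod 𝓘(ℝ, E →L[ℝ] ℝ)) ζ).symm y).2 : E →L[ℝ] ℝ) v)
    (congrArg (fun L : E × (E →L[ℝ] ℝ) →L[ℝ] E => L X) heq)

theorem differentiableWithinAt_of_contDiffOn_chart {F G N : Type*} [NormedAddCommGroup F]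
    [NormedSpace ℝ F] [TopologicalSpace G] {J : ModelWithCorners ℝ F G} [TopologicalSpace N]
    [ChartedSpace G N] {θ : F → F →L[ℝ] ℝ} {q : N}
    (h : ContDiffOn ℝ ∞ θ (extChartAt J q).target) :
    DifferentiableWithinAt ℝ θ (range J) (extChartAt J q q) :=
  ((h _ (mem_extChartAt_target q)).differentiableWithinAt (by simp)).mono_of_mem_nhdsWithin
    (extChartAt_target_mem_nhdsWithin q)

/-- In an interior chart, the magnetic form is the exterior derivative of the coordinate
expression of the potential. -/
theorem magneticForm_chart [FiniteDimensional ℝ E] (A : OneForm I M) {c : M} {x : E}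
    (hx : x ∈ (interiorChart I c).target) (X Y : E) :
    magneticForm A ((extChartAt I c).symm x) (mfderiv 𝓘(ℝ, E) I (extChartAt I c).symm x X)
        (mfderiv 𝓘(ℝ, E) I (extChartAt I c).symm x Y) =
      dForm (oneFormInChart I (fun q => A q) c) x X Y :=
  extDerivOneForm_chart I (fun q => A q) hx
    (differentiableWithinAt_of_contDiffOn_chart (contDiffOn_oneFormInChart A _)) X Y

theorem contDiffOn_oneFormInChart_liouvilleForm (ζ : CotangentBundle I M) :
    ContDiffOn ℝ ∞ (oneFormInChart (I.prod 𝓘(ℝ, E →L[ℝ] ℝ)) (liouvilleForm I M) ζ)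
      (extChartAt (I.prod 𝓘(ℝ, E →L[ℝ] ℝ)) ζ).target := by
  refine (liouvilleCLM E).contDiff.contDiffOn.congr fun y hy => ?_
  rw [cotangent_extChartAt_target] at hy
  exact oneFormInChart_liouvilleForm ζ hy.1

/-- Canonical coordinates on the cotangent bundle are symplectic. -/
theorem canonicalForm_chart (ζ : CotangentBundle I M) {y : E × (E →L[ℝ] ℝ)}
    (hy : y ∈ (interiorChart (I.prod 𝓘(ℝ, E →L[ℝ] ℝ)) ζ).target) (X Y : E × (E →L[ℝ] ℝ)) :
    canonicalForm I M ((extChartAt (I.prod 𝓘(ℝ, E →L[ℝ] ℝ)) ζ).symm y)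
        (mfderiv 𝓘(ℝ, E × (E →L[ℝ] ℝ)) (I.prod 𝓘(ℝ, E →L[ℝ] ℝ))
          (extChartAt (I.prod 𝓘(ℝ, E →L[ℝ] ℝ)) ζ).symm y X)
        (mfderiv 𝓘(ℝ, E × (E →L[ℝ] ℝ)) (I.prod 𝓘(ℝ, E →L[ℝ] ℝ))
          (extChartAt (I.prod 𝓘(ℝ, E →L[ℝ] ℝ)) ζ).symm y Y) = X.2 Y.1 - Y.2 X.1 := by
  have hev : oneFormInChart (I.prod 𝓘(ℝ, E →L[ℝ] ℝ)) (liouvilleForm I M) ζ =ᶠ[𝓝 y]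
      fun y => liouvilleCLM E y := by
    filter_upwards [(interiorChart (I.prod 𝓘(ℝ, E →L[ℝ] ℝ)) ζ).open_target.mem_nhds hy] with t ht
    have ht' := interior_subset ht
    rw [cotangent_extChartAt_target] at ht'
    exact oneFormInChart_liouvilleForm ζ ht'.1
  rw [← dForm_liouvilleCLM, dForm, ← hev.fderiv_eq]
  exact extDerivOneForm_chart (I.prod 𝓘(ℝ, E →L[ℝ] ℝ)) (liouvilleForm I M) hy
    (differentiableWithinAt_of_contDiffOn_chart (contDiffOn_oneFormInChart_liouvilleForm _)) X Y

end Cotangent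

section LinearAlgebra

variable {E : Type*} [NormedAddCommGroup E] [NormedSpace ℝ E]

/-- Raising indices is compatible with linear changes of variables. -/
theorem apply_inverse_pullback {γ γ' : E →L[ℝ] E →L[ℝ] ℝ} {T : E →L[ℝ] E}
    (hγ : γ.IsInvertible) (hγ' : γ'.IsInvertible) (hT : Function.Surjective T)
    (h : ∀ X Y, γ' X Y = γ (T X) (T Y)) {ℓ ℓ' : E →L[ℝ] ℝ} (hℓ : ∀ X, ℓ' X = ℓ (T X)) :
    T (γ'.inverse ℓ') = γ.inverse ℓ := by
  symm
  rw [hγ.inverse_apply_eq]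
  ext Y
  obtain ⟨X, rfl⟩ := hT Y
  rw [← h, hγ'.self_apply_inverse, hℓ]

theorem charpoly_eq_of_intertwining [FiniteDimensional ℝ E] {S S' T : E →L[ℝ] E}
    (hT : T.IsInvertible) (h : ∀ X, T (S' X) = S (T X)) :
    (S : E →ₗ[ℝ] E).charpoly = (S' : E →ₗ[ℝ] E).charpoly := by
  obtain ⟨e, rfl⟩ := hT
  rw [← e.toLinearEquiv.charpoly_conj (S' : E →ₗ[ℝ] E)]
  congr 1
  ext X
  have := h (e.symm X)
  simp only [ContinuousLinearEquiv.coe_coe, ContinuousLinearEquiv.apply_symm_apply] at this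
  exact this.symm

theorem isInvertible_of_pos [FiniteDimensional ℝ E] {γ : E →L[ℝ] E →L[ℝ] ℝ}
    (h : ∀ X, X ≠ 0 → 0 < γ X X) : γ.IsInvertible := by
  refine isInvertible_of_injective finrank_dual_eq.symm ?_
  rw [injective_iff_map_eq_zero]
  intro X hX
  by_contra h0
  have := h X h0
  rw [hX] at this
  simp at this

end LinearAlgebra

section Metric

variable {E : Type*} [NormedAddCommGroup E] [NormedSpace ℝ E]
  {H : Type*} [TopologicalSpace H] {I : ModelWithCorners ℝ E H}
  {M : Type*} [TopologicalSpace M] [ChartedSpace H M] [IsManifold I ∞ M]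

/-- The derivative of the inverse of the preferred chart at `c`. -/
def chartDeriv (I : ModelWithCorners ℝ E H) (c : M) (x : E) : E →L[ℝ] E :=
  mfderiv 𝓘(ℝ, E) I (extChartAt I c).symm x

/-- The coordinate expression of the metric in the preferred chart at `c`. -/
def metricInChart (g : RiemannianMetric I M) (c : M) (x : E) : E →L[ℝ] E →L[ℝ] ℝ :=
  (ContinuousLinearMap.precomp ℝ (chartDeriv I c x)).comp
    ((g.inner ((extChartAt I c).symm x) : E →L[ℝ] E →L[ℝ] ℝ).comp (chartDeriv I c x))

theorem metricInChart_apply (g : RiemannianMetric I M) (c : M) (x X Y : E) :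
    metricInChart g c x X Y = (g.inner ((extChartAt I c).symm x) : E →L[ℝ] E →L[ℝ] ℝ)
      (chartDeriv I c x X) (chartDeriv I c x Y) := rfl

variable {c : M} {x : E}

theorem isInvertible_chartDeriv (hx : x ∈ (interiorChart I c).target) :
    (chartDeriv I c x).IsInvertible := by
  have : IsManifold I 1 M := IsManifold.of_le (n := ∞) (by simp)
  have h := isInvertible_mfderivWithin_extChartAt_symm (I := I) (interior_subset hx)
  rw [mfderivWithin_extChartAt_symm_eq I hx] at h
  exact h

theorem metricInChart_symm (g : RiemannianMetric I M) (c : M) (x X Y : E) :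
    metricInChart g c x X Y = metricInChart g c x Y X :=
  g.symm ((extChartAt I c).symm x) (chartDeriv I c x X) (chartDeriv I c x Y)

theorem metricInChart_pos (g : RiemannianMetric I M) (hx : x ∈ (interiorChart I c).target) {X : E}
    (hX : X ≠ 0) : 0 < metricInChart g c x X X :=
  g.pos ((extChartAt I c).symm x) (chartDeriv I c x X) fun h =>
    hX ((isInvertible_chartDeriv hx).injective (h.trans (map_zero _).symm))

/-- Coordinate vector fields are smooth. -/
theorem contMDiffOn_chartDeriv (c : M) (X : E) :
    ContMDiffOn 𝓘(ℝ, E) (I.prod 𝓘(ℝ, E)) ∞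
      (fun x => TotalSpace.mk' E (E := fun q : M => TangentSpace I q) ((extChartAt I c).symm x)
        (mfderiv 𝓘(ℝ, E) I (extChartAt I c).symm x X)) (interiorChart I c).target := by
  have : IsManifold I 1 M := IsManifold.of_le (n := ∞) (by simp)
  have hmem : ∀ x ∈ (interiorChart I c).target, (extChartAt I c).symm x ∈ (chartAt H c).source :=
    fun x hx => by
      rw [← extChartAt_source I]
      exact (extChartAt I c).map_target (interior_subset hx)
  rw [Trivialization.contMDiffOn_iff (e := trivializationAt E (fun q : M => TangentSpace I q) c)
    (fun x hx => by
      rw [Trivialization.mem_source]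
      exact hmem x hx)]
  refine ⟨contMDiffOn_interiorChart_symm I c, (contMDiffOn_const (c := X)).congr fun x hx => ?_⟩
  have h1 := TangentBundle.continuousLinearMapAt_trivializationAt (I := I) (hmem x hx)
  have h2 := mfderiv_extChartAt_comp_mfderivWithin_extChartAt_symm (I := I) (interior_subset hx)
  rw [mfderivWithin_extChartAt_symm_eq I hx, ← h1] at h2
  have h3 := congrArg (fun L : E →L[ℝ] E => L X) h2
  refine Eq.trans ?_ h3
  exact (Trivialization.continuousLinearMapAt_apply_of_mem ℝ _ (hmem x hx) _).symm

theorem cotangent_extChartAt_symm_oneForm (A : OneForm I M) (ζ : CotangentBundle I M)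
    (hx : x ∈ (interiorChart I ζ.1).target) :
    (extChartAt (I.prod 𝓘(ℝ, E →L[ℝ] ℝ)) ζ).symm (x, oneFormInChart I (fun q => A q) ζ.1 x) =
      ⟨(extChartAt I ζ.1).symm x, A ((extChartAt I ζ.1).symm x)⟩ := by
  have hx' := interior_subset hx
  have hproj := cotangent_extChartAt_symm_proj ζ
    (y := (x, oneFormInChart I (fun q => A q) ζ.1 x)) hx'
  have hsnd := cotangent_extChartAt_symm_snd ζ
    (y := (x, oneFormInChart I (fun q => A q) ζ.1 x)) hx'
  generalize (extChartAt (I.prod 𝓘(ℝ, E →L[ℝ] ℝ)) ζ).symm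
    (x, oneFormInChart I (fun q => A q) ζ.1 x) = ξ at hproj hsnd
  obtain ⟨q, p⟩ := ξ
  change q = _ at hproj
  subst hproj
  rw [mfderivWithin_extChartAt_symm_eq I hx] at hsnd
  congr 1
  ext Y
  obtain ⟨X, rfl⟩ := (isInvertible_chartDeriv hx).surjective Y
  refine (hsnd X).trans ?_
  rw [← pullbackOneForm_extChartAt_symm I (fun q => A q) hx]
  rfl

variable [FiniteDimensional ℝ E]

theorem isInvertible_metricInChart (g : RiemannianMetric I M)
    (hx : x ∈ (interiorChart I c).target) : (metricInChart g c x).IsInvertible :=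
  isInvertible_of_pos fun _ hX => metricInChart_pos g hx hX

theorem contDiffOn_metricInChart (g : RiemannianMetric I M) (c : M) :
    ContDiffOn ℝ ∞ (metricInChart g c) (interiorChart I c).target := by
  rw [contDiffOn_clm_apply]
  intro X
  rw [contDiffOn_clm_apply]
  intro Y
  rw [← contMDiffOn_iff_contDiffOn]
  intro x hx
  have : ContMDiffWithinAt 𝓘(ℝ, E) (I.prod 𝓘(ℝ)) ∞
      (fun x => TotalSpace.mk' ℝ (E := Bundle.Trivial M ℝ) ((extChartAt I c).symm x)
        (g.inner ((extChartAt I c).symm x) (mfderiv 𝓘(ℝ, E) I (extChartAt I c).symm x X)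
          (mfderiv 𝓘(ℝ, E) I (extChartAt I c).symm x Y))) (interiorChart I c).target x := by
    apply ContMDiffWithinAt.clm_bundle_apply₂ (F₁ := E) (F₂ := E)
    · exact ContMDiffAt.comp_contMDiffWithinAt x g.contMDiff.contMDiffAt
        (contMDiffOn_interiorChart_symm I c x hx)
    · exact contMDiffOn_chartDeriv c X x hx
    · exact contMDiffOn_chartDeriv c Y x hx
  simp only [contMDiffWithinAt_totalSpace] at this
  exact this.2

variable (g : RiemannianMetric I M) (A : OneForm I M)

theorem chartDeriv_inverse_metricInChart (hx : x ∈ (interiorChart I c).target)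
    {ℓ ℓ' : E →L[ℝ] ℝ} (hℓ : ∀ X, ℓ' X = ℓ (chartDeriv I c x X)) :
    chartDeriv I c x ((metricInChart g c x).inverse ℓ') =
      (sharp g ((extChartAt I c).symm x) : (E →L[ℝ] ℝ) →L[ℝ] E) ℓ :=
  apply_inverse_pullback (E := E) (γ := g.inner ((extChartAt I c).symm x))
    (isInvertible_inner g ((extChartAt I c).symm x))
    (isInvertible_metricInChart g hx) (isInvertible_chartDeriv hx).surjective
    (metricInChart_apply g c x) hℓ

/-- The coordinate expression of the magnetic operator. -/
def operatorInChart (c : M) (x : E) : E →L[ℝ] E :=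
  (metricInChart g c x).inverse.comp (dForm (oneFormInChart I (fun q => A q) c) x)

theorem chartDeriv_operatorInChart (hx : x ∈ (interiorChart I c).target) (X : E) :
    chartDeriv I c x (operatorInChart g A c x X) =
      (magneticOperator g A ((extChartAt I c).symm x) : E →L[ℝ] E) (chartDeriv I c x X) :=
  chartDeriv_inverse_metricInChart g hx
    (ℓ := (magneticForm A ((extChartAt I c).symm x) : E →L[ℝ] E →L[ℝ] ℝ) (chartDeriv I c x X))
    fun Y => (magneticForm_chart A hx X Y).symm

theorem magneticEigenvalues_chart (hx : x ∈ (interiorChart I c).target) :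
    magneticEigenvalues g A ((extChartAt I c).symm x) =
      ((operatorInChart g A c x : E →ₗ[ℝ] E).charpoly.map (algebraMap ℝ ℂ)).roots := by
  rw [← charpoly_eq_of_intertwining (isInvertible_chartDeriv hx)
    (chartDeriv_operatorInChart g A hx)]
  rfl

theorem injective_operatorInChart (hx : x ∈ (interiorChart I c).target)
    (h : Function.Injective (magneticOperator g A ((extChartAt I c).symm x))) :
    Function.Injective (operatorInChart g A c x) := by
  intro X Y hXY
  refine (isInvertible_chartDeriv hx).injective (h ?_)
  have := congrArg (chartDeriv I c x) hXY
  rw [chartDeriv_operatorInChart g A hx, chartDeriv_operatorInChart g A hx] at this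
  exact this

theorem dualNormSq_eq (q : M) (p : TangentSpace I q →L[ℝ] ℝ) :
    dualNormSq g q p = p (sharp g q p) := by
  rw [dualNormSq, inner_sharp]

/-- The Hamiltonian in canonical coordinates. -/
theorem hamiltonian_chart (ζ : CotangentBundle I M) {y : E × (E →L[ℝ] ℝ)}
    (hy : y.1 ∈ (interiorChart I ζ.1).target) :
    hamiltonian g A ((extChartAt (I.prod 𝓘(ℝ, E →L[ℝ] ℝ)) ζ).symm y) =
      (y.2 - oneFormInChart I (fun q => A q) ζ.1 y.1)
        ((metricInChart g ζ.1 y.1).inverse (y.2 - oneFormInChart I (fun q => A q) ζ.1 y.1)) := by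
  have hproj := cotangent_extChartAt_symm_proj ζ (y := y) (interior_subset hy)
  have hsnd := cotangent_extChartAt_symm_snd ζ (y := y) (interior_subset hy)
  rw [mfderivWithin_extChartAt_symm_eq I hy] at hsnd
  have ha := pullbackOneForm_extChartAt_symm I (fun q => A q) hy
  generalize (extChartAt (I.prod 𝓘(ℝ, E →L[ℝ] ℝ)) ζ).symm y = ξ at hproj hsnd
  obtain ⟨q, p⟩ := ξ
  change q = _ at hproj
  subst hproj
  rw [hamiltonian, dualNormSq_eq]
  have hℓ : ∀ X, (y.2 - oneFormInChart I (fun q => A q) ζ.1 y.1) X =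
      (p - A ((extChartAt I ζ.1).symm y.1) : E →L[ℝ] ℝ) (chartDeriv I ζ.1 y.1 X) := by
    intro X
    rw [← ha, sub_apply, ← hsnd]
    rfl
  rw [hℓ, chartDeriv_inverse_metricInChart g hy hℓ]

end Metric

section Symplectomorphisms

variable {E : Type*} [NormedAddCommGroup E] [NormedSpace ℝ E]
  {H : Type*} [TopologicalSpace H] {I : ModelWithCorners ℝ E H}
  {M : Type*} [TopologicalSpace M] [ChartedSpace H M]
  {F : Type*} [NormedAddCommGroup F] [NormedSpace ℝ F]

/-- A diffeomorphism onto an open subset of a vector space, with constant form, is symplectic as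
soon as its inverse is. -/
theorem isSymplectomorphism_of_symm [IsManifold I ∞ M] {φ : OpenPartialHomeomorph M F}
    (h : ContMDiffOn I 𝓘(ℝ, F) ∞ φ φ.source) (h' : ContMDiffOn 𝓘(ℝ, F) I ∞ φ.symm φ.target)
    {σ : ∀ q : M, TangentSpace I q → TangentSpace I q → ℝ} {τ : F → F → ℝ}
    (hσ : ∀ w ∈ φ.target, ∀ X Y : F, σ (φ.symm w) (mfderiv 𝓘(ℝ, F) I φ.symm w X)
      (mfderiv 𝓘(ℝ, F) I φ.symm w Y) = τ X Y) :
    IsSymplectomorphism I 𝓘(ℝ, F) φ σ (fun _ => τ) := by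
  have : IsManifold I 1 M := IsManifold.of_le (n := ∞) (by simp)
  have hd : φ.MDifferentiable I 𝓘(ℝ, F) :=
    ⟨h.mdifferentiableOn (by simp), h'.mdifferentiableOn (by simp)⟩
  refine ⟨h, h', fun q hq => ?_⟩
  obtain ⟨w, hw, rfl⟩ : ∃ w ∈ φ.target, φ.symm w = q := ⟨φ q, φ.map_source hq, φ.left_inv hq⟩
  intro X Y
  obtain ⟨X, rfl⟩ := hd.symm.mfderiv_surjective hw X
  obtain ⟨Y, rfl⟩ := hd.symm.mfderiv_surjective hw Y
  have hinv : ∀ Z : F, mfderiv I 𝓘(ℝ, F) φ (φ.symm w) (mfderiv 𝓘(ℝ, F) I φ.symm w Z) = Z :=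
    fun Z => congrArg (fun L : F →L[ℝ] F => L Z) (hd.comp_symm_deriv hw)
  exact (congrArg₂ τ (hinv X) (hinv Y)).trans (hσ w hw X Y).symm

variable [IsManifold I ∞ M]

/-- Darboux coordinates for the coordinate expression of the magnetic form give Darboux coordinates
on the manifold. -/
theorem isSymplectomorphism_trans_interiorChart [FiniteDimensional ℝ E] (A : OneForm I M)
    (c : M) {n : ℕ} {χ : OpenPartialHomeomorph E (PhaseSpace n)}
    (hχO : χ.source ⊆ (interiorChart I c).target)
    (hχ : ContDiffOn ℝ ∞ χ χ.source) (hχ' : ContDiffOn ℝ ∞ χ.symm χ.target)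
    (hform : ∀ w ∈ χ.target, ∀ X Y, dForm (oneFormInChart I (fun q => A q) c) (χ.symm w)
      (fderiv ℝ χ.symm w X) (fderiv ℝ χ.symm w Y) = stdForm n X Y) {Ω : Set M} (hΩ : IsOpen Ω) :
    IsSymplectomorphism I 𝓘(ℝ, PhaseSpace n) (((interiorChart I c).trans χ).restrOpen Ω hΩ)
      (fun q X Y => magneticForm A q X Y) (fun _ => stdForm n) := by
  have hsrc : (((interiorChart I c).trans χ).restrOpen Ω hΩ).source ⊆
      (interiorChart I c).source ∩ interiorChart I c ⁻¹' χ.source := by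
    rw [OpenPartialHomeomorph.restrOpen_source, OpenPartialHomeomorph.trans_source]
    exact inter_subset_left
  have htgt : (((interiorChart I c).trans χ).restrOpen Ω hΩ).target ⊆ χ.target :=
    fun w hw => by
      have h : w ∈ ((interiorChart I c).trans χ).target := hw.1
      rw [OpenPartialHomeomorph.trans_target] at h
      exact h.1
  have hmaps : ∀ w ∈ χ.target, χ.symm w ∈ (interiorChart I c).target := fun w hw =>
    hχO (χ.map_target hw)
  refine isSymplectomorphism_of_symm ?_ ?_ fun w hw X Y => ?_
  · exact hχ.contMDiffOn.comp ((contMDiffOn_interiorChart I c).mono fun q hq => (hsrc hq).1)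
      fun q hq => (hsrc hq).2
  · exact (contMDiffOn_interiorChart_symm I c).comp (hχ'.contMDiffOn.mono htgt)
      fun w hw => hmaps w (htgt hw)
  · have hw' := htgt hw
    have hd : MDifferentiableAt 𝓘(ℝ, E) I (extChartAt I c).symm (χ.symm w) :=
      ((contMDiffOn_interiorChart_symm I c).contMDiffAt
        ((interiorChart I c).open_target.mem_nhds (hmaps w hw'))).mdifferentiableAt (by simp)
    have hd' : DifferentiableAt ℝ χ.symm w :=
      (hχ'.contDiffAt (χ.open_target.mem_nhds hw')).differentiableAt (by simp)
    have hm := (hd.hasMFDerivAt.comp w hd'.hasFDerivAt.hasMFDerivAt).mfderiv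
    have h := magneticForm_chart A (hmaps w hw') (fderiv ℝ χ.symm w X) (fderiv ℝ χ.symm w Y)
    rw [hform w hw'] at h
    rw [← h]
    change magneticForm A _ (mfderiv 𝓘(ℝ, PhaseSpace n) I ((extChartAt I c).symm ∘ χ.symm) w X)
      (mfderiv 𝓘(ℝ, PhaseSpace n) I ((extChartAt I c).symm ∘ χ.symm) w Y) = _
    rw [hm]
    rfl

theorem prod_subset_interiorChart_target (ζ : CotangentBundle I M) :
    (interiorChart I ζ.1).target ×ˢ univ ⊆
      (interiorChart (I.prod 𝓘(ℝ, E →L[ℝ] ℝ)) ζ).target := by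
  rw [interiorChart_target, interiorChart_target, cotangent_extChartAt_target, interior_prod_eq,
    interior_univ]

/-- A symplectic map to `E × E*` followed by canonical coordinates is symplectic. -/
theorem isSymplectomorphism_trans_interiorChart_symm (ζ : CotangentBundle I M) {n : ℕ}
    {Φ : OpenPartialHomeomorph (PhaseSpace n × PhaseSpace n) (E × (E →L[ℝ] ℝ))}
    (hΦ : ContDiffOn ℝ ∞ Φ Φ.source) (hΦ' : ContDiffOn ℝ ∞ Φ.symm Φ.target)
    (hform : ∀ p ∈ Φ.source, ∀ X Y, (fderiv ℝ Φ p X).2 (fderiv ℝ Φ p Y).1 -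
      (fderiv ℝ Φ p Y).2 (fderiv ℝ Φ p X).1 = prodForm n X Y) :
    IsSymplectomorphism 𝓘(ℝ, PhaseSpace n × PhaseSpace n) (I.prod 𝓘(ℝ, E →L[ℝ] ℝ))
      (Φ.trans (interiorChart (I.prod 𝓘(ℝ, E →L[ℝ] ℝ)) ζ).symm)
      (fun _ => prodForm n) (canonicalForm I M) := by
  have hsrc : ∀ p ∈ (Φ.trans (interiorChart (I.prod 𝓘(ℝ, E →L[ℝ] ℝ)) ζ).symm).source,
      p ∈ Φ.source ∧ Φ p ∈ (interiorChart (I.prod 𝓘(ℝ, E →L[ℝ] ℝ)) ζ).target := fun p hp => by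
    rw [OpenPartialHomeomorph.trans_source] at hp
    exact hp
  have htgt : ∀ q ∈ (Φ.trans (interiorChart (I.prod 𝓘(ℝ, E →L[ℝ] ℝ)) ζ).symm).target,
      q ∈ (interiorChart (I.prod 𝓘(ℝ, E →L[ℝ] ℝ)) ζ).source ∧
        interiorChart (I.prod 𝓘(ℝ, E →L[ℝ] ℝ)) ζ q ∈ Φ.target := fun q hq => by
    rw [OpenPartialHomeomorph.trans_target] at hq
    exact hq
  refine ⟨?_, ?_, fun p hp X Y => ?_⟩
  · exact (contMDiffOn_interiorChart_symm _ ζ).comp (hΦ.contMDiffOn.mono fun p hp => (hsrc p hp).1)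
      fun p hp => (hsrc p hp).2
  · exact hΦ'.contMDiffOn.comp ((contMDiffOn_interiorChart _ ζ).mono fun q hq => (htgt q hq).1)
      fun q hq => (htgt q hq).2
  · obtain ⟨hp1, hp2⟩ := hsrc p hp
    have hd : MDifferentiableAt 𝓘(ℝ, E × (E →L[ℝ] ℝ)) (I.prod 𝓘(ℝ, E →L[ℝ] ℝ))
        (extChartAt (I.prod 𝓘(ℝ, E →L[ℝ] ℝ)) ζ).symm (Φ p) :=
      ((contMDiffOn_interiorChart_symm _ ζ).contMDiffAt
        ((interiorChart _ ζ).open_target.mem_nhds hp2)).mdifferentiableAt (by simp)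
    have hd' : DifferentiableAt ℝ Φ p :=
      (hΦ.contDiffAt (Φ.open_source.mem_nhds hp1)).differentiableAt (by simp)
    have hm := (hd.hasMFDerivAt.comp p hd'.hasFDerivAt.hasMFDerivAt).mfderiv
    rw [← hform p hp1 X Y, ← canonicalForm_chart ζ hp2]
    change canonicalForm I M _ (mfderiv 𝓘(ℝ, PhaseSpace n × PhaseSpace n)
        (I.prod 𝓘(ℝ, E →L[ℝ] ℝ)) ((extChartAt (I.prod 𝓘(ℝ, E →L[ℝ] ℝ)) ζ).symm ∘ Φ) p X)
      (mfderiv 𝓘(ℝ, PhaseSpace n × PhaseSpace n)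
        (I.prod 𝓘(ℝ, E →L[ℝ] ℝ)) ((extChartAt (I.prod 𝓘(ℝ, E →L[ℝ] ℝ)) ζ).symm ∘ Φ) p Y) = _
    rw [hm]
    rfl

theorem image_subset_interior (c : M) {S : Set E} (hS : S ⊆ (interiorChart I c).target) :
    (extChartAt I c).symm '' S ⊆ I.interior M := by
  rintro _ ⟨x, hx, rfl⟩
  have hx' := hS hx
  have hs : (extChartAt I c).symm x ∈ (chartAt H c).source := by
    rw [← extChartAt_source I]
    exact (extChartAt I c).map_target (interior_subset hx')
  refine (I.isInteriorPoint_iff_of_mem_atlas (n := ∞) (by simp) (chart_mem_atlas H c) hs).mpr ?_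
  change extChartAt I c ((extChartAt I c).symm x) ∈ interior (extChartAt I c).target
  rw [(extChartAt I c).right_inv (interior_subset hx')]
  exact hx'

end Symplectomorphisms

end MagneticWell

end

open MagneticWell in
theorem theorem1p1
    {E : Type*} [NormedAddCommGroup E] [NormedSpace ℝ E] [FiniteDimensional ℝ E]
    {H : Type*} [TopologicalSpace H] (I : ModelWithCorners ℝ E H)
    {M : Type*} [TopologicalSpace M] [T2Space M] [ChartedSpace H M] [IsManifold I ∞ M]
    (n : ℕ) (hdim : Module.finrank ℝ E = 2 * n)
    (g : RiemannianMetric I M) (A : OneForm I M)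
    (q₀ : M) (hq₀ : q₀ ∈ I.interior M)
    (hinv : Function.Bijective (magneticOperator g A q₀))
    (hsimple : (magneticEigenvalues g A q₀).Nodup) :
    ∃ (Ω₀ : Set M) (β : Fin n → M → ℝ) (ε₀ : ℝ),
      IsOpen Ω₀ ∧ q₀ ∈ Ω₀ ∧ IsCompact (closure Ω₀) ∧ closure Ω₀ ⊆ I.interior M ∧ 0 < ε₀ ∧
      -- on `Ω₀` the eigenvalues of `𝐁(q)` are simple, equal to `± i β_j(q)`, with `β_j` smooth
      (∀ j, ContMDiffOn I 𝓘(ℝ, ℝ) ∞ (β j) Ω₀) ∧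
      (∀ q ∈ Ω₀, (∀ j, 0 < β j q) ∧ (magneticEigenvalues g A q).Nodup ∧
        magneticEigenvalues g A q =
          ∑ j, {(β j q : ℂ) * Complex.I, -((β j q : ℂ) * Complex.I)}) ∧
      ∀ Ω : Set M, IsOpen Ω → q₀ ∈ Ω → Ω ⊆ Ω₀ → ∀ ε : ℝ, 0 < ε → ε ≤ ε₀ →
        ∃ (φ : OpenPartialHomeomorph M (PhaseSpace n))
          (Φ : OpenPartialHomeomorph (PhaseSpace n × PhaseSpace n) (CotangentBundle I M)),
          -- `φ : (Ω, B) → (V, dη ∧ dy)`, with `V = φ.target`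
          φ.source = Ω ∧
          IsSymplectomorphism I 𝓘(ℝ, PhaseSpace n) φ
            (fun q X Y => magneticForm A q X Y) (fun _ => stdForm n) ∧
          -- `Φ` is a symplectomorphism on an open neighbourhood of `V × {|z| ≤ ε}`
          φ.target ×ˢ Metric.closedBall 0 ε ⊆ Φ.source ∧
          IsSymplectomorphism 𝓘(ℝ, PhaseSpace n × PhaseSpace n) (I.prod 𝓘(ℝ, E →L[ℝ] ℝ)) Φ
            (fun _ => prodForm n) (canonicalForm I M) ∧
          (∀ q ∈ Ω, Φ (φ q, 0) = ⟨q, A q⟩) ∧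
          -- the expansion of the Hamiltonian, locally uniformly in `w`
          ∀ w₀ ∈ φ.target, ∃ C : ℝ, ∀ᶠ w in 𝓝 w₀, ∀ z : PhaseSpace n, ‖z‖ ≤ ε →
            |hamiltonian g A (Φ (w, z)) - ∑ j, β j (φ.symm w) * normSqAt z j|
              ≤ C * ‖z‖ ^ 3 := by
  set D := (interiorChart I q₀).target with hD
  set a := oneFormInChart I (fun q => A q) q₀ with ha
  set x₀ := extChartAt I q₀ q₀ with hx₀
  have hx₀D : x₀ ∈ D := I.isInteriorPoint_iff.mp hq₀
  have hκx₀ : (extChartAt I q₀).symm x₀ = q₀ := (extChartAt I q₀).left_inv (mem_extChartAt_source q₀)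
  have hDt : D ⊆ (extChartAt I q₀).target := interior_subset
  obtain ⟨r, hr, hrD⟩ := Metric.nhds_basis_closedBall.mem_iff.mp
    ((interiorChart I q₀).open_target.mem_nhds hx₀D)
  have hOD : Metric.ball x₀ r ⊆ D := Metric.ball_subset_closedBall.trans hrD
  have hinj : Function.Injective (operatorInChart g A q₀ x₀) :=
    injective_operatorInChart g A hx₀D (by rw [hκx₀]; exact hinv.injective)
  have heig := magneticEigenvalues_chart g A hx₀D
  rw [hκx₀] at heig
  obtain ⟨β, χ, Φ, ε₀, C, hxχ, hχO, hΦO, hε₀, hχ, hχ', hΦ, hΦ', hβ, hβeig, hχform, hΦsrc, hΦform,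
    hΦ0, hbound⟩ := exists_local_normalForm hdim Metric.isOpen_ball (Metric.mem_ball_self hr)
    ((contDiffOn_oneFormInChart A q₀).mono (hOD.trans hDt))
    ((contDiffOn_metricInChart g q₀).mono hOD) (fun x _ => metricInChart_symm g q₀ x)
    (fun x hx X hX => metricInChart_pos g (hOD hx) hX) hinj (by rw [heig] at hsimple; exact hsimple)
  have hχD : χ.source ⊆ D := hχO.trans hOD
  have hsrc : ∀ q ∈ ((interiorChart I q₀).trans χ).source,
      q ∈ (extChartAt I q₀).source ∧ extChartAt I q₀ q ∈ χ.source := fun q hq => by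
    rw [OpenPartialHomeomorph.trans_source] at hq
    exact ⟨hq.1.1, hq.2⟩
  have hcompact : IsCompact ((extChartAt I q₀).symm '' Metric.closedBall x₀ r) :=
    (isCompact_closedBall x₀ r).image_of_continuousOn
      ((continuousOn_extChartAt_symm q₀).mono (hrD.trans hDt))
  have hclosure : closure ((interiorChart I q₀).trans χ).source ⊆
      (extChartAt I q₀).symm '' Metric.closedBall x₀ r :=
    closure_minimal (fun q hq => ⟨extChartAt I q₀ q,
      Metric.ball_subset_closedBall (hχO (hsrc q hq).2), (extChartAt I q₀).left_inv (hsrc q hq).1⟩)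
      hcompact.isClosed
  refine ⟨((interiorChart I q₀).trans χ).source, fun j q => β j (extChartAt I q₀ q), ε₀,
    ((interiorChart I q₀).trans χ).open_source, ?_, hcompact.of_isClosed_subset isClosed_closure
    hclosure, hclosure.trans (image_subset_interior q₀ hrD), hε₀, fun j => ?_, fun q hq => ?_, ?_⟩
  · rw [OpenPartialHomeomorph.trans_source]
    exact ⟨⟨mem_extChartAt_source q₀, hx₀D⟩, hxχ⟩
  · exact (hβ j).contMDiffOn.comp (contMDiffOn_extChartAt.mono fun q hq => by
      rw [← extChartAt_source I]
      exact (hsrc q hq).1) fun q hq => (hsrc q hq).2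
  · obtain ⟨hq1, hq2⟩ := hsrc q hq
    have h := magneticEigenvalues_chart g A (hχD hq2)
    rw [(extChartAt I q₀).left_inv hq1] at h
    rw [h]
    exact hβeig _ hq2
  intro Ω hΩ _ hΩsub ε _ hε
  set φ := ((interiorChart I q₀).trans χ).restrOpen Ω hΩ with hφ
  set Ψ := Φ.trans (interiorChart (I.prod 𝓘(ℝ, E →L[ℝ] ℝ))
    (⟨q₀, A q₀⟩ : CotangentBundle I M)).symm with hΨ
  have hφtgt : φ.target ⊆ χ.target := fun w hw => by
    have h : w ∈ ((interiorChart I q₀).trans χ).target := hw.1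
    rw [OpenPartialHomeomorph.trans_target] at h
    exact h.1
  have hΦD : ∀ p ∈ Φ.source, (Φ p).1 ∈ D := fun p hp => hOD (hΦO _ (Φ.map_source hp))
  have hmem : ∀ w ∈ χ.target, ∀ z : PhaseSpace n, ‖z‖ ≤ ε₀ → (w, z) ∈ Φ.source := fun w hw z hz =>
    hΦsrc ⟨hw, mem_closedBall_zero_iff.mpr hz⟩
  refine ⟨φ, Ψ, inter_eq_right.mpr hΩsub,
    isSymplectomorphism_trans_interiorChart A q₀ hχD hχ hχ' hχform hΩ, ?_,
    isSymplectomorphism_trans_interiorChart_symm _ hΦ hΦ' hΦform, fun q hq => ?_,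
    fun w₀ hw₀ => ⟨C, ?_⟩⟩
  · rintro ⟨w, z⟩ ⟨hw, hz⟩
    have hp := hmem w (hφtgt hw) z ((mem_closedBall_zero_iff.mp hz).trans hε)
    rw [hΨ, OpenPartialHomeomorph.trans_source]
    exact ⟨hp, prod_subset_interiorChart_target _ ⟨hΦD _ hp, mem_univ _⟩⟩
  · obtain ⟨hq1, hq2⟩ := hsrc q (hΩsub hq)
    have h : Ψ (φ q, 0) = (extChartAt (I.prod 𝓘(ℝ, E →L[ℝ] ℝ))
        (⟨q₀, A q₀⟩ : CotangentBundle I M)).symm (Φ (χ (extChartAt I q₀ q), 0)) := rfl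
    rw [h, hΦ0 _ hq2]
    refine (cotangent_extChartAt_symm_oneForm A (⟨q₀, A q₀⟩ : CotangentBundle I M)
      (hχD hq2)).trans ?_
    change (⟨(extChartAt I q₀).symm (extChartAt I q₀ q), _⟩ : CotangentBundle I M) = _
    rw [(extChartAt I q₀).left_inv hq1]
  · filter_upwards [φ.open_target.mem_nhds hw₀] with w hw z hz
    have hw' := hφtgt hw
    have hp := hmem w hw' z (hz.trans hε)
    have h := hamiltonian_chart g A (⟨q₀, A q₀⟩ : CotangentBundle I M) (hΦD _ hp)
    have hs : extChartAt I q₀ (φ.symm w) = χ.symm w :=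
      (extChartAt I q₀).right_inv (hDt (hχD (χ.map_target hw')))
    rw [hs]
    change |hamiltonian g A ((extChartAt (I.prod 𝓘(ℝ, E →L[ℝ] ℝ))
      (⟨q₀, A q₀⟩ : CotangentBundle I M)).symm (Φ (w, z))) - _| ≤ _
    rw [h]
    exact hbound w hw' z (hz.trans hε)
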